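/- Let $\nu\in\mathbb N$, let $V:\mathbb R^\nu\to\mathbb R$ be bounded and $C^1$, let $H=-\tfrac12\Delta+V$, and let $e^{-tH}$ ($t>0$) denote the associated Schrödinger semigroup acting on bounded measurable functions on $\mathbb R^\nu$. Let $\psi_0:\mathbb R^\nu\to\mathbb R$ be bounded and $C^1$, and put $u^{(0)}=\nabla\psi_0$, $\varphi_0=e^{-\psi_0}$, and for $t>0$ $$\varphi(\cdot,t)=e^{-tH}\varphi_0,\qquad u(x,t)=-\varphi(x,t)^{-1}\,\nabla\varphi(x,t).$$ Suppose there exist a measurable function $\Omega:\mathbb R^\nu\to\mathbb R$ and constants $a,b$ with $$e^{-tH}\Omega=\Omega\ \ (t>0),\qquad 0<a\le\Omega(x)\le b\ \ (x\in\mathbb R^\nu),\qquad \lim_{t\to\infty}\bigl\|\nabla\bigl(\varphi(\cdot,t)/\Omega\bigr)\bigr\|_\infty=0.$$ Then $\Omega$ and $\varphi(\cdot,t)$ ($t>0$) are $C^1$, $\varphi(\cdot,t)>0$, the function $u$ is continuous on $(0,\infty)\times\mathbb R^\nu$ and is a (distributional) solution for $t>0$ of the forced Burgers equation $$\frac{\partial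 u_i}{\partial t}+\sum_{j=1}^\nu u_j\frac{\partial u_j}{\partial x_i}=\tfrac12\Delta u_i+\frac{\partial V}{\partial x_i},\qquad i=1,\dots,\nu,$$ where the nonlinear term is read as $\partial_{x_i}(\tfrac12|u|^2)$, with $u(\cdot,t)\to u^{(0)}$ locally uniformly as $t\downarrow0$, and $$\lim_{t\to\infty}\ \sup_{x\in\mathbb R^\nu}\ \bigl|u(x,t)-u_\infty^{(0)}(x)\bigr|=0,\qquad u^{(0)}_\infty=-\Omega^{-1}\nabla\Omega.$$ -/

import Mathlib

open MeasureTheory Filter Set Topology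
open scoped ContDiff ENNReal

noncomputable section

namespace ForcedBurgers

/-- The kernel `(2πt)^{-ν/2} exp(-|z|²/(2t))` of `e^{tΔ/2}` on `ℝ^ν`, for `t > 0`. -/
def heatKernel {ν : ℕ} (t : ℝ) (z : EuclideanSpace ℝ (Fin ν)) : ℝ :=
  (2 * Real.pi * t) ^ (-(ν : ℝ) / 2) * Real.exp (-‖z‖ ^ 2 / (2 * t))

/-- The free semigroup `e^{tΔ/2}`, `t > 0`, acting on bounded measurable functions. -/
def heat {ν : ℕ} (t : ℝ) (f : EuclideanSpace ℝ (Fin ν) → ℝ)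
    (x : EuclideanSpace ℝ (Fin ν)) : ℝ :=
  ∫ y, heatKernel t (x - y) * f y

/-- The terms of the Dyson–Phillips series for `H = -Δ/2 + V` with `V` bounded:
`D₀(t) f = e^{tΔ/2} f` and `D_{n+1}(t) f = -∫₀ᵗ e^{(t-s)Δ/2} (V · D_n(s) f) ds`. -/
def dysonTerm {ν : ℕ} (V f : EuclideanSpace ℝ (Fin ν) → ℝ) :
    ℕ → ℝ → EuclideanSpace ℝ (Fin ν) → ℝ
  | 0 => fun t x => heat t f x
  | n + 1 => fun t x => -∫ s in (0 : ℝ)..t, heat (t - s) (fun y => V y * dysonTerm V f n s y) x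

/-- The Schrödinger semigroup `e^{-tH}`, `H = -Δ/2 + V`, `t > 0`, acting on bounded measurable
functions.  As `V` is bounded, it is the Dyson–Phillips perturbation series of the semigroup
`e^{tΔ/2}`; its `n`-th term is bounded by `(t sup|V|)ⁿ / n! · sup|f|`, and its sum is the bounded
solution of `φ(t) = e^{tΔ/2} f - ∫₀ᵗ e^{(t-s)Δ/2} (V φ(s)) ds`. -/
def schrodingerSemigroup {ν : ℕ} (V : EuclideanSpace ℝ (Fin ν) → ℝ) (t : ℝ)
    (f : EuclideanSpace ℝ (Fin ν) → ℝ) (x : EuclideanSpace ℝ (Fin ν)) : ℝ :=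
  ∑' n, dysonTerm V f n t x

/-- `φ(·, t) = e^{-tH} φ₀` with `φ₀ = exp(-ψ₀)`. -/
def colePhi {ν : ℕ} (V ψ₀ : EuclideanSpace ℝ (Fin ν) → ℝ) (t : ℝ) :
    EuclideanSpace ℝ (Fin ν) → ℝ :=
  schrodingerSemigroup V t (fun y => Real.exp (-ψ₀ y))

/-- The vector field `-g⁻¹ ∇g` of a positive differentiable function `g`. -/
def negLogGrad {ν : ℕ} (g : EuclideanSpace ℝ (Fin ν) → ℝ) (x : EuclideanSpace ℝ (Fin ν)) :
    EuclideanSpace ℝ (Fin ν) :=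
  -((g x)⁻¹ • gradient g x)

/-- The partial derivative `∂g/∂xᵢ`. -/
def partialDeriv {ν : ℕ} (i : Fin ν) (g : EuclideanSpace ℝ (Fin ν) → ℝ)
    (x : EuclideanSpace ℝ (Fin ν)) : ℝ :=
  fderiv ℝ g x (EuclideanSpace.single i 1)

/-- `u` solves the forced Burgers equation
`∂u_i/∂t + ∑_j u_j ∂u_j/∂x_i = ½ Δu_i + ∂V/∂x_i` on `t > 0`, in the sense of distributions, with
initial data `u₀`, attained locally uniformly.  The nonlinear term is `∂/∂x_i (½|u|²)`, and
`η` ranges over the smooth test functions with compact support in `(0,∞) × ℝ^ν`. -/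
structure IsBurgersSolution {ν : ℕ} (V : EuclideanSpace ℝ (Fin ν) → ℝ)
    (u₀ : EuclideanSpace ℝ (Fin ν) → EuclideanSpace ℝ (Fin ν))
    (u : ℝ → EuclideanSpace ℝ (Fin ν) → EuclideanSpace ℝ (Fin ν)) : Prop where
  continuousOn : ContinuousOn (fun p : ℝ × EuclideanSpace ℝ (Fin ν) => u p.1 p.2)
    (Ioi 0 ×ˢ univ)
  weak : ∀ (i : Fin ν) (η : ℝ → EuclideanSpace ℝ (Fin ν) → ℝ),
    ContDiff ℝ ∞ (Function.uncurry η) →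
    HasCompactSupport (Function.uncurry η) →
    tsupport (Function.uncurry η) ⊆ Ioi 0 ×ˢ univ →
    ∫ p : ℝ × EuclideanSpace ℝ (Fin ν),
      (u p.1 p.2 i * deriv (fun s => η s p.2) p.1
        + 1 / 2 * ‖u p.1 p.2‖ ^ 2 * partialDeriv i (η p.1) p.2
        + 1 / 2 * u p.1 p.2 i * Laplacian.laplacian (η p.1) p.2
        + partialDeriv i V p.2 * η p.1 p.2) = 0
  initial : TendstoLocallyUniformly u u₀ (𝓝[>] 0)

end ForcedBurgers

end

/-!
The function `u = -∇ log φ` is the Cole–Hopf transform of the solution `φ` of the linear equation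
`∂ₜ φ = ½ Δ φ - V φ`, so formally `∂ₜ log φ = ½ Δ log φ + ½ |∇ log φ|² - V`, and the gradient of
this identity is the forced Burgers equation. The work lies in making sense of it when `V` is only
`C¹` and bounded, and only one spatial derivative of `φ` is under control.

*Representation.* The free semigroup is the Gaussian average `e^{tΔ/2} f (x) = 𝔼 f(x + √t Z)`. Its
gradient is an average of `f` itself, bounded by a multiple of `t^{-1/2} sup |f|`, and this
singularity is integrable. Hence the Dyson–Phillips series satisfies Duhamel's equation
(`schrodingerFlow_eq`), which has only one locally bounded solution (`eq_schrodingerFlow`). For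
`t > 0` it is differentiable in space even if the data are only measurable
(`hasGradientAt_schrodingerFlow`), and `C¹` if they are continuous (`continuousOn_schrodingerGrad`).
As `Ω = e^{-H} Ω`, this makes `Ω` continuous and then `C¹`. For `C¹` data the gradient converges to
the initial one, locally uniformly (`tendsto_schrodingerGrad`).

*Positivity.* For `f ≥ 0` and short times the terms of the series are dominated by the free one, and
the semigroup property covers all times (`schrodingerFlow_nonneg`). Comparing `φ₀ ≥ c Ω` gives
`φ(t) ≥ c Ω ≥ c a > 0` for all `t` (`const_mul_schrodingerFlow_le`).

*The equation.* For a test function `θ`, the increment of `∫ θ log φ` over `[t, t + h]` is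
`∫ (θ / φ(t)) (φ(t + h) - φ(t))` up to a quadratic remainder. The free part of `φ(t + h) - φ(t)` is
symmetrised to a Dirichlet form, which only needs first differences and tends to
`-½ ∫ ∇(θ / φ) · ∇φ` (`tendsto_integral_mul_heatFlow_sub`). The remainder is negligible because the
time increments of `φ` are `o(√h)`: the linear term `√h ⟨∇φ, Z⟩` has mean zero
(`tendsto_inv_sqrt_mul_schrodingerFlow_add_sub`). Integrating in time yields the weak equation for
`log φ` (`integral_fderiv_mul_logFlow`); testing it with `∂ᵢ η` and using `u = -∇ log φ` once more
yields the weak Burgers equation (`integral_burgers_eq_zero`).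

*Long times.* With `w = φ(t) / Ω ≥ c`, the difference `u - u_∞` equals `-w⁻¹ ∇w`, so that
`|u - u_∞| ≤ c⁻¹ ‖∇w‖_∞`, where the essential supremum is a supremum because `∇w` is continuous.
-/

open MeasureTheory Filter Set Topology
open scoped ContDiff ENNReal

noncomputable section

set_option linter.unusedSectionVars false

namespace ForcedBurgers

open ProbabilityTheory

/-! ### The standard Gaussian measure -/

section

variable {E : Type*} [NormedAddCommGroup E] [InnerProductSpace ℝ E] [FiniteDimensional ℝ E]
  [MeasurableSpace E] [BorelSpace E]

/-- The Lebesgue density of the standard Gaussian measure. -/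
def gaussDensity (z : E) : ℝ :=
  (2 * Real.pi) ^ (-(Module.finrank ℝ E : ℝ) / 2) * Real.exp (-‖z‖ ^ 2 / 2)

lemma gaussDensity_nonneg (z : E) : 0 ≤ gaussDensity z := by
  unfold gaussDensity; positivity

lemma continuous_gaussDensity : Continuous (gaussDensity : E → ℝ) := by
  unfold gaussDensity; fun_prop

lemma integrable_exp_neg_mul_sq_norm {b : ℝ} (hb : 0 < b) :
    Integrable (fun z : E => Real.exp (-b * ‖z‖ ^ 2)) := by
  by_contra h
  have h1 := GaussianFourier.integral_rexp_neg_mul_sq_norm (V := E) hb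
  rw [integral_undef h] at h1
  have : (0 : ℝ) < (Real.pi / b) ^ (Module.finrank ℝ E / 2 : ℝ) := by positivity
  linarith

lemma integrable_gaussDensity : Integrable (gaussDensity : E → ℝ) := by
  have := (integrable_exp_neg_mul_sq_norm (E := E) (b := 1 / 2) (by norm_num)).const_mul
    ((2 * Real.pi) ^ (-(Module.finrank ℝ E : ℝ) / 2))
  refine this.congr (Eventually.of_forall fun z => ?_)
  simp only [gaussDensity]
  ring_nf

lemma stdGaussian_eq_withDensity :
    stdGaussian E = volume.withDensity (fun z => ENNReal.ofReal (gaussDensity z)) := by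
  have hfin : IsFiniteMeasure
      ((volume : Measure E).withDensity (fun z => ENNReal.ofReal (gaussDensity z))) :=
    isFiniteMeasure_withDensity_ofReal integrable_gaussDensity.2
  apply Measure.ext_of_charFun
  ext t
  rw [charFun_stdGaussian, charFun_apply]
  rw [integral_withDensity_eq_integral_toReal_smul
    (by exact (continuous_gaussDensity.measurable).ennreal_ofReal) (by simp)]
  have h1 := GaussianFourier.integral_cexp_neg_mul_sq_norm_add (V := E) (b := 1 / 2) (by norm_num)
    Complex.I t
  have h2 : ∀ x : E, (ENNReal.ofReal (gaussDensity x)).toReal •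
      Complex.exp ((inner ℝ x t : ℝ) * Complex.I) =
      (((2 * Real.pi) ^ (-(Module.finrank ℝ E : ℝ) / 2) : ℝ) : ℂ) *
      Complex.exp (-(1 / 2) * ‖x‖ ^ 2 + Complex.I * (inner ℝ t x : ℝ)) := by
    intro x
    rw [ENNReal.toReal_ofReal (gaussDensity_nonneg x), gaussDensity, Complex.exp_add,
      real_inner_comm, Complex.real_smul, Complex.ofReal_mul, Complex.ofReal_exp, mul_assoc]
    congr 2
    · push_cast; ring_nf
    · ring_nf
  simp_rw [h2]
  rw [integral_const_mul, h1, show (Real.pi : ℂ) / (1 / 2) = ((2 * Real.pi : ℝ) : ℂ) by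
    push_cast; ring,
    show ((Module.finrank ℝ E : ℂ) / 2) = (((Module.finrank ℝ E : ℝ) / 2 : ℝ) : ℂ) by
      push_cast; rfl,
    ← Complex.ofReal_cpow (by positivity), ← mul_assoc, ← Complex.ofReal_mul,
    ← Real.rpow_add (by positivity),
    show -(Module.finrank ℝ E : ℝ) / 2 + (Module.finrank ℝ E : ℝ) / 2 = 0 by ring, Real.rpow_zero]
  simp
  ring_nf

lemma integral_stdGaussian {G : Type*} [NormedAddCommGroup G] [NormedSpace ℝ G] (F : E → G) :
    ∫ z, F z ∂(stdGaussian E) = ∫ z, gaussDensity z • F z := by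
  rw [stdGaussian_eq_withDensity, integral_withDensity_eq_integral_toReal_smul
    (by exact (continuous_gaussDensity.measurable).ennreal_ofReal) (by simp)]
  simp_rw [ENNReal.toReal_ofReal (gaussDensity_nonneg _)]

lemma integrable_norm_pow_stdGaussian (k : ℕ) :
    Integrable (fun z => ‖z‖ ^ k) (stdGaussian E) := by
  have h := (IsGaussian.memLp_id (stdGaussian E) k (by simp)).integrable_norm_pow'
  simpa using h

lemma integrable_norm_stdGaussian : Integrable (fun z => ‖z‖) (stdGaussian E) := by
  simpa using integrable_norm_pow_stdGaussian (E := E) 1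

lemma integral_inner_mul_inner_stdGaussian (v w : E) :
    ∫ z, (inner ℝ v z : ℝ) * inner ℝ w z ∂(stdGaussian E) = inner ℝ v w := by
  have h := covarianceBilin_apply (μ := stdGaussian E) IsGaussian.memLp_two_id v w
  rw [covarianceBilin_stdGaussian] at h
  simpa using h.symm.trans (innerSL_apply_apply ℝ v w)

lemma integral_inner_smul_stdGaussian (v : E) :
    ∫ z, (inner ℝ v z : ℝ) • z ∂(stdGaussian E) = v := by
  have hi : Integrable (fun z : E => (inner ℝ v z : ℝ) • z) (stdGaussian E) := by
    refine ((integrable_norm_pow_stdGaussian (E := E) 2).const_mul ‖v‖).mono'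
      (by fun_prop) (Eventually.of_forall fun z => ?_)
    rw [norm_smul]
    have := norm_inner_le_norm (𝕜 := ℝ) v z
    nlinarith [norm_nonneg z]
  refine ext_inner_left ℝ fun w => ?_
  rw [← integral_inner hi]
  simp_rw [inner_smul_right]
  rw [integral_inner_mul_inner_stdGaussian, real_inner_comm]

lemma map_neg_stdGaussian : (stdGaussian E).map (fun z => -z) = stdGaussian E :=
  stdGaussian_map (LinearIsometryEquiv.neg ℝ)

/-- Stability: `√s Z + √t Z'` has the law of `√(s + t) Z`. -/
lemma map_add_stdGaussian {s t : ℝ} (hs : 0 ≤ s) (ht : 0 ≤ t) :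
    ((stdGaussian E).prod (stdGaussian E)).map (fun p => √s • p.1 + √t • p.2) =
      (stdGaussian E).map (fun z => √(s + t) • z) := by
  have h0 : ((stdGaussian E).prod (stdGaussian E)).map (fun p => √s • p.1 + √t • p.2) =
      ((stdGaussian E).map (fun z => √s • z)) ∗ ((stdGaussian E).map (fun z => √t • z)) := by
    rw [Measure.conv, Measure.map_prod_map _ _ (by fun_prop) (by fun_prop),
      Measure.map_map (by fun_prop) (by fun_prop)]
    rfl
  rw [h0]
  apply Measure.ext_of_charFun
  ext u
  rw [charFun_conv, charFun_map_smul, charFun_map_smul, charFun_map_smul]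
  simp only [charFun_stdGaussian, norm_smul, ← Complex.exp_add]
  simp only [Real.norm_eq_abs, Complex.ofReal_mul, mul_pow]
  simp only [← Complex.ofReal_pow, sq_abs, Real.sq_sqrt hs, Real.sq_sqrt ht,
    Real.sq_sqrt (add_nonneg hs ht)]
  congr 1
  push_cast
  ring

lemma hasFDerivAt_gaussDensity (z : E) :
    HasFDerivAt gaussDensity (-gaussDensity z • innerSL ℝ z) z := by
  have h := ((((hasStrictFDerivAt_norm_sq z).hasFDerivAt.const_mul (-1 / 2 : ℝ)).exp).const_mul
    ((2 * Real.pi) ^ (-(Module.finrank ℝ E : ℝ) / 2)))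
  have h1 : (gaussDensity : E → ℝ) = fun z => (2 * Real.pi) ^ (-(Module.finrank ℝ E : ℝ) / 2) *
      Real.exp (-1 / 2 * ‖z‖ ^ 2) := by
    ext z; simp only [gaussDensity]; ring_nf
  rw [h1]
  convert! h using 1
  ext v
  simp
  ring

lemma gaussDensity_sub_le {u z : E} (hu : ‖u‖ ≤ 1) :
    gaussDensity (z - u) * ‖z - u‖ ≤
      (2 * Real.pi) ^ (-(Module.finrank ℝ E : ℝ) / 2) * Real.exp 3 *
        Real.exp (-(1 / 8) * ‖z‖ ^ 2) := by
  have h1 : ‖z‖ ≤ ‖z - u‖ + 1 := by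
    calc ‖z‖ = ‖(z - u) + u‖ := by simp
      _ ≤ _ := (norm_add_le _ _).trans (by linarith)
  have h2 : ‖z - u‖ ≤ Real.exp ‖z - u‖ := by linarith [Real.add_one_le_exp ‖z - u‖]
  unfold gaussDensity
  rw [mul_assoc, mul_assoc]
  refine mul_le_mul_of_nonneg_left ?_ (by positivity)
  calc Real.exp (-‖z - u‖ ^ 2 / 2) * ‖z - u‖
      ≤ Real.exp (-‖z - u‖ ^ 2 / 2) * Real.exp ‖z - u‖ := by gcongr
    _ = Real.exp (-‖z - u‖ ^ 2 / 2 + ‖z - u‖) := (Real.exp_add _ _).symm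
    _ ≤ Real.exp (3 + -(1 / 8) * ‖z‖ ^ 2) := by
        refine Real.exp_le_exp.2 ?_
        have h3 : ‖z‖ ^ 2 ≤ (‖z - u‖ + 1) ^ 2 := by gcongr
        nlinarith [sq_nonneg (‖z - u‖ - 2)]
    _ = _ := Real.exp_add _ _

/-- Translating the argument under a Gaussian integral is smoothing: the derivative falls on the
density, so that only boundedness of `F` is needed. -/
lemma hasFDerivAt_integral_add_stdGaussian {F : E → ℝ} (hF : Measurable F) {C : ℝ}
    (hC : ∀ z, |F z| ≤ C) :
    HasFDerivAt (fun u => ∫ z, F (z + u) ∂(stdGaussian E))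
      (∫ z, F z • innerSL ℝ z ∂(stdGaussian E)) 0 := by
  have h1 : (fun u => ∫ z, F (z + u) ∂(stdGaussian E)) =
      fun u => ∫ z, gaussDensity (z - u) * F z := by
    ext u
    rw [integral_stdGaussian,
      ← integral_add_right_eq_self (fun z => gaussDensity (z - u) * F z) u]
    simp
  have hC0 : 0 ≤ C := (abs_nonneg _).trans (hC 0)
  rw [h1, integral_stdGaussian]
  have key := hasFDerivAt_integral_of_dominated_of_fderiv_le (μ := (volume : Measure E)) (𝕜 := ℝ)
    (F := fun u z => gaussDensity (z - u) * F z)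
    (F' := fun u z => F z • (gaussDensity (z - u) • innerSL ℝ (z - u)))
    (x₀ := 0) (s := Metric.ball 0 1)
    (bound := fun z => C * ((2 * Real.pi) ^ (-(Module.finrank ℝ E : ℝ) / 2) * Real.exp 3 *
        Real.exp (-(1 / 8) * ‖z‖ ^ 2)))
    (Metric.ball_mem_nhds _ one_pos) ?_ ?_ ?_ ?_ ?_ ?_
  · refine key.congr_fderiv ?_
    congr 1
    ext z : 1
    simp [smul_smul, mul_comm]
  · refine Eventually.of_forall fun u => ?_
    have := (continuous_gaussDensity (E := E)).measurable
    exact ((this.comp (measurable_id.sub_const u)).mul hF).aestronglyMeasurable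
  · refine (integrable_gaussDensity.mul_const C).mono' ?_ (Eventually.of_forall fun z => ?_)
    · have := (continuous_gaussDensity (E := E)).measurable
      exact ((this.comp (measurable_id.sub_const 0)).mul hF).aestronglyMeasurable
    · rw [norm_mul, sub_zero, Real.norm_of_nonneg (gaussDensity_nonneg z)]
      exact mul_le_mul_of_nonneg_left (hC z) (gaussDensity_nonneg z)
  · refine hF.aestronglyMeasurable.smul ?_
    have := (continuous_gaussDensity (E := E))
    refine Continuous.aestronglyMeasurable ?_
    fun_prop
  · refine Eventually.of_forall fun z u hu => ?_
    rw [norm_smul, norm_smul, innerSL_apply_norm, Real.norm_of_nonneg (gaussDensity_nonneg _)]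
    exact mul_le_mul (hC z) (gaussDensity_sub_le (mem_ball_zero_iff.1 hu).le)
      (mul_nonneg (gaussDensity_nonneg _) (norm_nonneg _)) hC0
  · exact ((integrable_exp_neg_mul_sq_norm (by norm_num)).const_mul _).const_mul _
  · refine Eventually.of_forall fun z u hu => ?_
    have h := ((hasFDerivAt_gaussDensity (z - u)).comp u
      ((hasFDerivAt_id u).const_sub z)).mul_const (F z)
    refine h.congr_fderiv ?_
    ext v
    simp

end

/-! ### The free semigroup as a Gaussian average -/

section

variable {E : Type*} [NormedAddCommGroup E] [InnerProductSpace ℝ E] [FiniteDimensional ℝ E]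
  [MeasurableSpace E] [BorelSpace E]

/-- The free semigroup `e^{tΔ/2}` as the average `𝔼 f(x + √t Z)` over a standard Gaussian vector.
Since `√t = 0` for `t ≤ 0`, it is the identity for such `t`. -/
def heatFlow (t : ℝ) (f : E → ℝ) (x : E) : ℝ :=
  ∫ z, f (x + √t • z) ∂(stdGaussian E)

lemma heat_eq_heatFlow {ν : ℕ} {t : ℝ} (ht : 0 < t) (f : EuclideanSpace ℝ (Fin ν) → ℝ)
    (x : EuclideanSpace ℝ (Fin ν)) : heat t f x = heatFlow t f x := by
  have hs : 0 < √t := Real.sqrt_pos.2 ht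
  rw [heat, heatFlow, integral_stdGaussian,
    ← integral_add_left_eq_self (fun y => heatKernel t (x - y) * f y) x]
  have h1 := Measure.integral_comp_smul (volume : Measure (EuclideanSpace ℝ (Fin ν)))
    (fun y => heatKernel t (x - (x + y)) * f (x + y)) (√t)
  have h2 : ∫ y, heatKernel t (x - (x + y)) * f (x + y) =
      (√t) ^ ν • ∫ z, heatKernel t (x - (x + √t • z)) * f (x + √t • z) := by
    rw [h1, smul_smul]
    simp only [finrank_euclideanSpace, Fintype.card_fin]
    rw [abs_of_pos (by positivity), mul_inv_cancel₀ (by positivity), one_smul]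
  rw [h2, ← integral_smul]
  congr 1
  ext z
  have h3 : ‖x - (x + √t • z)‖ ^ 2 = t * ‖z‖ ^ 2 := by
    rw [sub_add_cancel_left, norm_neg, norm_smul, mul_pow, Real.norm_of_nonneg hs.le,
      Real.sq_sqrt ht.le]
  have h4 : (√t) ^ ν * t ^ (-(ν : ℝ) / 2) = 1 := by
    rw [Real.sqrt_eq_rpow, ← Real.rpow_natCast, ← Real.rpow_mul ht.le, ← Real.rpow_add ht]
    rw [show 1 / 2 * (ν : ℝ) + -(ν : ℝ) / 2 = 0 by ring, Real.rpow_zero]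
  simp only [heatKernel, gaussDensity, smul_eq_mul, finrank_euclideanSpace, Fintype.card_fin]
  have h5 : -‖x - (x + √t • z)‖ ^ 2 = -(t * ‖z‖ ^ 2) := by rw [h3]
  rw [h5, Real.mul_rpow (by positivity) ht.le,
    show -(t * ‖z‖ ^ 2) / (2 * t) = -‖z‖ ^ 2 / 2 by field_simp]
  linear_combination ((2 * Real.pi) ^ (-(ν : ℝ) / 2) * Real.exp (-‖z‖ ^ 2 / 2) *
    f (x + √t • z)) * h4

lemma measurable_add_sqrt_smul (t : ℝ) (x : E) : Measurable (fun z : E => x + √t • z) := by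
  fun_prop

lemma integrable_comp_add_sqrt_smul {f : E → ℝ} (hf : Measurable f) {C : ℝ} (hC : ∀ x, |f x| ≤ C)
    (t : ℝ) (x : E) : Integrable (fun z => f (x + √t • z)) (stdGaussian E) :=
  (integrable_const C).mono' (hf.comp (measurable_add_sqrt_smul t x)).aestronglyMeasurable
    (Eventually.of_forall fun _ => hC _)

lemma abs_heatFlow_le {f : E → ℝ} {C : ℝ} (hC : ∀ x, |f x| ≤ C) (t : ℝ) (x : E) :
    |heatFlow t f x| ≤ C := by
  have := norm_integral_le_of_norm_le_const (μ := stdGaussian E)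
    (f := fun z => f (x + √t • z)) (Eventually.of_forall fun z => hC _)
  simpa [heatFlow] using this

lemma heatFlow_nonneg {f : E → ℝ} (hf : ∀ x, 0 ≤ f x) (t : ℝ) (x : E) : 0 ≤ heatFlow t f x :=
  integral_nonneg fun _ => hf _

lemma heatFlow_sub {f g : E → ℝ} (hf : Measurable f) (hg : Measurable g) {C D : ℝ}
    (hC : ∀ x, |f x| ≤ C) (hD : ∀ x, |g x| ≤ D) (t : ℝ) (x : E) :
    heatFlow t (fun y => f y - g y) x = heatFlow t f x - heatFlow t g x :=
  integral_sub (integrable_comp_add_sqrt_smul hf hC t x) (integrable_comp_add_sqrt_smul hg hD t x)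

lemma heatFlow_const_mul (c : ℝ) (f : E → ℝ) (t : ℝ) (x : E) :
    heatFlow t (fun y => c * f y) x = c * heatFlow t f x :=
  integral_const_mul _ _

lemma heatFlow_of_nonpos {t : ℝ} (ht : t ≤ 0) (f : E → ℝ) (x : E) : heatFlow t f x = f x := by
  simp [heatFlow, Real.sqrt_eq_zero_of_nonpos ht]

lemma measurable_heatFlow_comp {α : Type*} [MeasurableSpace α] {τ : α → ℝ} {H : α → E → ℝ}
    {ξ : α → E} (hτ : Measurable τ) (hH : Measurable (Function.uncurry H)) (hξ : Measurable ξ) :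
    Measurable (fun a => heatFlow (τ a) (H a) (ξ a)) := by
  unfold heatFlow
  refine StronglyMeasurable.measurable ?_
  refine StronglyMeasurable.integral_prod_right (f := fun a z => H a (ξ a + √(τ a) • z)) ?_
  refine Measurable.stronglyMeasurable ?_
  have : Measurable (fun p : α × E => (p.1, ξ p.1 + √(τ p.1) • p.2)) := by fun_prop
  exact hH.comp this

lemma measurable_heatFlow {f : E → ℝ} (hf : Measurable f) (t : ℝ) :
    Measurable (heatFlow t f) :=
  measurable_heatFlow_comp (τ := fun _ : E => t) (H := fun _ => f) (ξ := id) measurable_const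
    (hf.comp measurable_snd) measurable_id

lemma heatFlow_heatFlow {f : E → ℝ} (hf : Measurable f) {C : ℝ} (hC : ∀ x, |f x| ≤ C)
    {s t : ℝ} (hs : 0 ≤ s) (ht : 0 ≤ t) (x : E) :
    heatFlow s (heatFlow t f) x = heatFlow (s + t) f x := by
  have hm : Measurable (fun w => f (x + w)) := hf.comp (measurable_const_add x)
  have h1 : heatFlow (s + t) f x =
      ∫ w, f (x + w) ∂((stdGaussian E).map (fun z => √(s + t) • z)) := by
    rw [integral_map (by fun_prop) hm.aestronglyMeasurable, heatFlow]
  rw [h1, ← map_add_stdGaussian hs ht, integral_map (by fun_prop) hm.aestronglyMeasurable,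
    integral_prod]
  · simp only [heatFlow, add_assoc]
  · refine (integrable_const C).mono' ?_ (Eventually.of_forall fun _ => hC _)
    exact (hm.comp (by fun_prop)).aestronglyMeasurable

/-- The gradient of `e^{tΔ/2} f`, as a Gaussian average of `f` itself. -/
def heatGrad (t : ℝ) (f : E → ℝ) (x : E) : E :=
  ∫ z, ((√t)⁻¹ * f (x + √t • z)) • z ∂(stdGaussian E)

lemma norm_heatGrad_le {f : E → ℝ} {C : ℝ} (hC : ∀ x, |f x| ≤ C) (t : ℝ) (x : E) :
    ‖heatGrad t f x‖ ≤ (√t)⁻¹ * (C * ∫ z : E, ‖z‖ ∂(stdGaussian E)) := by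
  rw [heatGrad, ← integral_const_mul, ← integral_const_mul]
  refine norm_integral_le_of_norm_le
    ((integrable_norm_stdGaussian.const_mul _).const_mul _) (Eventually.of_forall fun z => ?_)
  rw [norm_smul, norm_mul, Real.norm_of_nonneg (by positivity), mul_assoc]
  gcongr
  exact hC _

lemma measurable_heatGrad_comp {α : Type*} [MeasurableSpace α] {τ : α → ℝ} {H : α → E → ℝ}
    {ξ : α → E} (hτ : Measurable τ) (hH : Measurable (Function.uncurry H)) (hξ : Measurable ξ) :
    StronglyMeasurable (fun a => heatGrad (τ a) (H a) (ξ a)) := by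
  unfold heatGrad
  refine StronglyMeasurable.integral_prod_right
    (f := fun a z => ((√(τ a))⁻¹ * H a (ξ a + √(τ a) • z)) • z) ?_
  have : Measurable (fun p : α × E => (p.1, ξ p.1 + √(τ p.1) • p.2)) := by fun_prop
  have h2 : Measurable (fun p : α × E => (√(τ p.1))⁻¹ * H p.1 (ξ p.1 + √(τ p.1) • p.2)) :=
    (by fun_prop : Measurable (fun p : α × E => (√(τ p.1))⁻¹)).mul (hH.comp this)
  exact (h2.smul measurable_snd).stronglyMeasurable

lemma hasGradientAt_heatFlow {f : E → ℝ} (hf : Measurable f) {C : ℝ} (hC : ∀ x, |f x| ≤ C)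
    {t : ℝ} (ht : 0 < t) (x : E) : HasGradientAt (heatFlow t f) (heatGrad t f x) x := by
  have hs : 0 < √t := Real.sqrt_pos.2 ht
  have hm : Measurable (fun z => f (x + √t • z)) := hf.comp (measurable_add_sqrt_smul t x)
  have h1 := hasFDerivAt_integral_add_stdGaussian hm (C := C) (fun z => hC _)
  have h2 : heatFlow t f =
      (fun u => ∫ z, f (x + √t • (z + u)) ∂(stdGaussian E)) ∘ (fun y => (√t)⁻¹ • (y - x)) := by
    ext y
    simp only [heatFlow, Function.comp]
    congr 1
    ext z
    rw [smul_add, smul_smul, mul_inv_cancel₀ hs.ne', one_smul]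
    congr 1
    abel
  have h3 : HasFDerivAt (fun y => (√t)⁻¹ • (y - x)) ((√t)⁻¹ • ContinuousLinearMap.id ℝ E) x :=
    ((hasFDerivAt_id x).sub_const x).const_smul _
  have h1' : HasFDerivAt (fun u => ∫ z, f (x + √t • (z + u)) ∂(stdGaussian E))
      (∫ z, f (x + √t • z) • innerSL ℝ z ∂(stdGaussian E)) ((√t)⁻¹ • (x - x)) := by
    simpa using h1
  have h4 := h1'.comp x h3
  rw [hasGradientAt_iff_hasFDerivAt, h2]
  refine h4.congr_fderiv ?_
  have hi : Integrable (fun z => f (x + √t • z) • z) (stdGaussian E) := by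
    refine (integrable_norm_stdGaussian.const_mul C).mono'
      (hm.aestronglyMeasurable.smul (by fun_prop)) (Eventually.of_forall fun z => ?_)
    rw [norm_smul]
    gcongr
    exact hC _
  have h5 : ∫ z, f (x + √t • z) • innerSL ℝ z ∂(stdGaussian E) =
      innerSL ℝ (∫ z, f (x + √t • z) • z ∂(stdGaussian E)) := by
    rw [← ContinuousLinearMap.integral_comp_comm _ hi]
    simp
  have h6 : heatGrad t f x = (√t)⁻¹ • ∫ z, f (x + √t • z) • z ∂(stdGaussian E) := by
    rw [heatGrad, ← integral_smul]
    simp only [smul_smul]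
  rw [h5, h6]
  ext v
  simp

end

/-! ### Duhamel's integral -/

section

variable {E : Type*} [NormedAddCommGroup E] [InnerProductSpace ℝ E] [FiniteDimensional ℝ E]
  [MeasurableSpace E] [BorelSpace E]

/-- Boundedness in space, locally uniformly in time. -/
def TimeLocallyBounded (h : ℝ → E → ℝ) : Prop :=
  ∀ T : ℝ, ∃ C : ℝ, ∀ s, |s| ≤ T → ∀ y, |h s y| ≤ C

lemma TimeLocallyBounded.mul_left {h : ℝ → E → ℝ} (hh : TimeLocallyBounded h) {V : E → ℝ} {M : ℝ}
    (hV : ∀ x, |V x| ≤ M) : TimeLocallyBounded (fun s y => V y * h s y) := by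
  intro T
  obtain ⟨C, hC⟩ := hh T
  refine ⟨M * C, fun s hs y => ?_⟩
  rw [abs_mul]
  exact mul_le_mul (hV y) (hC s hs y) (abs_nonneg _) ((abs_nonneg _).trans (hV y))

lemma TimeLocallyBounded.sub {h k : ℝ → E → ℝ} (hh : TimeLocallyBounded h)
    (hk : TimeLocallyBounded k) : TimeLocallyBounded (fun s y => h s y - k s y) := by
  intro T
  obtain ⟨C, hC⟩ := hh T
  obtain ⟨D, hD⟩ := hk T
  exact ⟨C + D, fun s hs y => (abs_sub _ _).trans (add_le_add (hC s hs y) (hD s hs y))⟩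

lemma TimeLocallyBounded.comp_add_left {h : ℝ → E → ℝ} (hh : TimeLocallyBounded h) (t : ℝ) :
    TimeLocallyBounded (fun s => h (t + s)) := by
  intro T
  obtain ⟨C, hC⟩ := hh (|t| + T)
  exact ⟨C, fun s hs y => hC _ ((abs_add_le _ _).trans (by linarith)) y⟩

/-- The inhomogeneous term `∫₀ᵗ e^{(t-s)Δ/2} h(s) ds` of Duhamel's formula. -/
def duhamel (h : ℝ → E → ℝ) (t : ℝ) (x : E) : ℝ :=
  ∫ s in (0 : ℝ)..t, heatFlow (t - s) (h s) x

lemma duhamel_eq_mul_integral (h : ℝ → E → ℝ) (t : ℝ) (x : E) :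
    duhamel h t x = t * ∫ σ in (0 : ℝ)..1, heatFlow (t * (1 - σ)) (h (t * σ)) x := by
  have := intervalIntegral.smul_integral_comp_mul_left (a := 0) (b := 1)
    (fun s => heatFlow (t - s) (h s) x) t
  simp only [mul_zero, mul_one, smul_eq_mul] at this
  rw [duhamel, ← this]
  simp only [mul_sub, mul_one]

lemma mul_mem_uIcc_zero {t σ : ℝ} (h0 : 0 ≤ σ) (h1 : σ ≤ 1) : t * σ ∈ uIcc 0 t := by
  rcases le_total 0 t with ht | ht
  · rw [uIcc_of_le ht]
    exact ⟨by positivity, by nlinarith⟩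
  · rw [uIcc_of_ge ht]
    exact ⟨by nlinarith, by nlinarith⟩

lemma abs_le_of_mem_uIcc_zero {t s : ℝ} (hs : s ∈ uIcc 0 t) : |s| ≤ |t| := by
  simpa using abs_sub_left_of_mem_uIcc hs

lemma abs_duhamel_le {h : ℝ → E → ℝ} {t : ℝ} {c : ℝ} {n : ℕ}
    (hc : ∀ s ∈ uIcc 0 t, ∀ y, |h s y| ≤ c * |s| ^ n) (x : E) :
    |duhamel h t x| ≤ c * |t| ^ (n + 1) / (n + 1) := by
  rw [duhamel_eq_mul_integral, abs_mul]
  have h1 : |∫ σ in (0 : ℝ)..1, heatFlow (t * (1 - σ)) (h (t * σ)) x| ≤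
      ∫ σ in (0 : ℝ)..1, c * |t| ^ n * σ ^ n := by
    have hint : IntervalIntegrable (fun σ : ℝ => c * |t| ^ n * σ ^ n) volume 0 1 :=
      Continuous.intervalIntegrable (by fun_prop) _ _
    refine intervalIntegral.norm_integral_le_of_norm_le
      (f := fun σ => heatFlow (t * (1 - σ)) (h (t * σ)) x) zero_le_one
      (Eventually.of_forall fun σ hσ => ?_) hint
    refine abs_heatFlow_le (fun y => ?_) _ _
    refine (hc _ (mul_mem_uIcc_zero hσ.1.le hσ.2) y).trans (le_of_eq ?_)
    rw [abs_mul, abs_of_pos hσ.1, mul_pow, mul_assoc]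
  rw [intervalIntegral.integral_const_mul, integral_pow] at h1
  refine (mul_le_mul_of_nonneg_left h1 (abs_nonneg t)).trans (le_of_eq ?_)
  simp
  ring

lemma intervalIntegrable_heatFlow {h : ℝ → E → ℝ} (hm : Measurable (Function.uncurry h))
    (hb : TimeLocallyBounded h) (τ a b : ℝ) (x : E) :
    IntervalIntegrable (fun s => heatFlow (τ - s) (h s) x) volume a b := by
  obtain ⟨C, hC⟩ := hb (max |a| |b|)
  have hmeas : Measurable (fun s => heatFlow (τ - s) (h s) x) :=
    measurable_heatFlow_comp (by fun_prop) hm measurable_const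
  rw [intervalIntegrable_iff]
  refine Measure.integrableOn_of_bounded (M := C) (by simp)
    hmeas.aestronglyMeasurable ?_
  refine (ae_restrict_iff' measurableSet_uIoc).2 (Eventually.of_forall fun s hs => ?_)
  exact abs_heatFlow_le (hC s (by
    have := uIoc_subset_uIcc hs
    rcases le_total a b with hab | hab
    · rw [uIcc_of_le hab] at this
      exact abs_le_max_abs_abs this.1 this.2
    · rw [uIcc_of_ge hab] at this
      rw [max_comm]
      exact abs_le_max_abs_abs this.1 this.2)) _ _

lemma duhamel_sub {h k : ℝ → E → ℝ} (hm : Measurable (Function.uncurry h))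
    (hb : TimeLocallyBounded h) (km : Measurable (Function.uncurry k))
    (kb : TimeLocallyBounded k) (t : ℝ) (x : E) :
    duhamel (fun s y => h s y - k s y) t x = duhamel h t x - duhamel k t x := by
  rw [duhamel, duhamel, duhamel, ← intervalIntegral.integral_sub
    (intervalIntegrable_heatFlow hm hb t 0 t x) (intervalIntegrable_heatFlow km kb t 0 t x)]
  refine intervalIntegral.integral_congr fun s _ => ?_
  obtain ⟨C, hC⟩ := hb |s|
  obtain ⟨D, hD⟩ := kb |s|
  exact heatFlow_sub (hm.of_uncurry_left) (km.of_uncurry_left) (hC s le_rfl) (hD s le_rfl) _ _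

lemma duhamel_const_mul (c : ℝ) (h : ℝ → E → ℝ) (t : ℝ) (x : E) :
    duhamel (fun s y => c * h s y) t x = c * duhamel h t x := by
  rw [duhamel, duhamel, ← intervalIntegral.integral_const_mul]
  simp only [heatFlow_const_mul]

lemma measurable_duhamel {h : ℝ → E → ℝ} (hm : Measurable (Function.uncurry h)) :
    Measurable (Function.uncurry (duhamel h)) := by
  have h1 : Function.uncurry (duhamel h) = fun p : ℝ × E =>
      p.1 * ∫ σ in (0 : ℝ)..1, heatFlow (p.1 * (1 - σ)) (h (p.1 * σ)) p.2 := by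
    ext p
    exact duhamel_eq_mul_integral h p.1 p.2
  rw [h1]
  refine measurable_fst.mul (StronglyMeasurable.measurable ?_)
  simp only [intervalIntegral.integral_of_le (zero_le_one (α := ℝ))]
  refine StronglyMeasurable.integral_prod_right
    (f := fun (p : ℝ × E) σ => heatFlow (p.1 * (1 - σ)) (h (p.1 * σ)) p.2) ?_
  refine Measurable.stronglyMeasurable ?_
  refine measurable_heatFlow_comp (τ := fun q : (ℝ × E) × ℝ => q.1.1 * (1 - q.2))
    (H := fun q => h (q.1.1 * q.2)) (ξ := fun q => q.1.2) (by fun_prop) ?_ (by fun_prop)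
  exact hm.comp (by fun_prop : Measurable
    (fun r : ((ℝ × E) × ℝ) × E => (r.1.1.1 * r.1.2, r.2)))

lemma continuous_heatFlow_comp {α : Type*} [TopologicalSpace α] [FirstCountableTopology α]
    {τ : α → ℝ} {H : α → E → ℝ} {ξ : α → E} (hτ : Continuous τ)
    (hH : Continuous (Function.uncurry H)) (hξ : Continuous ξ)
    (hb : ∀ a, ∃ C, ∀ᶠ a' in 𝓝 a, ∀ y, |H a' y| ≤ C) :
    Continuous (fun a => heatFlow (τ a) (H a) (ξ a)) := by
  rw [continuous_iff_continuousAt]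
  intro a
  obtain ⟨C, hC⟩ := hb a
  have hcont : Continuous (fun p : α × E => H p.1 (ξ p.1 + √(τ p.1) • p.2)) :=
    hH.comp (by fun_prop : Continuous fun p : α × E => (p.1, ξ p.1 + √(τ p.1) • p.2))
  refine continuousAt_of_dominated (bound := fun _ => C) ?_ ?_ (integrable_const _) ?_
  · refine Eventually.of_forall fun a' => ?_
    exact (hcont.comp (by fun_prop : Continuous fun z : E => (a', z))).aestronglyMeasurable
  · filter_upwards [hC] with a' ha'
    exact Eventually.of_forall fun z => ha' _
  · refine Eventually.of_forall fun z => ?_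
    exact (hcont.comp (by fun_prop : Continuous fun a' : α => (a', z))).continuousAt

lemma continuous_integral_heatFlow {h : ℝ → E → ℝ} (hc : Continuous (Function.uncurry h))
    (hb : TimeLocallyBounded h) : Continuous (fun p : ℝ × E =>
      ∫ σ in (0 : ℝ)..1, heatFlow (p.1 * (1 - σ)) (h (p.1 * σ)) p.2) := by
  refine intervalIntegral.continuous_parametric_intervalIntegral_of_continuous'
    (f := fun (p : ℝ × E) σ => heatFlow (p.1 * (1 - σ)) (h (p.1 * σ)) p.2) ?_ 0 1
  refine continuous_heatFlow_comp (τ := fun q : (ℝ × E) × ℝ => q.1.1 * (1 - q.2))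
    (H := fun q => h (q.1.1 * q.2)) (ξ := fun q => q.1.2) (by fun_prop) ?_ (by fun_prop) ?_
  · exact hc.comp (by fun_prop : Continuous
      (fun r : ((ℝ × E) × ℝ) × E => (r.1.1.1 * r.1.2, r.2)))
  · intro a
    obtain ⟨C, hC⟩ := hb (|a.1.1 * a.2| + 1)
    refine ⟨C, ?_⟩
    have : ContinuousAt (fun q : (ℝ × E) × ℝ => |q.1.1 * q.2|) a := by fun_prop
    filter_upwards [this.eventually (gt_mem_nhds (lt_add_one _))] with q hq
    exact hC _ hq.le

lemma continuous_duhamel {h : ℝ → E → ℝ} (hc : Continuous (Function.uncurry h))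
    (hb : TimeLocallyBounded h) : Continuous (Function.uncurry (duhamel h)) := by
  have h1 : Function.uncurry (duhamel h) = fun p : ℝ × E =>
      p.1 * ∫ σ in (0 : ℝ)..1, heatFlow (p.1 * (1 - σ)) (h (p.1 * σ)) p.2 := by
    ext p
    exact duhamel_eq_mul_integral h p.1 p.2
  rw [h1]
  exact continuous_fst.mul (continuous_integral_heatFlow hc hb)

lemma tendsto_inv_mul_duhamel {h : ℝ → E → ℝ} (hc : Continuous (Function.uncurry h))
    (hb : TimeLocallyBounded h) (x : E) :
    Tendsto (fun t => t⁻¹ * duhamel h t x) (𝓝[>] 0) (𝓝 (h 0 x)) := by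
  have h1 := ((continuous_integral_heatFlow hc hb).comp
    (by fun_prop : Continuous fun t : ℝ => (t, x))).tendsto 0
  simp only [Function.comp, zero_mul, heatFlow_of_nonpos le_rfl,
    intervalIntegral.integral_const, sub_zero, one_smul] at h1
  refine (h1.mono_left nhdsWithin_le_nhds).congr' ?_
  filter_upwards [self_mem_nhdsWithin] with t ht
  have ht0 : t ≠ 0 := ne_of_gt ht
  rw [duhamel_eq_mul_integral, inv_mul_cancel_left₀ ht0, Function.comp]

/-- Duhamel's term over `[0, t + r]`, split at time `t`. -/
lemma duhamel_add {h : ℝ → E → ℝ} (hm : Measurable (Function.uncurry h))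
    (hb : TimeLocallyBounded h) {t r : ℝ} (ht : 0 ≤ t) (hr : 0 ≤ r) (x : E) :
    duhamel h (t + r) x = heatFlow r (duhamel h t) x + duhamel (fun s => h (t + s)) r x := by
  have hI := intervalIntegrable_heatFlow hm hb (t + r)
  have h1 : duhamel h (t + r) x = (∫ s in (0 : ℝ)..t, heatFlow (t + r - s) (h s) x) +
      ∫ s in t..(t + r), heatFlow (t + r - s) (h s) x :=
    (intervalIntegral.integral_add_adjacent_intervals (hI _ _ x) (hI _ _ x)).symm
  have h2 : ∫ s in t..(t + r), heatFlow (t + r - s) (h s) x = duhamel (fun s => h (t + s)) r x := by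
    have := intervalIntegral.integral_comp_add_left (a := 0) (b := r)
      (fun s => heatFlow (t + r - s) (h s) x) t
    rw [add_zero] at this
    rw [← this, duhamel]
    simp only [add_sub_add_left_eq_sub]
  rw [h1, h2]
  congr 1
  obtain ⟨C, hC⟩ := hb t
  have hC' : ∀ s ∈ Ioc 0 t, ∀ y, |h s y| ≤ C := fun s hs y =>
    hC s (by rw [abs_of_pos hs.1]; exact hs.2) y
  have h3 : ∫ s in (0 : ℝ)..t, heatFlow (t + r - s) (h s) x =
      ∫ s in (0 : ℝ)..t, ∫ z, heatFlow (t - s) (h s) (x + √r • z) ∂(stdGaussian E) := by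
    rw [intervalIntegral.integral_of_le ht, intervalIntegral.integral_of_le ht]
    refine setIntegral_congr_fun measurableSet_Ioc fun s hs => ?_
    have := heatFlow_heatFlow (hm.of_uncurry_left (x := s)) (hC' s hs) hr (sub_nonneg.2 hs.2) x
    rw [show t + r - s = r + (t - s) by ring, ← this, heatFlow]
  rw [h3, heatFlow]
  simp only [duhamel, intervalIntegral.integral_of_le ht]
  refine integral_integral_swap ?_
  have hmeas : Measurable (fun p : ℝ × E => heatFlow (t - p.1) (h p.1) (x + √r • p.2)) :=
    measurable_heatFlow_comp (H := fun p : ℝ × E => h p.1) (by fun_prop)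
      (hm.comp (by fun_prop : Measurable fun q : (ℝ × E) × E => (q.1.1, q.2))) (by fun_prop)
  refine (integrable_const C).mono' hmeas.aestronglyMeasurable ?_
  have : ∀ᵐ s ∂(volume.restrict (Ioc 0 t)), ∀ y, |h s y| ≤ C :=
    (ae_restrict_iff' measurableSet_Ioc).2 (Eventually.of_forall hC')
  have h4 := (Measure.quasiMeasurePreserving_fst (μ := volume.restrict (Ioc 0 t))
    (ν := stdGaussian E)).ae this
  filter_upwards [h4] with p hp
  exact abs_heatFlow_le hp _ _

end

/-! ### The Dyson–Phillips series: Duhamel equation, uniqueness, positivity -/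

section

variable {E : Type*} [NormedAddCommGroup E] [InnerProductSpace ℝ E] [FiniteDimensional ℝ E]
  [MeasurableSpace E] [BorelSpace E]

/-- The terms of the Dyson–Phillips series, built on `heatFlow`. -/
def dysonFlow (V f : E → ℝ) : ℕ → ℝ → E → ℝ
  | 0 => fun t x => heatFlow t f x
  | n + 1 => fun t x => -duhamel (fun s y => V y * dysonFlow V f n s y) t x

/-- The Schrödinger semigroup, as the sum of the Dyson–Phillips series built on `heatFlow`. -/
def schrodingerFlow (V f : E → ℝ) (t : ℝ) (x : E) : ℝ :=
  ∑' n, dysonFlow V f n t x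

lemma dysonTerm_eq_dysonFlow {ν : ℕ} (V f : EuclideanSpace ℝ (Fin ν) → ℝ) (n : ℕ) :
    ∀ t : ℝ, 0 < t → dysonTerm V f n t = dysonFlow V f n t := by
  induction n with
  | zero => exact fun t ht => funext fun x => heat_eq_heatFlow ht f x
  | succ n ih =>
    intro t ht
    ext x
    simp only [dysonTerm, dysonFlow, duhamel]
    congr 1
    rw [intervalIntegral.integral_of_le ht.le, intervalIntegral.integral_of_le ht.le,
      integral_Ioc_eq_integral_Ioo, integral_Ioc_eq_integral_Ioo]
    refine setIntegral_congr_fun measurableSet_Ioo fun s hs => ?_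
    simp only [ih s hs.1]
    exact heat_eq_heatFlow (sub_pos.2 hs.2) _ _

lemma schrodingerSemigroup_eq_schrodingerFlow {ν : ℕ} (V f : EuclideanSpace ℝ (Fin ν) → ℝ)
    {t : ℝ} (ht : 0 < t) : schrodingerSemigroup V t f = schrodingerFlow V f t := by
  ext x
  simp only [schrodingerSemigroup, schrodingerFlow, dysonTerm_eq_dysonFlow V f _ t ht]

section

variable {V f : E → ℝ} {M B : ℝ}

lemma abs_dysonFlow_le (hV : ∀ x, |V x| ≤ M) (hf : ∀ x, |f x| ≤ B) (n : ℕ) :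
    ∀ (t : ℝ) (x : E), |dysonFlow V f n t x| ≤ B * ((M * |t|) ^ n / n.factorial) := by
  induction n with
  | zero => simpa [dysonFlow] using fun t x => abs_heatFlow_le hf t x
  | succ n ih =>
    intro t x
    have h1 : |duhamel (fun s y => V y * dysonFlow V f n s y) t x| ≤
        (B * M ^ (n + 1) / n.factorial) * |t| ^ (n + 1) / (n + 1) := by
      refine abs_duhamel_le (fun s _ y => ?_) x
      rw [abs_mul]
      calc |V y| * |dysonFlow V f n s y|
          ≤ M * (B * ((M * |s|) ^ n / n.factorial)) :=
            mul_le_mul (hV y) (ih s y) (abs_nonneg _) ((abs_nonneg _).trans (hV y))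
        _ = _ := by rw [mul_pow]; ring
    simp only [dysonFlow, abs_neg]
    refine h1.trans (le_of_eq ?_)
    rw [Nat.factorial_succ, mul_pow]
    push_cast
    field_simp

lemma timeLocallyBounded_dysonFlow (hV : ∀ x, |V x| ≤ M) (hf : ∀ x, |f x| ≤ B) (n : ℕ) :
    TimeLocallyBounded (dysonFlow V f n) := by
  intro T
  refine ⟨B * ((M * T) ^ n / n.factorial), fun s hs y => (abs_dysonFlow_le hV hf n s y).trans ?_⟩
  have hB : 0 ≤ B := (abs_nonneg _).trans (hf 0)
  have hM : 0 ≤ M := (abs_nonneg _).trans (hV 0)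
  gcongr

lemma summable_pow_div_factorial_mul (B a : ℝ) :
    Summable fun n : ℕ => B * (a ^ n / n.factorial) :=
  (Real.summable_pow_div_factorial a).mul_left B

lemma summable_dysonFlow (hV : ∀ x, |V x| ≤ M) (hf : ∀ x, |f x| ≤ B) (t : ℝ) (x : E) :
    Summable fun n => dysonFlow V f n t x :=
  Summable.of_norm_bounded (f := fun n => dysonFlow V f n t x)
    (summable_pow_div_factorial_mul B (M * |t|)) fun n => abs_dysonFlow_le hV hf n t x

lemma abs_schrodingerFlow_le (hV : ∀ x, |V x| ≤ M) (hf : ∀ x, |f x| ≤ B) (t : ℝ) (x : E) :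
    |schrodingerFlow V f t x| ≤ B * Real.exp (M * |t|) := by
  refine tsum_of_norm_bounded (f := fun n => dysonFlow V f n t x)
    (g := fun n => B * ((M * |t|) ^ n / n.factorial)) ?_ fun n => abs_dysonFlow_le hV hf n t x
  refine HasSum.mul_left B ?_
  rw [Real.exp_eq_exp_ℝ]
  exact NormedSpace.expSeries_div_hasSum_exp _

lemma timeLocallyBounded_schrodingerFlow (hV : ∀ x, |V x| ≤ M) (hf : ∀ x, |f x| ≤ B) :
    TimeLocallyBounded (schrodingerFlow V f) := by
  intro T
  refine ⟨B * Real.exp (M * T), fun s hs y => (abs_schrodingerFlow_le hV hf s y).trans ?_⟩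
  have hB : 0 ≤ B := (abs_nonneg _).trans (hf 0)
  have hM : 0 ≤ M := (abs_nonneg _).trans (hV 0)
  gcongr

lemma measurable_dysonFlow (hVm : Measurable V) (hfm : Measurable f) (n : ℕ) :
    Measurable (Function.uncurry (dysonFlow V f n)) := by
  induction n with
  | zero =>
    exact measurable_heatFlow_comp (τ := fun p : ℝ × E => p.1) (H := fun _ => f)
      (ξ := fun p => p.2) measurable_fst (hfm.comp measurable_snd) measurable_snd
  | succ n ih =>
    exact (measurable_duhamel ((hVm.comp measurable_snd).mul ih)).neg

lemma measurable_schrodingerFlow (hVm : Measurable V) (hfm : Measurable f)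
    (hV : ∀ x, |V x| ≤ M) (hf : ∀ x, |f x| ≤ B) :
    Measurable (Function.uncurry (schrodingerFlow V f)) := by
  refine measurable_of_tendsto_metrizable
    (f := fun N (p : ℝ × E) => ∑ n ∈ Finset.range N, dysonFlow V f n p.1 p.2)
    (fun N => Finset.measurable_sum _ fun n _ => measurable_dysonFlow hVm hfm n) ?_
  rw [tendsto_pi_nhds]
  exact fun p => (summable_dysonFlow hV hf p.1 p.2).hasSum.tendsto_sum_nat

lemma continuous_dysonFlow (hVc : Continuous V) (hfc : Continuous f)
    (hV : ∀ x, |V x| ≤ M) (hf : ∀ x, |f x| ≤ B) (n : ℕ) :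
    Continuous (Function.uncurry (dysonFlow V f n)) := by
  induction n with
  | zero =>
    exact continuous_heatFlow_comp (τ := fun p : ℝ × E => p.1) (H := fun _ => f)
      (ξ := fun p => p.2) continuous_fst (hfc.comp continuous_snd) continuous_snd
      fun _ => ⟨B, Eventually.of_forall fun _ => hf⟩
  | succ n ih =>
    exact (continuous_duhamel ((hVc.comp continuous_snd).mul ih)
      ((timeLocallyBounded_dysonFlow hV hf n).mul_left hV)).neg

lemma continuous_schrodingerFlow (hVc : Continuous V) (hfc : Continuous f)
    (hV : ∀ x, |V x| ≤ M) (hf : ∀ x, |f x| ≤ B) :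
    Continuous (Function.uncurry (schrodingerFlow V f)) := by
  have hB : 0 ≤ B := (abs_nonneg _).trans (hf 0)
  have hM : 0 ≤ M := (abs_nonneg _).trans (hV 0)
  have hD : ∀ n, Continuous fun q : ℝ × E => dysonFlow V f n q.1 q.2 :=
    fun n => continuous_dysonFlow hVc hfc hV hf n
  have h1 : ∀ T : ℝ, ContinuousOn (fun q : ℝ × E => ∑' n, dysonFlow V f n q.1 q.2)
      {q | |q.1| < T} := by
    intro T
    have h2 : ∀ (n : ℕ) (q : ℝ × E), q ∈ {q : ℝ × E | |q.1| < T} →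
        ‖dysonFlow V f n q.1 q.2‖ ≤ B * ((M * T) ^ n / n.factorial) := by
      intro n q hq
      have h3 : |q.1| ≤ T := le_of_lt hq
      have h4 : (M * |q.1|) ^ n ≤ (M * T) ^ n := by gcongr
      exact (abs_dysonFlow_le hV hf n q.1 q.2).trans (by gcongr)
    exact continuousOn_tsum (fun n => (hD n).continuousOn)
      (summable_pow_div_factorial_mul B (M * T)) h2
  refine continuous_iff_continuousAt.2 fun p => ?_
  refine (h1 (|p.1| + 1)).continuousAt (IsOpen.mem_nhds ?_ (lt_add_one |p.1|))
  exact isOpen_lt (by fun_prop) continuous_const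

lemma hasSum_heatFlow {H : ℕ → E → ℝ} {c : ℕ → ℝ} (hm : ∀ n, Measurable (H n))
    (hc : ∀ n y, |H n y| ≤ c n) (hs : Summable c) (t : ℝ) (x : E) :
    HasSum (fun n => heatFlow t (H n) x) (heatFlow t (fun y => ∑' n, H n y) x) := by
  refine hasSum_integral_of_dominated_convergence (fun n _ => c n)
    (fun n => ((hm n).comp (measurable_add_sqrt_smul t x)).aestronglyMeasurable)
    (fun n => Eventually.of_forall fun z => hc n _) (Eventually.of_forall fun _ => hs)
    (integrable_const _) (Eventually.of_forall fun z => ?_)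
  exact (Summable.of_norm_bounded hs fun n => hc n _).hasSum

/-- Duhamel's formula `φ(t) = e^{tΔ/2} f - ∫₀ᵗ e^{(t-s)Δ/2} V φ(s) ds`. -/
lemma schrodingerFlow_eq (hVm : Measurable V) (hfm : Measurable f)
    (hV : ∀ x, |V x| ≤ M) (hf : ∀ x, |f x| ≤ B) (t : ℝ) (x : E) :
    schrodingerFlow V f t x =
      heatFlow t f x - duhamel (fun s y => V y * schrodingerFlow V f s y) t x := by
  have hB : 0 ≤ B := (abs_nonneg _).trans (hf 0)
  have hM : 0 ≤ M := (abs_nonneg _).trans (hV 0)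
  rw [schrodingerFlow, (summable_dysonFlow hV hf t x).tsum_eq_zero_add, sub_eq_add_neg]
  congr 1
  simp only [dysonFlow]
  rw [tsum_neg]
  congr 1
  refine HasSum.tsum_eq ?_
  refine intervalIntegral.hasSum_integral_of_dominated_convergence
    (fun n _ => M * (B * ((M * |t|) ^ n / n.factorial))) (fun n => ?_) (fun n => ?_)
    (Eventually.of_forall fun s _ => (summable_pow_div_factorial_mul _ _).mul_left M)
    intervalIntegrable_const (Eventually.of_forall fun s _ => ?_)
  · have hm : Measurable (Function.uncurry fun s y => V y * dysonFlow V f n s y) :=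
      (hVm.comp measurable_snd).mul (measurable_dysonFlow hVm hfm n)
    exact (measurable_heatFlow_comp (τ := fun s => t - s)
      (H := fun s y => V y * dysonFlow V f n s y) (ξ := fun _ : ℝ => x) (by fun_prop) hm
      measurable_const).aestronglyMeasurable
  · refine Eventually.of_forall fun s hs => abs_heatFlow_le (fun y => ?_) _ _
    rw [abs_mul]
    have := abs_le_of_mem_uIcc_zero (uIoc_subset_uIcc hs)
    refine mul_le_mul (hV y) ((abs_dysonFlow_le hV hf n s y).trans ?_) (abs_nonneg _) hM
    gcongr
  · have hcong : (fun y => V y * schrodingerFlow V f s y) =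
        fun y => ∑' n, V y * dysonFlow V f n s y := by
      ext y
      rw [tsum_mul_left, schrodingerFlow]
    simp only [hcong]
    refine hasSum_heatFlow (c := fun n => M * (B * ((M * |s|) ^ n / n.factorial)))
      (fun n => hVm.mul (measurable_dysonFlow hVm hfm n).of_uncurry_left) (fun n y => ?_)
      ((summable_pow_div_factorial_mul _ _).mul_left M) _ _
    rw [Pi.mul_apply, abs_mul]
    exact mul_le_mul (hV y) (abs_dysonFlow_le hV hf n s y) (abs_nonneg _) hM

/-- A locally bounded solution of the homogeneous Duhamel equation vanishes. -/
lemma eq_zero_of_eq_neg_duhamel (hV : ∀ x, |V x| ≤ M) {w : ℝ → E → ℝ}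
    (hw : TimeLocallyBounded w)
    (hd : ∀ t, 0 ≤ t → ∀ x, w t x = -duhamel (fun s y => V y * w s y) t x) {t : ℝ} (ht : 0 ≤ t)
    (x : E) : w t x = 0 := by
  obtain ⟨C, hC⟩ := hw t
  have hM : 0 ≤ M := (abs_nonneg _).trans (hV 0)
  have key : ∀ n : ℕ, ∀ s, 0 ≤ s → s ≤ t → ∀ y, |w s y| ≤ C * ((M * s) ^ n / n.factorial) := by
    intro n
    induction n with
    | zero =>
      intro s hs hst y
      simpa using hC s (by rwa [abs_of_nonneg hs]) y
    | succ n ih =>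
      intro s hs hst y
      rw [hd s hs, abs_neg]
      have h1 : |duhamel (fun s y => V y * w s y) s y| ≤
          (C * M ^ (n + 1) / n.factorial) * |s| ^ (n + 1) / (n + 1) := by
        refine abs_duhamel_le (fun r hr y => ?_) y
        rw [uIcc_of_le hs] at hr
        rw [abs_mul, abs_of_nonneg hr.1]
        calc |V y| * |w r y| ≤ M * (C * ((M * r) ^ n / n.factorial)) :=
              mul_le_mul (hV y) (ih r hr.1 (hr.2.trans hst) y) (abs_nonneg _) hM
          _ = _ := by rw [mul_pow]; ring
      refine h1.trans (le_of_eq ?_)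
      rw [abs_of_nonneg hs, Nat.factorial_succ, mul_pow]
      push_cast
      field_simp
  have hlim : Tendsto (fun n : ℕ => C * ((M * t) ^ n / n.factorial)) atTop (𝓝 (C * 0)) :=
    (FloorSemiring.tendsto_pow_div_factorial_atTop _).const_mul C
  rw [mul_zero] at hlim
  have h0 : |w t x| ≤ 0 := ge_of_tendsto' hlim fun n => key n t ht le_rfl x
  exact abs_eq_zero.1 (le_antisymm h0 (abs_nonneg _))

/-- Uniqueness for Duhamel's equation. -/
lemma eq_schrodingerFlow (hVm : Measurable V) (hfm : Measurable f)
    (hV : ∀ x, |V x| ≤ M) (hf : ∀ x, |f x| ≤ B) {χ : ℝ → E → ℝ}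
    (hχm : Measurable (Function.uncurry χ)) (hχb : TimeLocallyBounded χ)
    (hd : ∀ t, 0 ≤ t → ∀ x, χ t x = heatFlow t f x - duhamel (fun s y => V y * χ s y) t x)
    {t : ℝ} (ht : 0 ≤ t) (x : E) : χ t x = schrodingerFlow V f t x := by
  have hb := timeLocallyBounded_schrodingerFlow hV hf
  have hm := measurable_schrodingerFlow hVm hfm hV hf
  refine sub_eq_zero.1 (eq_zero_of_eq_neg_duhamel hV
    (w := fun s y => χ s y - schrodingerFlow V f s y) (hχb.sub hb) (fun s hs y => ?_) ht x)
  have h1 : Measurable (Function.uncurry fun s y => V y * χ s y) :=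
    (hVm.comp measurable_snd).mul hχm
  have h2 : Measurable (Function.uncurry fun s y => V y * schrodingerFlow V f s y) :=
    (hVm.comp measurable_snd).mul hm
  simp only [mul_sub]
  rw [duhamel_sub h1 (hχb.mul_left hV) h2 (hb.mul_left hV), hd s hs,
    schrodingerFlow_eq hVm hfm hV hf]
  ring

/-- Duhamel's formula with initial time `t`. -/
lemma schrodingerFlow_add_eq (hVm : Measurable V) (hfm : Measurable f)
    (hV : ∀ x, |V x| ≤ M) (hf : ∀ x, |f x| ≤ B) {t r : ℝ} (ht : 0 ≤ t) (hr : 0 ≤ r) (x : E) :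
    schrodingerFlow V f (t + r) x = heatFlow r (schrodingerFlow V f t) x -
      duhamel (fun s y => V y * schrodingerFlow V f (t + s) y) r x := by
  have hm : Measurable (Function.uncurry fun s y => V y * schrodingerFlow V f s y) :=
    (hVm.comp measurable_snd).mul (measurable_schrodingerFlow hVm hfm hV hf)
  have hb := (timeLocallyBounded_schrodingerFlow hV hf).mul_left hV
  have hM : 0 ≤ M := (abs_nonneg _).trans (hV 0)
  rw [schrodingerFlow_eq hVm hfm hV hf, duhamel_add hm hb ht hr, ← sub_sub]
  congr 1
  obtain ⟨C, hC⟩ := hb |t|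
  have h1 : schrodingerFlow V f t = fun y => heatFlow t f y -
      duhamel (fun s y => V y * schrodingerFlow V f s y) t y :=
    funext fun y => schrodingerFlow_eq hVm hfm hV hf t y
  have h2 : ∀ y, |duhamel (fun s y => V y * schrodingerFlow V f s y) t y| ≤
      C * |t| ^ (0 + 1) / ((0 : ℕ) + 1) := fun y =>
    abs_duhamel_le (fun s hs y => by
      simpa using hC s (abs_le_of_mem_uIcc_zero hs) y) y
  rw [h1, heatFlow_sub (measurable_heatFlow hfm t) (measurable_duhamel hm).of_uncurry_left
    (abs_heatFlow_le hf t) h2, heatFlow_heatFlow hfm hf hr ht, add_comm r t]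

lemma schrodingerFlow_add (hVm : Measurable V) (hfm : Measurable f)
    (hV : ∀ x, |V x| ≤ M) (hf : ∀ x, |f x| ≤ B) {t r : ℝ} (ht : 0 ≤ t) (hr : 0 ≤ r) (x : E) :
    schrodingerFlow V f (t + r) x = schrodingerFlow V (schrodingerFlow V f t) r x := by
  have hm := measurable_schrodingerFlow hVm hfm hV hf
  have hb := timeLocallyBounded_schrodingerFlow hV hf
  obtain ⟨C, hC⟩ := hb |t|
  exact eq_schrodingerFlow hVm hm.of_uncurry_left hV (hC t le_rfl)
    (χ := fun s => schrodingerFlow V f (t + s))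
    (hm.comp (by fun_prop : Measurable fun p : ℝ × E => (t + p.1, p.2))) (hb.comp_add_left t)
    (fun s hs y => schrodingerFlow_add_eq hVm hfm hV hf ht hs y) hr x

/-- For nonnegative `f` the Dyson terms are dominated pointwise by the free evolution of `f`, not
just by `sup |f|`: this is what makes positivity accessible. -/
lemma abs_dysonFlow_le_heatFlow (hfm : Measurable f)
    (hV : ∀ x, |V x| ≤ M) (hf : ∀ x, |f x| ≤ B) (hf0 : ∀ x, 0 ≤ f x) (n : ℕ) :
    ∀ t : ℝ, 0 ≤ t → ∀ x, |dysonFlow V f n t x| ≤ (M * t) ^ n / n.factorial * heatFlow t f x := by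
  have hM : 0 ≤ M := (abs_nonneg _).trans (hV 0)
  induction n with
  | zero =>
    intro t _ x
    simp [dysonFlow, abs_of_nonneg (heatFlow_nonneg hf0 t x)]
  | succ n ih =>
    intro t ht x
    simp only [dysonFlow, abs_neg, duhamel]
    have h1 : ∀ s ∈ Ioc 0 t, |heatFlow (t - s) (fun y => V y * dysonFlow V f n s y) x| ≤
        M ^ (n + 1) / n.factorial * heatFlow t f x * s ^ n := by
      intro s hs
      have h2 : |heatFlow (t - s) (fun y => V y * dysonFlow V f n s y) x| ≤
          heatFlow (t - s) (fun y => M ^ (n + 1) * s ^ n / n.factorial * heatFlow s f y) x := by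
        refine norm_integral_le_of_norm_le
          (f := fun z => V (x + √(t - s) • z) * dysonFlow V f n s (x + √(t - s) • z))
          ?_ (Eventually.of_forall fun z => ?_)
        · exact (integrable_comp_add_sqrt_smul (measurable_heatFlow hfm s)
            (abs_heatFlow_le hf s) (t - s) x).const_mul _
        · rw [norm_mul]
          refine (mul_le_mul (hV _) (ih s hs.1.le _) (abs_nonneg _) hM).trans (le_of_eq ?_)
          rw [mul_pow]
          ring
      refine h2.trans (le_of_eq ?_)
      rw [heatFlow_const_mul, heatFlow_heatFlow hfm hf (sub_nonneg.2 hs.2) hs.1.le, sub_add_cancel]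
      ring
    have h3 := intervalIntegral.norm_integral_le_of_norm_le (μ := volume)
      (f := fun s => heatFlow (t - s) (fun y => V y * dysonFlow V f n s y) x) ht
      (Eventually.of_forall h1) ((by fun_prop : Continuous fun s : ℝ =>
        M ^ (n + 1) / n.factorial * heatFlow t f x * s ^ n).intervalIntegrable _ _)
    refine h3.trans (le_of_eq ?_)
    rw [intervalIntegral.integral_const_mul, integral_pow, Nat.factorial_succ, mul_pow]
    push_cast
    field_simp
    simp

/-- For `M t ≤ 1 / 2` the terms with `n ≥ 1` add up to at most `(exp (M t) - 1) e^{tΔ/2} f`, which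
is below the free term. -/
lemma schrodingerFlow_nonneg_of_le (hfm : Measurable f)
    (hV : ∀ x, |V x| ≤ M) (hf : ∀ x, |f x| ≤ B) (hf0 : ∀ x, 0 ≤ f x) {t : ℝ} (ht : 0 ≤ t)
    (hMt : M * t ≤ 1 / 2) (x : E) : 0 ≤ schrodingerFlow V f t x := by
  have hM : 0 ≤ M := (abs_nonneg _).trans (hV 0)
  have hexp : HasSum (fun n : ℕ => (M * t) ^ n / n.factorial) (Real.exp (M * t)) := by
    rw [Real.exp_eq_exp_ℝ]
    exact NormedSpace.expSeries_div_hasSum_exp _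
  have hexp1 := (hasSum_nat_add_iff' 1).2 hexp
  have h1 : |∑' n, dysonFlow V f (n + 1) t x| ≤ (Real.exp (M * t) - 1) * heatFlow t f x := by
    refine tsum_of_norm_bounded (f := fun n => dysonFlow V f (n + 1) t x) (g := fun n =>
      (M * t) ^ (n + 1) / (n + 1).factorial * heatFlow t f x) ?_
      fun n => abs_dysonFlow_le_heatFlow hfm hV hf hf0 (n + 1) t ht x
    simpa using hexp1.mul_right (heatFlow t f x)
  have h2 : Real.exp (M * t) ≤ 2 := by
    refine (Real.exp_le_exp.2 hMt).trans ?_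
    have : Real.exp (1 / 2) ^ 2 = Real.exp 1 := by
      rw [← Real.exp_nat_mul]; norm_num
    nlinarith [Real.exp_one_lt_d9, Real.exp_pos (1 / 2)]
  rw [schrodingerFlow, (summable_dysonFlow hV hf t x).tsum_eq_zero_add]
  have h3 := (abs_le.1 h1).1
  have h4 := heatFlow_nonneg hf0 t x
  simp only [dysonFlow] at h3 ⊢
  nlinarith

/-- The Schrödinger semigroup preserves positivity: for short times the free term dominates the
rest of the Dyson–Phillips series, and the semigroup property does the rest. -/
lemma schrodingerFlow_nonneg (hVm : Measurable V) (hfm : Measurable f)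
    (hV : ∀ x, |V x| ≤ M) (hf : ∀ x, |f x| ≤ B) (hf0 : ∀ x, 0 ≤ f x) {t : ℝ} (ht : 0 ≤ t)
    (x : E) : 0 ≤ schrodingerFlow V f t x := by
  have hM : 0 ≤ M := (abs_nonneg _).trans (hV 0)
  have hm := measurable_schrodingerFlow hVm hfm hV hf
  -- `N` steps of length `t / N`, each short enough for the perturbative argument.
  obtain ⟨N, hN⟩ := exists_nat_gt (2 * (M * t))
  have hN0 : (0 : ℝ) < N := lt_of_le_of_lt (by positivity) hN
  have hτ : M * (t / N) ≤ 1 / 2 := by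
    rw [← mul_div_assoc, div_le_iff₀ hN0]
    linarith
  have key : ∀ n : ℕ, ∀ y, 0 ≤ schrodingerFlow V f (n * (t / N)) y := by
    intro n
    induction n with
    | zero =>
      intro y
      exact schrodingerFlow_nonneg_of_le hfm hV hf hf0 (by simp) (by simp) y
    | succ n ih =>
      intro y
      obtain ⟨C, hC⟩ := timeLocallyBounded_schrodingerFlow hV hf |n * (t / N)|
      rw [Nat.cast_succ, add_mul, one_mul,
        schrodingerFlow_add hVm hfm hV hf (by positivity) (by positivity)]
      exact schrodingerFlow_nonneg_of_le hm.of_uncurry_left hV (hC _ le_rfl) ih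
        (by positivity) hτ y
  simpa [mul_div_cancel₀ t hN0.ne'] using key N x

/-- Comparison principle: `f - c g ≥ 0` stays nonnegative, and by uniqueness its evolution is the
difference of the evolutions. -/
lemma const_mul_schrodingerFlow_le {g : E → ℝ} {D c : ℝ} (hVm : Measurable V)
    (hfm : Measurable f) (hgm : Measurable g) (hV : ∀ x, |V x| ≤ M) (hf : ∀ x, |f x| ≤ B)
    (hg : ∀ x, |g x| ≤ D) (hgf : ∀ x, c * g x ≤ f x) {t : ℝ} (ht : 0 ≤ t) (x : E) :
    c * schrodingerFlow V g t x ≤ schrodingerFlow V f t x := by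
  have hfM := measurable_schrodingerFlow hVm hfm hV hf
  have hgM := measurable_schrodingerFlow hVm hgm hV hg
  have hfB := timeLocallyBounded_schrodingerFlow hV hf
  have hgB := (timeLocallyBounded_schrodingerFlow hV hg).mul_left (V := fun _ => c) fun _ => le_rfl
  have hcg : ∀ x, |c * g x| ≤ |c| * D := fun x => by
    rw [abs_mul]
    exact mul_le_mul_of_nonneg_left (hg x) (abs_nonneg _)
  have hm : Measurable fun x => f x - c * g x := hfm.sub (hgm.const_mul c)
  have hb : ∀ x, |f x - c * g x| ≤ B + |c| * D :=
    fun x => (abs_sub _ _).trans (add_le_add (hf x) (hcg x))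
  have h1 := eq_schrodingerFlow hVm hm hV hb
    (χ := fun s y => schrodingerFlow V f s y - c * schrodingerFlow V g s y)
    (hfM.sub (hgM.const_mul c)) (hfB.sub hgB) (fun s _ y => ?_) ht x
  · have h2 := schrodingerFlow_nonneg hVm hm hV hb (fun x => sub_nonneg.2 (hgf x)) ht x
    rw [← h1] at h2
    linarith
  · have hVf : Measurable (Function.uncurry fun s y => V y * schrodingerFlow V f s y) :=
      (hVm.comp measurable_snd).mul hfM
    have hVg : Measurable (Function.uncurry fun s y => c * (V y * schrodingerFlow V g s y)) :=
      ((hVm.comp measurable_snd).mul hgM).const_mul c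
    have h3 : (fun s y => V y * (schrodingerFlow V f s y - c * schrodingerFlow V g s y)) =
        fun s y => V y * schrodingerFlow V f s y - c * (V y * schrodingerFlow V g s y) := by
      ext s y; ring
    rw [h3, duhamel_sub hVf (hfB.mul_left hV) hVg
      (((timeLocallyBounded_schrodingerFlow hV hg).mul_left hV).mul_left (V := fun _ => c)
        fun _ => le_rfl), duhamel_const_mul,
      heatFlow_sub hfm (hgm.const_mul c) hf hcg, heatFlow_const_mul,
      schrodingerFlow_eq hVm hfm hV hf, schrodingerFlow_eq hVm hgm hV hg]
    ring

end

end

/-! ### Spatial gradients -/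

section

variable {E : Type*} [NormedAddCommGroup E] [InnerProductSpace ℝ E] [FiniteDimensional ℝ E]
  [MeasurableSpace E] [BorelSpace E]

lemma contDiff_one_of_hasGradientAt {f : E → ℝ} {g : E → E} (hfg : ∀ x, HasGradientAt f (g x) x)
    (hg : Continuous g) : ContDiff ℝ 1 f := by
  rw [contDiff_one_iff_fderiv]
  refine ⟨fun x => (hfg x).differentiableAt, ?_⟩
  have h1 : fderiv ℝ f = fun x => InnerProductSpace.toDual ℝ E (g x) :=
    funext fun x => (hfg x).hasFDerivAt.fderiv
  rw [h1]
  exact (InnerProductSpace.toDual ℝ E).continuous.comp hg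

lemma continuous_gradient {f : E → ℝ} (hf : ContDiff ℝ 1 f) : Continuous (gradient f) :=
  (InnerProductSpace.toDual ℝ E).symm.continuous.comp (hf.continuous_fderiv one_ne_zero)

lemma inner_gradient_left {f : E → ℝ} (x v : E) :
    inner ℝ (gradient f x) v = fderiv ℝ f x v := by
  simp [gradient]

lemma intervalIntegrable_inv_sqrt (a b : ℝ) :
    IntervalIntegrable (fun s : ℝ => (√s)⁻¹) volume a b := by
  have h0 : (fun s : ℝ => (√s)⁻¹) = fun s => (max s 0) ^ (-(1 / 2) : ℝ) := by
    ext s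
    rw [Real.rpow_neg (le_max_right _ _), ← Real.sqrt_eq_rpow]
    rcases le_total s 0 with hs | hs
    · rw [Real.sqrt_eq_zero_of_nonpos hs, max_eq_right hs, Real.sqrt_zero]
    · rw [max_eq_left hs]
  have hpos : ∀ c : ℝ, 0 ≤ c → IntervalIntegrable (fun s : ℝ => (√s)⁻¹) volume 0 c := by
    intro c hc
    refine (intervalIntegral.intervalIntegrable_rpow' (r := -(1 / 2)) (by norm_num)).congr ?_
    intro s hs
    rw [uIoc_of_le hc] at hs
    simp only
    rw [Real.rpow_neg hs.1.le, ← Real.sqrt_eq_rpow]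
  have hneg : ∀ c : ℝ, c ≤ 0 → IntervalIntegrable (fun s : ℝ => (√s)⁻¹) volume 0 c := by
    intro c hc
    refine (intervalIntegrable_const (c := (0 : ℝ))).congr ?_
    intro s hs
    rw [uIoc_of_ge hc] at hs
    simp [Real.sqrt_eq_zero_of_nonpos hs.2]
  have hall : ∀ c : ℝ, IntervalIntegrable (fun s : ℝ => (√s)⁻¹) volume 0 c := fun c =>
    (le_total 0 c).elim (hpos c) (hneg c)
  exact (hall a).symm.trans (hall b)

lemma integral_inv_sqrt {t : ℝ} (ht : 0 ≤ t) : ∫ s in (0 : ℝ)..t, (√s)⁻¹ = 2 * √t := by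
  have h1 : ∫ s in (0 : ℝ)..t, (√s)⁻¹ = ∫ s in (0 : ℝ)..t, s ^ (-(1 / 2) : ℝ) := by
    refine intervalIntegral.integral_congr fun s hs => ?_
    rw [uIcc_of_le ht] at hs
    rw [Real.rpow_neg hs.1, ← Real.sqrt_eq_rpow]
  rw [h1, integral_rpow (Or.inl (by norm_num)), Real.sqrt_eq_rpow]
  norm_num
  ring

/-- The gradient of `duhamel h t`. -/
def duhamelGrad (h : ℝ → E → ℝ) (t : ℝ) (x : E) : E :=
  ∫ s in (0 : ℝ)..t, heatGrad (t - s) (h s) x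

lemma norm_duhamelGrad_le {h : ℝ → E → ℝ} {t C : ℝ} (ht : 0 ≤ t)
    (hC : ∀ s ∈ Icc 0 t, ∀ y, |h s y| ≤ C) (x : E) :
    ‖duhamelGrad h t x‖ ≤ 2 * √t * (C * ∫ z : E, ‖z‖ ∂(stdGaussian E)) := by
  have h1 : ‖duhamelGrad h t x‖ ≤
      ∫ s in (0 : ℝ)..t, (√(t - s))⁻¹ * (C * ∫ z : E, ‖z‖ ∂(stdGaussian E)) := by
    refine intervalIntegral.norm_integral_le_of_norm_le ht
      (Eventually.of_forall fun s hs => norm_heatGrad_le (hC s (Ioc_subset_Icc_self hs)) _ _) ?_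
    have := (intervalIntegrable_inv_sqrt t 0).comp_sub_left t
    simp only [sub_self, sub_zero] at this
    exact this.mul_const _
  refine h1.trans (le_of_eq ?_)
  rw [intervalIntegral.integral_mul_const,
    intervalIntegral.integral_comp_sub_left (fun s => (√s)⁻¹) t, sub_self, sub_zero,
    integral_inv_sqrt ht]

/-- The bound `(t - s)^{-1/2} sup |h(s)|` for the gradient of `e^{(t-s)Δ/2} h(s)` is integrable in
`s`, so `h` need not be differentiable, or even continuous. -/
lemma hasGradientAt_duhamel {h : ℝ → E → ℝ} (hm : Measurable (Function.uncurry h))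
    (hb : TimeLocallyBounded h) {t : ℝ} (ht : 0 < t) (x : E) :
    HasGradientAt (duhamel h t) (duhamelGrad h t x) x := by
  obtain ⟨C, hC⟩ := hb t
  have hC' : ∀ s ∈ Ioo 0 t, ∀ y, |h s y| ≤ C := fun s hs y =>
    hC s (by rw [abs_of_pos hs.1]; exact hs.2.le) y
  have hgm : ∀ y, StronglyMeasurable fun s => heatGrad (t - s) (h s) y := fun y =>
    measurable_heatGrad_comp (τ := fun s => t - s) (H := h) (ξ := fun _ : ℝ => y) (by fun_prop) hm
      measurable_const
  have hI : IntervalIntegrable (fun s => (√(t - s))⁻¹ * (C * ∫ z : E, ‖z‖ ∂(stdGaussian E)))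
      volume 0 t := by
    have := (intervalIntegrable_inv_sqrt t 0).comp_sub_left t
    simp only [sub_self, sub_zero] at this
    exact this.mul_const _
  have hae : ∀ P : ℝ → Prop, (∀ s ∈ Ioo 0 t, P s) → ∀ᵐ s ∂(volume.restrict (Ioc 0 t)), P s := by
    intro P hP
    rw [← Measure.restrict_congr_set (Ioo_ae_eq_Ioc (a := (0 : ℝ)) (b := t) (μ := volume))]
    exact (ae_restrict_iff' measurableSet_Ioo).2 (Eventually.of_forall hP)
  have key := hasFDerivAt_integral_of_dominated_of_fderiv_le (𝕜 := ℝ)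
    (μ := volume.restrict (Ioc 0 t))
    (F := fun y s => heatFlow (t - s) (h s) y)
    (F' := fun y s => InnerProductSpace.toDual ℝ E (heatGrad (t - s) (h s) y))
    (x₀ := x) (s := univ) (bound := fun s => (√(t - s))⁻¹ * (C * ∫ z : E, ‖z‖ ∂(stdGaussian E)))
    univ_mem ?_ ?_ ?_ ?_ ?_ ?_
  · rw [hasGradientAt_iff_hasFDerivAt]
    have h1 : duhamel h t = fun y => ∫ s in Ioc 0 t, heatFlow (t - s) (h s) y := by
      ext y
      rw [duhamel, intervalIntegral.integral_of_le ht.le]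
    rw [h1]
    refine key.congr_fderiv ?_
    rw [duhamelGrad, intervalIntegral.integral_of_le ht.le]
    have hi : Integrable (fun s => heatGrad (t - s) (h s) x) (volume.restrict (Ioc 0 t)) := by
      refine ((intervalIntegrable_iff_integrableOn_Ioc_of_le ht.le).1 hI).mono'
        (hgm x).aestronglyMeasurable (hae _ fun s hs => ?_)
      exact norm_heatGrad_le (hC' s hs) _ _
    exact (innerSL ℝ).integral_comp_comm hi
  · refine Eventually.of_forall fun y => Measurable.aestronglyMeasurable ?_
    exact measurable_heatFlow_comp (τ := fun s => t - s) (H := h) (ξ := fun _ : ℝ => y)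
      (by fun_prop) hm measurable_const
  · exact (intervalIntegrable_iff_integrableOn_Ioc_of_le ht.le).1
      (intervalIntegrable_heatFlow hm hb t 0 t x)
  · exact ((InnerProductSpace.toDual ℝ E).continuous.comp_stronglyMeasurable
      (hgm x)).aestronglyMeasurable
  · refine hae _ fun s hs y _ => ?_
    rw [LinearIsometryEquiv.norm_map]
    exact norm_heatGrad_le (hC' s hs) _ _
  · exact (intervalIntegrable_iff_integrableOn_Ioc_of_le ht.le).1 hI
  · refine hae _ fun s hs y _ => ?_
    exact (hasGradientAt_heatFlow hm.of_uncurry_left (hC' s hs) (sub_pos.2 hs.2) y).hasFDerivAt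

lemma continuousAt_heatGrad_comp {α : Type*} [TopologicalSpace α] [FirstCountableTopology α]
    {τ : α → ℝ} {H : α → E → ℝ} {ξ : α → E} (hτ : Continuous τ)
    (hH : Continuous (Function.uncurry H)) (hξ : Continuous ξ) {a : α} {C : ℝ}
    (hb : ∀ᶠ a' in 𝓝 a, ∀ y, |H a' y| ≤ C) (ha : 0 < τ a) :
    ContinuousAt (fun a => heatGrad (τ a) (H a) (ξ a)) a := by
  have hcont : Continuous (fun p : α × E => H p.1 (ξ p.1 + √(τ p.1) • p.2)) :=
    hH.comp (by fun_prop : Continuous fun p : α × E => (p.1, ξ p.1 + √(τ p.1) • p.2))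
  have h2 : ∀ᶠ a' in 𝓝 a, (√(τ a'))⁻¹ ≤ (√(τ a / 2))⁻¹ := by
    filter_upwards [hτ.continuousAt.eventually (lt_mem_nhds (half_lt_self ha))] with a' ha'
    have : 0 < √(τ a / 2) := Real.sqrt_pos.2 (half_pos ha)
    gcongr
  refine continuousAt_of_dominated (bound := fun z => (√(τ a / 2))⁻¹ * C * ‖z‖) ?_ ?_
    (integrable_norm_stdGaussian.const_mul _) ?_
  · refine Eventually.of_forall fun a' => ?_
    have h3 : Continuous fun z : E => H a' (ξ a' + √(τ a') • z) :=
      hcont.comp (by fun_prop : Continuous fun z : E => (a', z))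
    exact ((continuous_const.mul h3).smul continuous_id).aestronglyMeasurable
  · filter_upwards [hb, h2] with a' ha' ha2
    refine Eventually.of_forall fun z => ?_
    rw [norm_smul, norm_mul, Real.norm_of_nonneg (by positivity : 0 ≤ (√(τ a'))⁻¹)]
    gcongr
    exact ha' _
  · refine Eventually.of_forall fun z => ?_
    have h3 : Continuous fun a' : α => H a' (ξ a' + √(τ a') • z) :=
      hcont.comp (by fun_prop : Continuous fun a' : α => (a', z))
    have h4 : ContinuousAt (fun a' => (√(τ a'))⁻¹) a :=
      (Real.continuous_sqrt.comp hτ).continuousAt.inv₀ (Real.sqrt_pos.2 ha).ne'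
    exact (h4.mul h3.continuousAt).smul continuousAt_const

lemma duhamelGrad_eq_smul_integral (h : ℝ → E → ℝ) (t : ℝ) (x : E) :
    duhamelGrad h t x = t • ∫ σ in (0 : ℝ)..1, heatGrad (t * (1 - σ)) (h (t * σ)) x := by
  have := intervalIntegral.smul_integral_comp_mul_left (a := 0) (b := 1)
    (fun s => heatGrad (t - s) (h s) x) t
  simp only [mul_zero, mul_one] at this
  rw [duhamelGrad, ← this]
  simp only [mul_sub, mul_one]

/-- Rescaling time to `[0, 1]` fixes the position of the singularity `(t - s)^{-1/2}`, so that
dominated convergence applies. -/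
lemma continuousOn_duhamelGrad {h : ℝ → E → ℝ} (hc : Continuous (Function.uncurry h))
    (hb : TimeLocallyBounded h) :
    ContinuousOn (Function.uncurry (duhamelGrad h)) (Ioi 0 ×ˢ univ) := by
  rintro ⟨t, x⟩ ⟨ht, -⟩
  have ht : 0 < t := ht
  refine ContinuousAt.continuousWithinAt ?_
  have h1 : Function.uncurry (duhamelGrad h) = fun p : ℝ × E =>
      p.1 • ∫ σ in (0 : ℝ)..1, heatGrad (p.1 * (1 - σ)) (h (p.1 * σ)) p.2 := by
    ext1 p
    exact duhamelGrad_eq_smul_integral h p.1 p.2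
  rw [h1]
  refine continuousAt_fst.smul ?_
  obtain ⟨C, hC⟩ := hb (t + 1)
  have hnear : ∀ᶠ p : ℝ × E in 𝓝 (t, x), t / 2 < p.1 ∧ p.1 < t + 1 :=
    (continuousAt_fst.eventually (lt_mem_nhds (half_lt_self ht))).and
      (continuousAt_fst.eventually (gt_mem_nhds (lt_add_one t)))
  have hC' : ∀ p : ℝ × E, t / 2 < p.1 ∧ p.1 < t + 1 → ∀ σ ∈ Ioc (0 : ℝ) 1, ∀ y,
      |h (p.1 * σ) y| ≤ C := by
    intro p hp σ hσ y
    refine hC _ ?_ y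
    have hp0 : 0 < p.1 := by linarith [hp.1]
    rw [abs_of_nonneg (mul_nonneg hp0.le hσ.1.le)]
    nlinarith [hσ.1, hσ.2, hp.2]
  have hm := hc.measurable
  refine intervalIntegral.continuousAt_of_dominated_interval (bound := fun σ =>
    (√(t / 2))⁻¹ * (√(1 - σ))⁻¹ * (C * ∫ z : E, ‖z‖ ∂(stdGaussian E))) ?_ ?_ ?_ ?_
  · refine Eventually.of_forall fun p => StronglyMeasurable.aestronglyMeasurable ?_
    exact measurable_heatGrad_comp (τ := fun σ => p.1 * (1 - σ)) (H := fun σ => h (p.1 * σ))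
      (ξ := fun _ : ℝ => p.2) (by fun_prop)
      (hm.comp (by fun_prop : Measurable fun q : ℝ × E => (p.1 * q.1, q.2))) measurable_const
  · filter_upwards [hnear] with p hp
    refine Eventually.of_forall fun σ hσ => ?_
    rw [uIoc_of_le zero_le_one] at hσ
    have hC0 : 0 ≤ C := (abs_nonneg _).trans (hC' p hp σ hσ 0)
    refine (norm_heatGrad_le (hC' p hp σ hσ) _ _).trans ?_
    have h2 : 0 ≤ ∫ z : E, ‖z‖ ∂(stdGaussian E) := integral_nonneg fun _ => norm_nonneg _
    rw [Real.sqrt_mul (by linarith [hp.1]), mul_inv]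
    have : 0 < √(t / 2) := Real.sqrt_pos.2 (half_pos ht)
    gcongr
    exact hp.1.le
  · have := (intervalIntegrable_inv_sqrt 1 0).comp_sub_left 1
    simp only [sub_self, sub_zero] at this
    exact (this.const_mul _).mul_const _
  · have h1 : ∀ᵐ σ : ℝ, σ ≠ 1 := by simp [ae_iff, measure_singleton]
    filter_upwards [h1] with σ hσ1 hσ
    rw [uIoc_of_le zero_le_one] at hσ
    have hσ2 : σ < 1 := lt_of_le_of_ne hσ.2 hσ1
    refine continuousAt_heatGrad_comp (τ := fun p : ℝ × E => p.1 * (1 - σ))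
      (H := fun p => h (p.1 * σ)) (ξ := fun p => p.2) (C := C) (by fun_prop)
      (hc.comp (by fun_prop : Continuous fun q : (ℝ × E) × E => (q.1.1 * σ, q.2)))
      (by fun_prop) ?_ (mul_pos ht (sub_pos.2 hσ2))
    filter_upwards [hnear] with p hp
    exact hC' p hp σ hσ

/-- The spatial gradient of `schrodingerFlow V f t`. -/
def schrodingerGrad (V f : E → ℝ) (t : ℝ) (x : E) : E :=
  heatGrad t f x - duhamelGrad (fun s y => V y * schrodingerFlow V f s y) t x

section

variable {V f : E → ℝ} {M B : ℝ}

lemma hasGradientAt_schrodingerFlow (hVm : Measurable V) (hfm : Measurable f)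
    (hV : ∀ x, |V x| ≤ M) (hf : ∀ x, |f x| ≤ B) {t : ℝ} (ht : 0 < t) (x : E) :
    HasGradientAt (schrodingerFlow V f t) (schrodingerGrad V f t x) x := by
  have hm : Measurable (Function.uncurry fun s y => V y * schrodingerFlow V f s y) :=
    (hVm.comp measurable_snd).mul (measurable_schrodingerFlow hVm hfm hV hf)
  have h1 := (hasGradientAt_heatFlow hfm hf ht x).hasFDerivAt.sub
    (hasGradientAt_duhamel hm ((timeLocallyBounded_schrodingerFlow hV hf).mul_left hV) ht
      x).hasFDerivAt
  have h2 : schrodingerFlow V f t = heatFlow t f -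
      duhamel (fun s y => V y * schrodingerFlow V f s y) t :=
    funext fun y => schrodingerFlow_eq hVm hfm hV hf t y
  rw [hasGradientAt_iff_hasFDerivAt, schrodingerGrad, map_sub, h2]
  exact h1

lemma continuousOn_schrodingerGrad (hVc : Continuous V) (hfc : Continuous f)
    (hV : ∀ x, |V x| ≤ M) (hf : ∀ x, |f x| ≤ B) :
    ContinuousOn (Function.uncurry (schrodingerGrad V f)) (Ioi 0 ×ˢ univ) := by
  have hc : Continuous (Function.uncurry fun s y => V y * schrodingerFlow V f s y) :=
    (hVc.comp continuous_snd).mul (continuous_schrodingerFlow hVc hfc hV hf)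
  refine ContinuousOn.sub ?_
    (continuousOn_duhamelGrad hc ((timeLocallyBounded_schrodingerFlow hV hf).mul_left hV))
  rintro ⟨t, x⟩ ⟨ht, -⟩
  exact (continuousAt_heatGrad_comp (τ := fun p : ℝ × E => p.1) (H := fun _ => f)
    (ξ := fun p => p.2) (C := B) continuous_fst (hfc.comp continuous_snd) continuous_snd
    (Eventually.of_forall fun _ => hf) ht).continuousWithinAt

lemma exists_norm_schrodingerGrad_le (hV : ∀ x, |V x| ≤ M) (hf : ∀ x, |f x| ≤ B) {t₀ : ℝ}
    (ht₀ : 0 < t₀) (T : ℝ) :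
    ∃ C, ∀ t, t₀ ≤ t → t ≤ T → ∀ x, ‖schrodingerGrad V f t x‖ ≤ C := by
  obtain ⟨C, hC⟩ := (timeLocallyBounded_schrodingerFlow hV hf).mul_left hV T
  have hB : 0 ≤ B := (abs_nonneg _).trans (hf 0)
  set m := ∫ z : E, ‖z‖ ∂(stdGaussian E)
  have hm : 0 ≤ m := integral_nonneg fun _ => norm_nonneg _
  refine ⟨(√t₀)⁻¹ * (B * m) + 2 * √T * (C * m), fun t ht htT x => ?_⟩
  have ht0 : 0 < t := ht₀.trans_le ht
  have hC' : ∀ s ∈ Icc 0 t, ∀ y, |V y * schrodingerFlow V f s y| ≤ C := fun s hs y =>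
    hC s (by rw [abs_of_nonneg hs.1]; exact hs.2.trans htT) y
  have hC0 : 0 ≤ C := (abs_nonneg _).trans (hC' 0 ⟨le_rfl, ht0.le⟩ 0)
  refine (norm_sub_le _ _).trans (add_le_add ((norm_heatGrad_le hf t x).trans ?_)
    ((norm_duhamelGrad_le ht0.le hC' x).trans ?_))
  · have : 0 < √t₀ := Real.sqrt_pos.2 ht₀
    gcongr
  · gcongr

lemma contDiff_schrodingerFlow (hVc : Continuous V) (hfc : Continuous f)
    (hV : ∀ x, |V x| ≤ M) (hf : ∀ x, |f x| ≤ B) {t : ℝ} (ht : 0 < t) :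
    ContDiff ℝ 1 (schrodingerFlow V f t) := by
  refine contDiff_one_of_hasGradientAt
    (fun x => hasGradientAt_schrodingerFlow hVc.measurable hfc.measurable hV hf ht x) ?_
  have h1 : Continuous fun x : E => (t, x) := by fun_prop
  rw [← continuousOn_univ]
  exact (continuousOn_schrodingerGrad hVc hfc hV hf).comp h1.continuousOn
    fun x _ => ⟨ht, mem_univ _⟩

end

/-- The difference quotient along `√t • z`, with moving base point, of a strictly differentiable
function. -/
lemma tendsto_inv_sqrt_mul_sub {f : E → ℝ} {x : E} (hf : HasStrictFDerivAt f (fderiv ℝ f x) x)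
    (z : E) :
    Tendsto (fun p : ℝ × E => (√p.1)⁻¹ * (f (p.2 + √p.1 • z) - f p.2)) (𝓝[>] 0 ×ˢ 𝓝 x)
      (𝓝 (inner ℝ (gradient f x) z)) := by
  rw [inner_gradient_left]
  have hs : Tendsto (fun p : ℝ × E => √p.1) (𝓝[>] 0 ×ˢ 𝓝 x) (𝓝 0) := by
    have : Tendsto (fun t : ℝ => √t) (𝓝[>] 0) (𝓝 0) := by
      have := Real.continuous_sqrt.tendsto 0
      rw [Real.sqrt_zero] at this
      exact this.mono_left nhdsWithin_le_nhds
    exact this.comp tendsto_fst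
  have hpt : Tendsto (fun p : ℝ × E => (p.2 + √p.1 • z, p.2)) (𝓝[>] 0 ×ˢ 𝓝 x) (𝓝 (x, x)) := by
    refine Tendsto.prodMk_nhds ?_ tendsto_snd
    simpa using (tendsto_snd (f := 𝓝[>] (0 : ℝ)) (g := 𝓝 x)).add (hs.smul_const z)
  have h1 := (hf.isLittleO).comp_tendsto hpt
  have h2 : (fun p : ℝ × E => f (p.2 + √p.1 • z) - f p.2 - fderiv ℝ f x (√p.1 • z))
      =o[𝓝[>] 0 ×ˢ 𝓝 x] fun p => √p.1 := by
    have h3 : (fun p : ℝ × E => f (p.2 + √p.1 • z) - f p.2 - fderiv ℝ f x (√p.1 • z))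
        =o[𝓝[>] 0 ×ˢ 𝓝 x] fun p => √p.1 • z := by
      simpa [Function.comp_def] using h1
    refine h3.trans_isBigO (Asymptotics.IsBigO.of_bound ‖z‖ (Eventually.of_forall fun p => ?_))
    rw [norm_smul, mul_comm]
  have h4 := h2.tendsto_div_nhds_zero.add_const (fderiv ℝ f x z)
  rw [zero_add] at h4
  refine h4.congr' ?_
  have hpos : ∀ᶠ p : ℝ × E in 𝓝[>] 0 ×ˢ 𝓝 x, 0 < p.1 :=
    tendsto_fst.eventually self_mem_nhdsWithin
  filter_upwards [hpos] with p hp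
  have : √p.1 ≠ 0 := (Real.sqrt_pos.2 hp).ne'
  rw [map_smul, smul_eq_mul]
  field_simp
  ring

lemma heatGrad_eq_integral_sub {f : E → ℝ} (hf : Measurable f) {C : ℝ} (hC : ∀ x, |f x| ≤ C)
    (t : ℝ) (x : E) :
    heatGrad t f x = ∫ z, ((√t)⁻¹ * (f (x + √t • z) - f x)) • z ∂(stdGaussian E) := by
  have h0 : ∫ z : E, z ∂(stdGaussian E) = 0 := integral_id_stdGaussian
  have hz : Integrable (fun z : E => z) (stdGaussian E) := IsGaussian.integrable_fun_id
  have hi : Integrable (fun z => ((√t)⁻¹ * f (x + √t • z)) • z) (stdGaussian E) := by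
    refine (integrable_norm_stdGaussian.const_mul ((√t)⁻¹ * C)).mono'
      ((measurable_const.mul (hf.comp (measurable_add_sqrt_smul t x))).aestronglyMeasurable.smul
        (by fun_prop)) (Eventually.of_forall fun z => ?_)
    rw [norm_smul, norm_mul, Real.norm_of_nonneg (by positivity : 0 ≤ (√t)⁻¹)]
    gcongr
    exact hC _
  have hz' : Integrable (fun z : E => ((√t)⁻¹ * f x) • z) (stdGaussian E) := hz.smul _
  simp only [mul_sub, sub_smul]
  rw [integral_sub hi hz', integral_smul, h0, smul_zero, sub_zero, heatGrad]

/-- A bounded `C¹` function is Lipschitz about every point near `x`, with a constant that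
does not depend on the size of the increment. -/
lemma exists_abs_sub_le_of_contDiff {f : E → ℝ} (hf : ContDiff ℝ 1 f) {C : ℝ}
    (hC : ∀ x, |f x| ≤ C) (x : E) :
    ∃ L, 0 ≤ L ∧ ∀ y ∈ Metric.ball x 1, ∀ w, |f (y + w) - f y| ≤ L * ‖w‖ := by
  obtain ⟨K, hK⟩ := (isCompact_closedBall x 2).exists_bound_of_continuousOn
    (hf.continuous_fderiv one_ne_zero).continuousOn
  have hK0 : 0 ≤ K := (norm_nonneg _).trans (hK x (Metric.mem_closedBall_self (by norm_num)))
  have hC0 : 0 ≤ C := (abs_nonneg _).trans (hC 0)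
  refine ⟨K + 2 * C, by positivity, fun y hy w => ?_⟩
  rcases le_total ‖w‖ 1 with hw | hw
  · have h1 := (convex_closedBall x 2).norm_image_sub_le_of_norm_fderiv_le (𝕜 := ℝ) (f := f)
      (fun z _ => (hf.differentiable one_ne_zero) z) hK (x := y) (y := y + w)
      (Metric.closedBall_subset_closedBall (by norm_num) (Metric.ball_subset_closedBall hy))
      (by
        rw [Metric.mem_ball] at hy
        rw [Metric.mem_closedBall]
        calc dist (y + w) x ≤ dist (y + w) y + dist y x := dist_triangle _ _ _
          _ ≤ 2 := by simp only [dist_self_add_left]; linarith)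
    simp only [add_sub_cancel_left, Real.norm_eq_abs] at h1
    nlinarith [norm_nonneg w]
  · have h1 := abs_sub (f (y + w)) (f y)
    have h2 := hC (y + w)
    have h3 := hC y
    nlinarith

/-- The gradient of `e^{tΔ/2} f` converges locally uniformly to that of `f`. -/
lemma tendsto_heatGrad {f : E → ℝ} (hf : ContDiff ℝ 1 f) {C : ℝ} (hC : ∀ x, |f x| ≤ C) (x : E) :
    Tendsto (fun p : ℝ × E => heatGrad p.1 f p.2) (𝓝[>] 0 ×ˢ 𝓝 x) (𝓝 (gradient f x)) := by
  obtain ⟨L, hL0, hL⟩ := exists_abs_sub_le_of_contDiff hf hC x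
  have hpos : ∀ᶠ p : ℝ × E in 𝓝[>] 0 ×ˢ 𝓝 x, 0 < p.1 :=
    tendsto_fst.eventually self_mem_nhdsWithin
  have hnear : ∀ᶠ p : ℝ × E in 𝓝[>] 0 ×ˢ 𝓝 x, p.2 ∈ Metric.ball x 1 :=
    tendsto_snd.eventually (Metric.ball_mem_nhds x one_pos)
  have hfc := hf.continuous
  rw [← integral_inner_smul_stdGaussian (gradient f x)]
  simp only [heatGrad_eq_integral_sub hfc.measurable hC]
  refine tendsto_integral_filter_of_dominated_convergence (fun z => L * ‖z‖ ^ 2) ?_ ?_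
    ((integrable_norm_pow_stdGaussian 2).const_mul L) ?_
  · refine Eventually.of_forall fun p => Continuous.aestronglyMeasurable ?_
    fun_prop
  · filter_upwards [hpos, hnear] with p hp hp2
    refine Eventually.of_forall fun z => ?_
    have hs : 0 < √p.1 := Real.sqrt_pos.2 hp
    have h1 := hL p.2 hp2 (√p.1 • z)
    rw [norm_smul, Real.norm_of_nonneg hs.le] at h1
    rw [norm_smul, norm_mul, Real.norm_of_nonneg (by positivity : 0 ≤ (√p.1)⁻¹), Real.norm_eq_abs]
    calc (√p.1)⁻¹ * |f (p.2 + √p.1 • z) - f p.2| * ‖z‖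
        ≤ (√p.1)⁻¹ * (L * (√p.1 * ‖z‖)) * ‖z‖ := by gcongr
      _ = L * ‖z‖ ^ 2 := by field_simp
  · refine Eventually.of_forall fun z => ?_
    exact (tendsto_inv_sqrt_mul_sub
      (hf.contDiffAt.hasStrictFDerivAt one_ne_zero) z).smul_const z

lemma tendsto_schrodingerGrad {V f : E → ℝ} {M B : ℝ} (hf : ContDiff ℝ 1 f)
    (hV : ∀ x, |V x| ≤ M) (hfB : ∀ x, |f x| ≤ B) (x : E) :
    Tendsto (fun p : ℝ × E => schrodingerGrad V f p.1 p.2) (𝓝[>] 0 ×ˢ 𝓝 x)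
      (𝓝 (gradient f x)) := by
  have h1 : Tendsto (fun p : ℝ × E =>
      duhamelGrad (fun s y => V y * schrodingerFlow V f s y) p.1 p.2)
      (𝓝[>] 0 ×ˢ 𝓝 x) (𝓝 0) := by
    obtain ⟨C, hC⟩ := (timeLocallyBounded_schrodingerFlow hV hfB).mul_left hV 1
    have hlim : Tendsto (fun p : ℝ × E => 2 * √p.1 * (C * ∫ z : E, ‖z‖ ∂(stdGaussian E)))
        (𝓝[>] 0 ×ˢ 𝓝 x) (𝓝 0) := by
      have h2 : Continuous fun t : ℝ => 2 * √t * (C * ∫ z : E, ‖z‖ ∂(stdGaussian E)) := by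
        fun_prop
      have h3 := (h2.tendsto 0).mono_left (nhdsWithin_le_nhds (s := Ioi 0))
      simp only [Real.sqrt_zero, mul_zero, zero_mul] at h3
      exact h3.comp tendsto_fst
    refine squeeze_zero_norm' ?_ hlim
    have hpos : ∀ᶠ p : ℝ × E in 𝓝[>] 0 ×ˢ 𝓝 x, p.1 ∈ Ioc (0 : ℝ) 1 :=
      tendsto_fst.eventually (Ioc_mem_nhdsGT one_pos)
    filter_upwards [hpos] with p hp
    refine norm_duhamelGrad_le hp.1.le (fun s hs y => ?_) p.2
    exact hC s (by rw [abs_of_nonneg hs.1]; exact hs.2.trans hp.2) y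
  simpa [schrodingerGrad] using (tendsto_heatGrad hf hfB x).sub h1

end

/-! ### The Dirichlet form of the free semigroup -/

section

variable {E : Type*} [NormedAddCommGroup E] [InnerProductSpace ℝ E] [FiniteDimensional ℝ E]
  [MeasurableSpace E] [BorelSpace E]

lemma hasCompactSupport_of_norm {g : E → ℝ} {R : ℝ} (hgR : ∀ x, R < ‖x‖ → g x = 0) :
    HasCompactSupport g :=
  HasCompactSupport.intro (isCompact_closedBall 0 R) fun x hx => hgR x (by simpa using hx)

lemma integrable_one_add_norm_pow_stdGaussian (k : ℕ) :
    Integrable (fun z : E => (1 + ‖z‖) ^ k) (stdGaussian E) := by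
  have h1 : MemLp (fun z : E => ‖z‖) (k : ℝ≥0∞) (stdGaussian E) :=
    (IsGaussian.memLp_id (stdGaussian E) k (by simp)).norm
  have h2 := ((memLp_const (1 : ℝ)).add h1).integrable_norm_pow'
  refine h2.congr (Eventually.of_forall fun z => ?_)
  simp only [Pi.add_apply]
  rw [Real.norm_of_nonneg (by positivity)]

/-- An integrable majorant, with respect to `volume × Gaussian`, of `‖z‖²` on the set
`‖x‖ ≤ R + ‖z‖`. -/
def spreadBound (R : ℝ) (p : E × E) : ℝ :=
  (1 + ‖p.1‖) ^ (-((Module.finrank ℝ E + 1 : ℕ) : ℝ)) *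
    ((1 + R) ^ (Module.finrank ℝ E + 1) * (1 + ‖p.2‖) ^ (Module.finrank ℝ E + 3))

lemma integrable_spreadBound (R : ℝ) :
    Integrable (spreadBound R : E × E → ℝ) ((volume : Measure E).prod (stdGaussian E)) := by
  have h1 : Integrable (fun x : E => (1 + ‖x‖) ^ (-((Module.finrank ℝ E + 1 : ℕ) : ℝ))) :=
    integrable_one_add_norm (by push_cast; linarith)
  have h2 : Integrable (fun z : E => (1 + ‖z‖) ^ (Module.finrank ℝ E + 3)) (stdGaussian E) :=
    integrable_one_add_norm_pow_stdGaussian _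
  exact h1.mul_prod (h2.const_mul _)

lemma sq_norm_le_spreadBound {R : ℝ} (hR : 0 ≤ R) {x z : E} (hx : ‖x‖ ≤ R + ‖z‖) :
    ‖z‖ ^ 2 ≤ spreadBound R (x, z) := by
  simp only [spreadBound]
  rw [Real.rpow_neg (by positivity), Real.rpow_natCast]
  have h1 : (1 + ‖x‖) ^ (Module.finrank ℝ E + 1) ≤
      ((1 + R) * (1 + ‖z‖)) ^ (Module.finrank ℝ E + 1) := by
    gcongr
    nlinarith [norm_nonneg z]
  have h2 : ‖z‖ ^ 2 ≤ (1 + ‖z‖) ^ 2 := by gcongr; linarith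
  rw [inv_mul_eq_div, le_div_iff₀ (by positivity)]
  calc ‖z‖ ^ 2 * (1 + ‖x‖) ^ (Module.finrank ℝ E + 1)
      ≤ (1 + ‖z‖) ^ 2 * ((1 + R) * (1 + ‖z‖)) ^ (Module.finrank ℝ E + 1) := by gcongr
    _ = _ := by rw [mul_pow]; ring

lemma spreadBound_nonneg {R : ℝ} (hR : 0 ≤ R) (p : E × E) : 0 ≤ spreadBound R p := by
  unfold spreadBound; positivity

/-- The product of the difference quotients of `g` and `φ` at `x` along `√h • z`. -/
def diffQuotientMul (g φ : E → ℝ) (h : ℝ) (p : E × E) : ℝ :=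
  ((√h)⁻¹ * (g (p.1 + √h • p.2) - g p.1)) * ((√h)⁻¹ * (φ (p.1 + √h • p.2) - φ p.1))

section

variable {g φ : E → ℝ} {R L L' B : ℝ}

lemma abs_diffQuotientMul_le (hR : 0 ≤ R) (hL : 0 ≤ L) (hL' : 0 ≤ L')
    (hgR : ∀ x, R < ‖x‖ → g x = 0)
    (hgL : ∀ x w, |g (x + w) - g x| ≤ L * ‖w‖) (hφL : ∀ x w, |φ (x + w) - φ x| ≤ L' * ‖w‖)
    {h : ℝ} (h0 : 0 < h) (h1 : h ≤ 1) (p : E × E) :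
    |diffQuotientMul g φ h p| ≤ L * L' * spreadBound R p := by
  obtain ⟨x, z⟩ := p
  have hs : 0 < √h := Real.sqrt_pos.2 h0
  have hs1 : √h ≤ 1 := Real.sqrt_le_one.2 h1
  have hn : ‖√h • z‖ = √h * ‖z‖ := by rw [norm_smul, Real.norm_of_nonneg hs.le]
  have hq : ∀ {K a : ℝ}, |a| ≤ K * ‖√h • z‖ → |(√h)⁻¹ * a| ≤ K * ‖z‖ := by
    intro K a ha
    rw [abs_mul, abs_of_pos (by positivity : 0 < (√h)⁻¹), inv_mul_le_iff₀ hs]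
    rw [hn] at ha
    linarith
  rcases le_or_gt ‖x‖ (R + ‖z‖) with hx | hx
  · calc |diffQuotientMul g φ h (x, z)| ≤ (L * ‖z‖) * (L' * ‖z‖) := by
          rw [diffQuotientMul, abs_mul]
          exact mul_le_mul (hq (hgL _ _)) (hq (hφL _ _)) (abs_nonneg _) (by positivity)
      _ = L * L' * ‖z‖ ^ 2 := by ring
      _ ≤ _ := by gcongr; exact sq_norm_le_spreadBound hR hx
  · have h3 : g x = 0 := hgR x (by linarith [norm_nonneg z])
    have h4 : g (x + √h • z) = 0 := by
      refine hgR _ ?_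
      have h5 : ‖x‖ ≤ ‖x + √h • z‖ + ‖√h • z‖ := by
        simpa using norm_sub_le (x + √h • z) (√h • z)
      rw [hn] at h5
      nlinarith [norm_nonneg z]
    have h5 : diffQuotientMul g φ h (x, z) = 0 := by simp [diffQuotientMul, h3, h4]
    rw [h5, abs_zero]
    exact mul_nonneg (by positivity) (spreadBound_nonneg hR _)

lemma continuous_diffQuotientMul (hg : Continuous g) (hφ : Continuous φ) (h : ℝ) :
    Continuous (diffQuotientMul g φ h) := by
  unfold diffQuotientMul
  fun_prop

lemma integrable_diffQuotientMul (hg : Continuous g) (hφ : Continuous φ)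
    (hR : 0 ≤ R) (hL : 0 ≤ L) (hL' : 0 ≤ L')
    (hgR : ∀ x, R < ‖x‖ → g x = 0)
    (hgL : ∀ x w, |g (x + w) - g x| ≤ L * ‖w‖) (hφL : ∀ x w, |φ (x + w) - φ x| ≤ L' * ‖w‖)
    {h : ℝ} (h0 : 0 < h) (h1 : h ≤ 1) :
    Integrable (diffQuotientMul g φ h) ((volume : Measure E).prod (stdGaussian E)) :=
  ((integrable_spreadBound R).const_mul (L * L')).mono'
    (continuous_diffQuotientMul hg hφ h).aestronglyMeasurable
    (Eventually.of_forall fun p => abs_diffQuotientMul_le hR hL hL' hgR hgL hφL h0 h1 p)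

lemma heatFlow_sub_self (hφ : Continuous φ) (hφB : ∀ x, |φ x| ≤ B) (h : ℝ) (x : E) :
    heatFlow h φ x - φ x = ∫ z, (φ (x + √h • z) - φ x) ∂(stdGaussian E) := by
  rw [integral_sub (integrable_comp_add_sqrt_smul hφ.measurable hφB h x) (integrable_const _)]
  simp [heatFlow]

/-- The Dirichlet form of `e^{hΔ/2}`: the symmetries `z ↦ -z` and `x ↦ x + √h z` turn the pairing
of `g` with `e^{hΔ/2} φ - φ` into a product of first-order differences. -/
lemma integral_mul_heatFlow_sub (hg : Continuous g) (hφ : Continuous φ)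
    (hφB : ∀ x, |φ x| ≤ B) (hR : 0 ≤ R) (hL : 0 ≤ L) (hL' : 0 ≤ L')
    (hgR : ∀ x, R < ‖x‖ → g x = 0)
    (hgL : ∀ x w, |g (x + w) - g x| ≤ L * ‖w‖) (hφL : ∀ x w, |φ (x + w) - φ x| ≤ L' * ‖w‖)
    {h : ℝ} (h0 : 0 < h) (h1 : h ≤ 1) :
    ∫ x, g x * (h⁻¹ * (heatFlow h φ x - φ x)) =
      -(1 / 2) * ∫ p, diffQuotientMul g φ h p ∂((volume : Measure E).prod (stdGaussian E)) := by
  have hgi : Integrable g := hg.integrable_of_hasCompactSupport (hasCompactSupport_of_norm hgR)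
  have hB : ∀ x w, |φ (x + w) - φ x| ≤ 2 * B := fun x w =>
    (abs_sub _ _).trans (by linarith [hφB (x + w), hφB x])
  have hFc : Continuous fun p : E × E => g p.1 * (φ (p.1 + √h • p.2) - φ p.1) := by fun_prop
  have hF : Integrable (fun p : E × E => g p.1 * (φ (p.1 + √h • p.2) - φ p.1))
      ((volume : Measure E).prod (stdGaussian E)) := by
    refine (hgi.norm.mul_prod (integrable_const (2 * B))).mono' hFc.aestronglyMeasurable
      (Eventually.of_forall fun p => ?_)
    rw [norm_mul]
    exact mul_le_mul_of_nonneg_left (hB _ _) (norm_nonneg _)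
  set a : E → ℝ := fun z => ∫ x, g x * (φ (x + √h • z) - φ x) with ha
  have hai : Integrable a (stdGaussian E) := hF.integral_prod_right
  have hA : ∫ x, g x * (h⁻¹ * (heatFlow h φ x - φ x)) = h⁻¹ * ∫ z, a z ∂(stdGaussian E) := by
    rw [ha, ← integral_integral_swap (f := fun x z => g x * (φ (x + √h • z) - φ x)) hF,
      ← integral_const_mul]
    congr 1
    ext x
    rw [heatFlow_sub_self hφ hφB, integral_const_mul]
    ring
  have hsymm : ∫ z, a (-z) ∂(stdGaussian E) = ∫ z, a z ∂(stdGaussian E) := by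
    conv_rhs => rw [← map_neg_stdGaussian]
    rw [integral_map (by fun_prop)]
    rw [map_neg_stdGaussian]
    exact hai.aestronglyMeasurable
  have hai' : Integrable (fun z => a (-z)) (stdGaussian E) := by
    have : Integrable a ((stdGaussian E).map (fun z => -z)) := by rwa [map_neg_stdGaussian]
    exact this.comp_measurable measurable_neg
  -- Averaging over `±z` and translating `x` by `√h • z` makes the pairing symmetric in `g` and `φ`.
  have hsum : ∀ z, a z + a (-z) = -h * ∫ x, diffQuotientMul g φ h (x, z) := by
    intro z
    have hneg : a (-z) = ∫ x, g (x + √h • z) * (φ x - φ (x + √h • z)) := by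
      simp only [ha]
      rw [← integral_add_right_eq_self _ (√h • z)]
      simp
    have hi1 : Integrable fun x => g x * (φ (x + √h • z) - φ x) := by
      refine Continuous.integrable_of_hasCompactSupport (by fun_prop) ?_
      exact (hasCompactSupport_of_norm hgR).mul_right
    have hi2 : Integrable fun x => g (x + √h • z) * (φ x - φ (x + √h • z)) := by
      have h2 : Integrable fun x => g x * (φ (x + √h • -z) - φ x) := by
        refine Continuous.integrable_of_hasCompactSupport (by fun_prop) ?_
        exact (hasCompactSupport_of_norm hgR).mul_right
      simpa using h2.comp_add_right (√h • z)
    rw [hneg]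
    simp only [ha]
    rw [← integral_add hi1 hi2, ← integral_const_mul]
    congr 1
    ext x
    have hs : (√h)⁻¹ * (√h)⁻¹ = h⁻¹ := by rw [← mul_inv, Real.mul_self_sqrt h0.le]
    simp only [diffQuotientMul]
    rw [show ((√h)⁻¹ * (g (x + √h • z) - g x)) * ((√h)⁻¹ * (φ (x + √h • z) - φ x)) =
      ((√h)⁻¹ * (√h)⁻¹) * ((g (x + √h • z) - g x) * (φ (x + √h • z) - φ x)) by ring, hs]
    field_simp
    ring
  have hD := integrable_diffQuotientMul hg hφ hR hL hL' hgR hgL hφL h0 h1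
  have hfin : 2 * ∫ z, a z ∂(stdGaussian E) = -h * ∫ p, diffQuotientMul g φ h p
      ∂((volume : Measure E).prod (stdGaussian E)) := by
    rw [two_mul]
    nth_rewrite 2 [← hsymm]
    rw [← integral_add hai hai', integral_prod_symm _ hD, ← integral_const_mul]
    simp only [hsum]
  rw [hA]
  have h2 : ∫ z, a z ∂(stdGaussian E) = -(h / 2) * ∫ p, diffQuotientMul g φ h p
      ∂((volume : Measure E).prod (stdGaussian E)) := by linarith
  rw [h2]
  field_simp

lemma abs_integral_mul_heatFlow_sub_le (hg : Continuous g) (hφ : Continuous φ)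
    (hφB : ∀ x, |φ x| ≤ B) (hR : 0 ≤ R) (hL : 0 ≤ L) (hL' : 0 ≤ L')
    (hgR : ∀ x, R < ‖x‖ → g x = 0)
    (hgL : ∀ x w, |g (x + w) - g x| ≤ L * ‖w‖) (hφL : ∀ x w, |φ (x + w) - φ x| ≤ L' * ‖w‖)
    {h : ℝ} (h0 : 0 < h) (h1 : h ≤ 1) :
    |∫ x, g x * (h⁻¹ * (heatFlow h φ x - φ x))| ≤ 1 / 2 * (L * L' *
      ∫ p, spreadBound R p ∂((volume : Measure E).prod (stdGaussian E))) := by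
  rw [integral_mul_heatFlow_sub hg hφ hφB hR hL hL' hgR hgL hφL h0 h1, abs_mul]
  have h2 : |(-(1 / 2) : ℝ)| = 1 / 2 := by norm_num
  rw [h2, ← integral_const_mul]
  gcongr
  exact norm_integral_le_of_norm_le (f := diffQuotientMul g φ h)
    ((integrable_spreadBound R).const_mul _)
    (Eventually.of_forall fun p => abs_diffQuotientMul_le hR hL hL' hgR hgL hφL h0 h1 p)

/-- The generator of `e^{hΔ/2}` in weak form, for `C¹` functions. -/
lemma tendsto_integral_mul_heatFlow_sub (hg : ContDiff ℝ 1 g) (hφ : ContDiff ℝ 1 φ)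
    (hφB : ∀ x, |φ x| ≤ B) (hR : 0 ≤ R) (hL : 0 ≤ L) (hL' : 0 ≤ L')
    (hgR : ∀ x, R < ‖x‖ → g x = 0)
    (hgL : ∀ x w, |g (x + w) - g x| ≤ L * ‖w‖) (hφL : ∀ x w, |φ (x + w) - φ x| ≤ L' * ‖w‖) :
    Tendsto (fun h : ℝ => ∫ x, g x * (h⁻¹ * (heatFlow h φ x - φ x))) (𝓝[>] 0)
      (𝓝 (-(1 / 2) * ∫ x, (inner ℝ (gradient g x) (gradient φ x) : ℝ))) := by
  have hsmall : ∀ᶠ h : ℝ in 𝓝[>] 0, h ∈ Ioc (0 : ℝ) 1 := Ioc_mem_nhdsGT one_pos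
  have hcg := continuous_gradient hg
  have hcφ := continuous_gradient hφ
  have hlim : Tendsto (fun h : ℝ => ∫ p, diffQuotientMul g φ h p
      ∂((volume : Measure E).prod (stdGaussian E))) (𝓝[>] 0)
      (𝓝 (∫ p : E × E, (inner ℝ (gradient g p.1) p.2 : ℝ) * inner ℝ (gradient φ p.1) p.2
        ∂((volume : Measure E).prod (stdGaussian E)))) := by
    refine tendsto_integral_filter_of_dominated_convergence (fun p => L * L' * spreadBound R p)
      (Eventually.of_forall fun h =>
        (continuous_diffQuotientMul hg.continuous hφ.continuous h).aestronglyMeasurable) ?_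
      ((integrable_spreadBound R).const_mul _) (Eventually.of_forall fun p => ?_)
    · filter_upwards [hsmall] with h hh
      exact Eventually.of_forall fun p =>
        abs_diffQuotientMul_le hR hL hL' hgR hgL hφL hh.1 hh.2 p
    · have hpair : Tendsto (fun h : ℝ => (h, p.1)) (𝓝[>] 0) (𝓝[>] 0 ×ˢ 𝓝 p.1) :=
        tendsto_id.prodMk tendsto_const_nhds
      exact ((tendsto_inv_sqrt_mul_sub (hg.contDiffAt.hasStrictFDerivAt one_ne_zero) p.2).comp
        hpair).mul ((tendsto_inv_sqrt_mul_sub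
          (hφ.contDiffAt.hasStrictFDerivAt one_ne_zero) p.2).comp hpair)
  have hval : ∫ p : E × E, (inner ℝ (gradient g p.1) p.2 : ℝ) * inner ℝ (gradient φ p.1) p.2
      ∂((volume : Measure E).prod (stdGaussian E)) =
      ∫ x, (inner ℝ (gradient g x) (gradient φ x) : ℝ) := by
    have hgs : HasCompactSupport (gradient g) := by
      refine HasCompactSupport.comp_left (g := (InnerProductSpace.toDual ℝ E).symm)
        ((hasCompactSupport_of_norm hgR).fderiv ℝ) (map_zero _)
    rw [integral_prod]
    · simp only [integral_inner_mul_inner_stdGaussian]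
    · have h1 : Integrable fun x => ‖gradient g x‖ * ‖gradient φ x‖ := by
        refine Continuous.integrable_of_hasCompactSupport (by fun_prop) ?_
        exact hgs.norm.mul_right
      refine (h1.mul_prod (integrable_norm_pow_stdGaussian 2)).mono'
        (Continuous.aestronglyMeasurable (by fun_prop)) (Eventually.of_forall fun p => ?_)
      rw [norm_mul]
      calc ‖(inner ℝ (gradient g p.1) p.2 : ℝ)‖ * ‖(inner ℝ (gradient φ p.1) p.2 : ℝ)‖
          ≤ (‖gradient g p.1‖ * ‖p.2‖) * (‖gradient φ p.1‖ * ‖p.2‖) := by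
            gcongr <;> exact norm_inner_le_norm _ _
        _ = _ := by ring
  rw [← hval]
  refine (hlim.const_mul (-(1 / 2))).congr' ?_
  filter_upwards [hsmall] with h hh
  exact (integral_mul_heatFlow_sub hg.continuous hφ.continuous hφB hR hL hL' hgR hgL hφL
    hh.1 hh.2).symm

end

end

/-! ### Difference quotients and time increments -/

section

section Translation

variable {X : Type*} [NormedAddCommGroup X] [NormedSpace ℝ X] [FiniteDimensional ℝ X]
  [MeasurableSpace X] [BorelSpace X] {μ : Measure X}

lemma integrable_indicator_closedBall_const [IsFiniteMeasureOnCompacts μ] (R c : ℝ) :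
    Integrable (indicator (Metric.closedBall (0 : X) R) fun _ => c) μ := by
  rw [integrable_indicator_iff Metric.isClosed_closedBall.measurableSet]
  exact continuousOn_const.integrableOn_compact (isCompact_closedBall 0 R)

lemma norm_le_indicator_closedBall {F : X → ℝ} {R c : ℝ}
    (hc : ∀ x, |F x| ≤ c) (h0 : ∀ x, R < ‖x‖ → F x = 0) (x : X) :
    ‖F x‖ ≤ indicator (Metric.closedBall (0 : X) R) (fun _ => c) x := by
  by_cases hx : x ∈ Metric.closedBall (0 : X) R
  · rw [indicator_of_mem hx]
    exact hc x
  · rw [indicator_of_notMem hx, h0 x (by simpa using hx), norm_zero]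

lemma abs_integral_le_of_closedBall [IsFiniteMeasureOnCompacts μ] {F : X → ℝ} {R c : ℝ}
    (hc : ∀ x, |F x| ≤ c) (h0 : ∀ x, R < ‖x‖ → F x = 0) :
    |∫ x, F x ∂μ| ≤ μ.real (Metric.closedBall 0 R) * c := by
  have h1 := norm_integral_le_of_norm_le (integrable_indicator_closedBall_const (μ := μ) R c)
    (Eventually.of_forall (norm_le_indicator_closedBall hc h0))
  rwa [integral_indicator Metric.isClosed_closedBall.measurableSet, setIntegral_const,
    smul_eq_mul] at h1

lemma tendsto_integral_of_closedBall [IsFiniteMeasureOnCompacts μ] {F : ℝ → X → ℝ} {G : X → ℝ}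
    {R c : ℝ} (hm : ∀ᶠ h in 𝓝[>] 0, Continuous (F h)) (hc : ∀ᶠ h in 𝓝[>] 0, ∀ x, |F h x| ≤ c)
    (h0 : ∀ h, ∀ x, R < ‖x‖ → F h x = 0)
    (hlim : ∀ x, Tendsto (fun h => F h x) (𝓝[>] 0) (𝓝 (G x))) :
    Tendsto (fun h => ∫ x, F h x ∂μ) (𝓝[>] 0) (𝓝 (∫ x, G x ∂μ)) := by
  refine tendsto_integral_filter_of_dominated_convergence _
    (hm.mono fun h hh => hh.aestronglyMeasurable) ?_
    (integrable_indicator_closedBall_const (μ := μ) R c) (Eventually.of_forall hlim)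
  filter_upwards [hc] with h hh
  exact Eventually.of_forall (norm_le_indicator_closedBall hh (h0 h))

/-- Summation by parts: the weak derivative of a continuous function along `v` as the limit of
forward difference quotients. -/
lemma tendsto_integral_mul_diffQuotient [μ.IsAddHaarMeasure] {θ ℓ : X → ℝ}
    (hθ : ContDiff ℝ 1 θ) (hθs : HasCompactSupport θ) (hℓ : Continuous ℓ) (v : X) :
    Tendsto (fun h : ℝ => ∫ p, θ p * (h⁻¹ * (ℓ (p + h • v) - ℓ p)) ∂μ) (𝓝[>] 0)
      (𝓝 (-∫ p, fderiv ℝ θ p v * ℓ p ∂μ)) := by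
  have hθc := hθ.continuous
  obtain ⟨K, hK⟩ := hθ.lipschitzWith_of_hasCompactSupport hθs one_ne_zero
  obtain ⟨R, hR⟩ := hθs.isCompact.isBounded.subset_closedBall 0
  have hR0 : ∀ p, R < ‖p‖ → θ p = 0 := fun p hp =>
    image_eq_zero_of_notMem_tsupport fun h => by
      have := hR h
      rw [mem_closedBall_zero_iff] at this
      linarith
  have heq : ∀ h : ℝ, ∫ p, θ p * (h⁻¹ * (ℓ (p + h • v) - ℓ p)) ∂μ =
      ∫ p, (h⁻¹ * (θ (p + h • -v) - θ p)) * ℓ p ∂μ := by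
    intro h
    have h1 : Integrable (fun p => θ p * ℓ (p + h • v)) μ :=
      Continuous.integrable_of_hasCompactSupport (by fun_prop) hθs.mul_right
    have h2 : Integrable (fun p => θ p * ℓ p) μ :=
      Continuous.integrable_of_hasCompactSupport (by fun_prop) hθs.mul_right
    have h3 : ∫ p, θ (p + h • -v) * ℓ p ∂μ = ∫ p, θ p * ℓ (p + h • v) ∂μ := by
      rw [← integral_add_right_eq_self _ (h • v)]
      simp
    have h4 : Integrable (fun p => θ (p + h • -v) * ℓ p) μ := by
      simpa using h1.comp_add_right (h • -v)
    calc ∫ p, θ p * (h⁻¹ * (ℓ (p + h • v) - ℓ p)) ∂μ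
        = ∫ p, h⁻¹ * (θ p * ℓ (p + h • v) - θ p * ℓ p) ∂μ := by congr 1; ext p; ring
      _ = h⁻¹ * (∫ p, θ (p + h • -v) * ℓ p ∂μ - ∫ p, θ p * ℓ p ∂μ) := by
          rw [integral_const_mul, integral_sub h1 h2, h3]
      _ = ∫ p, h⁻¹ * (θ (p + h • -v) * ℓ p - θ p * ℓ p) ∂μ := by
          rw [integral_const_mul, integral_sub h4 h2]
      _ = _ := by congr 1; ext p; ring
  simp only [heq]
  rw [← integral_neg]
  have hsmall : ∀ᶠ h : ℝ in 𝓝[>] 0, h ∈ Ioc (0 : ℝ) 1 := Ioc_mem_nhdsGT one_pos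
  have hbi : Integrable (indicator (Metric.closedBall (0 : X) (R + ‖v‖))
      fun p => K * ‖v‖ * |ℓ p|) μ := by
    rw [integrable_indicator_iff Metric.isClosed_closedBall.measurableSet]
    exact Continuous.continuousOn (by fun_prop) |>.integrableOn_compact (isCompact_closedBall 0 _)
  refine tendsto_integral_filter_of_dominated_convergence _ ?_ ?_ hbi
    (Eventually.of_forall fun p => ?_)
  · exact Eventually.of_forall fun h => Continuous.aestronglyMeasurable (by fun_prop)
  · filter_upwards [hsmall] with h hh
    refine Eventually.of_forall fun p => ?_
    have hn : ‖h • -v‖ = h * ‖v‖ := by rw [norm_smul, norm_neg, Real.norm_of_nonneg hh.1.le]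
    by_cases hp : p ∈ Metric.closedBall (0 : X) (R + ‖v‖)
    · rw [indicator_of_mem hp, norm_mul, norm_mul, Real.norm_of_nonneg (inv_nonneg.2 hh.1.le)]
      have h5 := hK.norm_sub_le (p + h • -v) p
      rw [add_sub_cancel_left, hn] at h5
      refine mul_le_mul_of_nonneg_right ?_ (abs_nonneg _)
      rw [inv_mul_le_iff₀ hh.1]
      exact h5.trans (le_of_eq (by ring))
    · rw [indicator_of_notMem hp]
      rw [mem_closedBall_zero_iff, not_le] at hp
      have h6 : ‖p‖ ≤ ‖p + h • -v‖ + ‖h • -v‖ := by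
        simpa using norm_sub_le (p + h • -v) (h • -v)
      rw [hn] at h6
      have h7 : θ (p + h • -v) = 0 := hR0 _ (by nlinarith [norm_nonneg v, hh.2])
      have h8 : θ p = 0 := hR0 _ (by linarith [norm_nonneg v])
      rw [h7, h8]
      simp
  · have h9 : HasLineDerivAt ℝ θ (fderiv ℝ θ p (-v)) p (-v) :=
      ((hθ.differentiable one_ne_zero) p).hasFDerivAt.hasLineDerivAt (-v)
    have h10 := h9.tendsto_slope_zero_right.mul_const (ℓ p)
    simpa using h10

end Translation

/-- The first-order Taylor remainder of `log` on `[κ, ∞)`. -/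
lemma abs_log_sub_log_sub_le {κ a b : ℝ} (hκ : 0 < κ) (ha : κ ≤ a) (hb : κ ≤ b) :
    |Real.log b - Real.log a - (b - a) / a| ≤ (b - a) ^ 2 / κ ^ 2 := by
  have ha0 : 0 < a := hκ.trans_le ha
  have hb0 : 0 < b := hκ.trans_le hb
  have h1 : Real.log b - Real.log a ≤ (b - a) / a := by
    rw [← Real.log_div hb0.ne' ha0.ne', sub_div, div_self ha0.ne']
    exact Real.log_le_sub_one_of_pos (by positivity)
  have h2 : (b - a) / b ≤ Real.log b - Real.log a := by
    have := Real.log_le_sub_one_of_pos (x := a / b) (by positivity)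
    rw [Real.log_div ha0.ne' hb0.ne'] at this
    rw [sub_div, div_self hb0.ne']
    linarith
  have h3 : (b - a) / a - (b - a) / b = (b - a) ^ 2 / (a * b) := by field_simp
  have h4 : (b - a) ^ 2 / (a * b) ≤ (b - a) ^ 2 / κ ^ 2 := by
    gcongr
    nlinarith
  rw [abs_le]
  constructor <;> linarith [div_nonneg (sq_nonneg (b - a)) (sq_nonneg κ)]

variable {E : Type*} [NormedAddCommGroup E] [InnerProductSpace ℝ E] [FiniteDimensional ℝ E]
  [MeasurableSpace E] [BorelSpace E]

lemma abs_sub_le_of_norm_gradient_le {f : E → ℝ} (hf : Differentiable ℝ f) {C : ℝ}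
    (hC : ∀ x, ‖gradient f x‖ ≤ C) (x w : E) : |f (x + w) - f x| ≤ C * ‖w‖ := by
  have h1 := (convex_univ (E := E) (𝕜 := ℝ)).norm_image_sub_le_of_norm_fderiv_le (𝕜 := ℝ) (f := f)
    (C := C) (fun z _ => hf z) (fun z _ => by simpa [gradient] using hC z) (mem_univ x)
    (mem_univ (x + w))
  simpa using h1

section

variable {V f : E → ℝ} {M B : ℝ}

lemma gradient_schrodingerFlow (hVc : Continuous V) (hfc : Continuous f)
    (hV : ∀ x, |V x| ≤ M) (hf : ∀ x, |f x| ≤ B) {t : ℝ} (ht : 0 < t) :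
    gradient (schrodingerFlow V f t) = schrodingerGrad V f t :=
  funext fun x =>
    (hasGradientAt_schrodingerFlow hVc.measurable hfc.measurable hV hf ht x).gradient

/-- The potential term of the Duhamel formula started at time `t`. -/
def potentialTerm (V f : E → ℝ) (t s : ℝ) (y : E) : ℝ := V y * schrodingerFlow V f (t + s) y

lemma continuous_potentialTerm (hVc : Continuous V) (hfc : Continuous f)
    (hV : ∀ x, |V x| ≤ M) (hf : ∀ x, |f x| ≤ B) (t : ℝ) :
    Continuous (Function.uncurry (potentialTerm V f t)) :=
  (hVc.comp continuous_snd).mul ((continuous_schrodingerFlow hVc hfc hV hf).comp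
    (by fun_prop : Continuous fun p : ℝ × E => (t + p.1, p.2)))

lemma timeLocallyBounded_potentialTerm (hV : ∀ x, |V x| ≤ M) (hf : ∀ x, |f x| ≤ B) (t : ℝ) :
    TimeLocallyBounded (potentialTerm V f t) :=
  ((timeLocallyBounded_schrodingerFlow hV hf).comp_add_left t).mul_left hV

/-- The increment of `φ` over `[t, t + h]`: a free part, paired with test functions through the
Dirichlet form, and a potential part of order `h`. -/
lemma schrodingerFlow_add_sub (hVc : Continuous V) (hfc : Continuous f)
    (hV : ∀ x, |V x| ≤ M) (hf : ∀ x, |f x| ≤ B) {t h : ℝ} (ht : 0 ≤ t) (hh : 0 ≤ h) (x : E) :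
    schrodingerFlow V f (t + h) x - schrodingerFlow V f t x =
      (heatFlow h (schrodingerFlow V f t) x - schrodingerFlow V f t x) -
        duhamel (potentialTerm V f t) h x := by
  rw [schrodingerFlow_add_eq hVc.measurable hfc.measurable hV hf ht hh]
  have h1 : potentialTerm V f t = fun s y => V y * schrodingerFlow V f (t + s) y := rfl
  rw [h1]
  ring

lemma exists_abs_duhamel_potentialTerm_le (hV : ∀ x, |V x| ≤ M) (hf : ∀ x, |f x| ≤ B) (T : ℝ) :
    ∃ C, 0 ≤ C ∧ ∀ t, 0 ≤ t → t ≤ T → ∀ h, 0 < h → h ≤ 1 → ∀ x,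
      |duhamel (potentialTerm V f t) h x| ≤ C * h := by
  obtain ⟨C, hC⟩ := (timeLocallyBounded_schrodingerFlow hV hf).mul_left hV (T + 1)
  refine ⟨max C 0, le_max_right _ _, fun t ht htT h hh hh1 x => ?_⟩
  have h1 := abs_duhamel_le (h := potentialTerm V f t) (t := h) (c := max C 0) (n := 0)
    (fun s hs y => ?_) x
  · simpa [abs_of_pos hh] using h1
  · rw [uIcc_of_le hh.le] at hs
    rw [pow_zero, mul_one]
    refine (hC (t + s) ?_ y).trans (le_max_left _ _)
    rw [abs_of_nonneg (add_nonneg ht hs.1)]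
    linarith [hs.2]

/-- `φ(t)` is Lipschitz in space, uniformly for `t₀ ≤ t ≤ T`. -/
lemma exists_abs_schrodingerFlow_sub_le (hVc : Continuous V) (hfc : Continuous f)
    (hV : ∀ x, |V x| ≤ M) (hf : ∀ x, |f x| ≤ B) {t₀ : ℝ} (ht₀ : 0 < t₀) (T : ℝ) :
    ∃ L, 0 ≤ L ∧ ∀ t, t₀ ≤ t → t ≤ T → ∀ x w,
      |schrodingerFlow V f t (x + w) - schrodingerFlow V f t x| ≤ L * ‖w‖ := by
  obtain ⟨L, hL⟩ := exists_norm_schrodingerGrad_le hV hf ht₀ T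
  refine ⟨max L 0, le_max_right _ _, fun t ht htT x w => ?_⟩
  have ht0 := ht₀.trans_le ht
  refine abs_sub_le_of_norm_gradient_le
    ((contDiff_schrodingerFlow hVc hfc hV hf ht0).differentiable one_ne_zero) (fun y => ?_) x w
  rw [gradient_schrodingerFlow hVc hfc hV hf ht0]
  exact (hL t ht htT y).trans (le_max_left _ _)

/-- `t ↦ φ(t, x)` is Hölder continuous with exponent `1/2`, uniformly in `x`. -/
lemma exists_abs_schrodingerFlow_add_sub_le (hVc : Continuous V) (hfc : Continuous f)
    (hV : ∀ x, |V x| ≤ M) (hf : ∀ x, |f x| ≤ B) {t₀ : ℝ} (ht₀ : 0 < t₀) (T : ℝ) :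
    ∃ C, 0 ≤ C ∧ ∀ t, t₀ ≤ t → t ≤ T → ∀ h, 0 < h → h ≤ 1 → ∀ x,
      |schrodingerFlow V f (t + h) x - schrodingerFlow V f t x| ≤ C * √h := by
  obtain ⟨L, hL0, hL⟩ := exists_abs_schrodingerFlow_sub_le hVc hfc hV hf ht₀ T
  obtain ⟨D, hD0, hD⟩ := exists_abs_duhamel_potentialTerm_le hV hf T
  have hm : 0 ≤ ∫ z : E, ‖z‖ ∂(stdGaussian E) := integral_nonneg fun _ => norm_nonneg _
  refine ⟨L * (∫ z : E, ‖z‖ ∂(stdGaussian E)) + D, by positivity, fun t ht htT h hh hh1 x => ?_⟩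
  have ht0 : 0 < t := ht₀.trans_le ht
  obtain ⟨C, hC⟩ := timeLocallyBounded_schrodingerFlow hV hf |t|
  have hs : 0 < √h := Real.sqrt_pos.2 hh
  have hh2 : h ≤ √h := by
    calc h = √h * √h := (Real.mul_self_sqrt hh.le).symm
      _ ≤ √h * 1 := by gcongr; exact Real.sqrt_le_one.2 hh1
      _ = √h := mul_one _
  have h1 : |heatFlow h (schrodingerFlow V f t) x - schrodingerFlow V f t x| ≤
      L * (∫ z : E, ‖z‖ ∂(stdGaussian E)) * √h := by
    rw [heatFlow_sub_self (contDiff_schrodingerFlow hVc hfc hV hf ht0).continuous (hC t le_rfl)]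
    have h2 := norm_integral_le_of_norm_le (μ := stdGaussian E)
      (f := fun z => schrodingerFlow V f t (x + √h • z) - schrodingerFlow V f t x)
      (integrable_norm_stdGaussian.const_mul (L * √h)) (Eventually.of_forall fun z => by
        refine (hL t ht htT x (√h • z)).trans (le_of_eq ?_)
        rw [norm_smul, Real.norm_of_nonneg hs.le, mul_assoc])
    refine h2.trans (le_of_eq ?_)
    rw [integral_const_mul]
    ring
  rw [schrodingerFlow_add_sub hVc hfc hV hf ht0.le hh.le, add_mul]
  refine (abs_sub _ _).trans (add_le_add h1 ((hD t ht0.le htT h hh hh1 x).trans ?_))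
  gcongr

/-- The time increments of `φ` are `o(√h)`, because the Gaussian average of `⟨∇φ, z⟩` vanishes. -/
lemma tendsto_inv_sqrt_mul_schrodingerFlow_add_sub (hVc : Continuous V) (hfc : Continuous f)
    (hV : ∀ x, |V x| ≤ M) (hf : ∀ x, |f x| ≤ B) {t : ℝ} (ht : 0 < t) (x : E) :
    Tendsto (fun h : ℝ => (√h)⁻¹ * (schrodingerFlow V f (t + h) x - schrodingerFlow V f t x))
      (𝓝[>] 0) (𝓝 0) := by
  have hsmall : ∀ᶠ h : ℝ in 𝓝[>] 0, h ∈ Ioc (0 : ℝ) 1 := Ioc_mem_nhdsGT one_pos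
  obtain ⟨L, hL0, hL⟩ := exists_abs_schrodingerFlow_sub_le hVc hfc hV hf ht t
  obtain ⟨C, hC⟩ := timeLocallyBounded_schrodingerFlow hV hf |t|
  have hφ := contDiff_schrodingerFlow hVc hfc hV hf ht
  have hφc := hφ.continuous
  have h1 : Tendsto (fun h : ℝ => ∫ z, (√h)⁻¹ * (schrodingerFlow V f t (x + √h • z) -
      schrodingerFlow V f t x) ∂(stdGaussian E)) (𝓝[>] 0)
      (𝓝 (∫ z, (inner ℝ (gradient (schrodingerFlow V f t) x) z : ℝ) ∂(stdGaussian E))) := by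
    refine tendsto_integral_filter_of_dominated_convergence (fun z => L * ‖z‖)
      (Eventually.of_forall fun h => Continuous.aestronglyMeasurable (by fun_prop)) ?_
      (integrable_norm_stdGaussian.const_mul L) (Eventually.of_forall fun z => ?_)
    · filter_upwards [hsmall] with h hh
      refine Eventually.of_forall fun z => ?_
      have hs : 0 < √h := Real.sqrt_pos.2 hh.1
      have h2 := hL t le_rfl le_rfl x (√h • z)
      rw [norm_smul, Real.norm_of_nonneg hs.le] at h2
      rw [norm_mul, Real.norm_of_nonneg (inv_nonneg.2 hs.le), inv_mul_le_iff₀ hs]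
      exact h2.trans (le_of_eq (by ring))
    · exact (tendsto_inv_sqrt_mul_sub (hφ.contDiffAt.hasStrictFDerivAt one_ne_zero) z).comp
        (tendsto_id.prodMk tendsto_const_nhds)
  have h0 : ∫ z, (inner ℝ (gradient (schrodingerFlow V f t) x) z : ℝ) ∂(stdGaussian E) = 0 :=
    integral_strongDual_stdGaussian (innerSL ℝ (gradient (schrodingerFlow V f t) x))
  rw [h0] at h1
  have h2 : Tendsto (fun h : ℝ => √h * (h⁻¹ * duhamel (potentialTerm V f t) h x)) (𝓝[>] 0)
      (𝓝 0) := by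
    have hs : Tendsto (fun h : ℝ => √h) (𝓝[>] 0) (𝓝 0) := by
      have := (Real.continuous_sqrt.tendsto 0).mono_left (nhdsWithin_le_nhds (s := Ioi 0))
      rwa [Real.sqrt_zero] at this
    have := hs.mul (tendsto_inv_mul_duhamel (continuous_potentialTerm hVc hfc hV hf t)
      (timeLocallyBounded_potentialTerm hV hf t) x)
    rwa [zero_mul] at this
  have h3 := h1.sub h2
  rw [sub_zero] at h3
  refine h3.congr' ?_
  filter_upwards [self_mem_nhdsWithin] with h hh
  have hh : 0 < h := hh
  have hs : √h ≠ 0 := (Real.sqrt_pos.2 hh).ne'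
  have hs2 : √h * h⁻¹ = (√h)⁻¹ := by
    nth_rewrite 2 [← Real.mul_self_sqrt hh.le]
    field_simp
  rw [schrodingerFlow_add_sub hVc hfc hV hf ht.le hh.le, heatFlow_sub_self hφc (hC t le_rfl),
    integral_const_mul, ← mul_assoc, hs2, mul_sub]

end

end

/-! ### Time increments of the logarithm -/

section

variable {E : Type*} [NormedAddCommGroup E] [InnerProductSpace ℝ E] [FiniteDimensional ℝ E]
  [MeasurableSpace E] [BorelSpace E]

lemma hasGradientAt_div {θ φ : E → ℝ} {a b x : E} (hθ : HasGradientAt θ a x)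
    (hφ : HasGradientAt φ b x) (h0 : φ x ≠ 0) :
    HasGradientAt (fun y => θ y / φ y) ((φ x)⁻¹ • a - (θ x / φ x ^ 2) • b) x := by
  have h1 := hθ.hasFDerivAt.mul ((hasDerivAt_inv h0).comp_hasFDerivAt x hφ.hasFDerivAt)
  rw [hasGradientAt_iff_hasFDerivAt]
  refine (h1.congr_fderiv ?_).congr_of_eventuallyEq (Eventually.of_forall fun y => ?_)
  · ext v
    simp
    ring
  · simp [div_eq_mul_inv]

/-- The Cole–Hopf velocity `-φ⁻¹ ∇φ` of `φ = schrodingerFlow V f`. -/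
def velocity (V f : E → ℝ) (t : ℝ) (x : E) : E :=
  -((schrodingerFlow V f t x)⁻¹ • schrodingerGrad V f t x)

section

variable {V f θ : E → ℝ} {M B κ R K₀ K₁ : ℝ}

/-- The quadratic remainder of `log` in the increment of `φ` over `[t, t + h]`. -/
def logRemainder (V f : E → ℝ) (t h : ℝ) (x : E) : ℝ :=
  Real.log (schrodingerFlow V f (t + h) x) - Real.log (schrodingerFlow V f t x) -
    (schrodingerFlow V f (t + h) x - schrodingerFlow V f t x) / schrodingerFlow V f t x

lemma mul_log_sub_log_eq (hVc : Continuous V) (hfc : Continuous f)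
    (hV : ∀ x, |V x| ≤ M) (hf : ∀ x, |f x| ≤ B) {t h : ℝ} (ht : 0 ≤ t) (hh : 0 ≤ h) (x : E) :
    θ x * (h⁻¹ * (Real.log (schrodingerFlow V f (t + h) x) -
        Real.log (schrodingerFlow V f t x))) =
      (θ x / schrodingerFlow V f t x) *
        (h⁻¹ * (heatFlow h (schrodingerFlow V f t) x - schrodingerFlow V f t x)) -
      (θ x / schrodingerFlow V f t x) * (h⁻¹ * duhamel (potentialTerm V f t) h x) +
      θ x * (h⁻¹ * logRemainder V f t h x) := by
  rw [logRemainder, schrodingerFlow_add_sub hVc hfc hV hf ht hh]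
  ring

lemma continuous_schrodingerFlow_right (hVc : Continuous V) (hfc : Continuous f)
    (hV : ∀ x, |V x| ≤ M) (hf : ∀ x, |f x| ≤ B) (t : ℝ) : Continuous (schrodingerFlow V f t) :=
  (continuous_schrodingerFlow hVc hfc hV hf).comp (by fun_prop : Continuous fun x : E => (t, x))

lemma continuous_heatFlow {g : E → ℝ} (hg : Continuous g) (hgB : ∀ x, |g x| ≤ B) (t : ℝ) :
    Continuous (heatFlow t g) :=
  continuous_heatFlow_comp (τ := fun _ : E => t) (H := fun _ => g) (ξ := id) continuous_const
    (hg.comp continuous_snd) continuous_id fun _ => ⟨B, Eventually.of_forall fun _ => hgB⟩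

lemma continuous_logRemainder (hVc : Continuous V) (hfc : Continuous f)
    (hV : ∀ x, |V x| ≤ M) (hf : ∀ x, |f x| ≤ B) (hκ : 0 < κ)
    (hpos : ∀ t, 0 ≤ t → ∀ x, κ ≤ schrodingerFlow V f t x) {t h : ℝ} (ht : 0 ≤ t) (hh : 0 ≤ h) :
    Continuous (logRemainder V f t h) := by
  have h1 := continuous_schrodingerFlow_right hVc hfc hV hf t
  have h2 := continuous_schrodingerFlow_right hVc hfc hV hf (t + h)
  have h3 : ∀ x, schrodingerFlow V f t x ≠ 0 := fun x => (hκ.trans_le (hpos t ht x)).ne'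
  have h4 : ∀ x, schrodingerFlow V f (t + h) x ≠ 0 :=
    fun x => (hκ.trans_le (hpos (t + h) (add_nonneg ht hh) x)).ne'
  unfold logRemainder
  exact ((h2.log h4).sub (h1.log h3)).sub ((h2.sub h1).div h1 h3)

/-- The remainder is quadratic in `h^{-1/2} (φ(t + h) - φ(t))`, hence bounded after division by `h`,
and `o(h)` pointwise. -/
lemma abs_inv_mul_logRemainder_le (hκ : 0 < κ)
    (hpos : ∀ t, 0 ≤ t → ∀ x, κ ≤ schrodingerFlow V f t x) {t h : ℝ} (ht : 0 ≤ t) (hh : 0 < h)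
    (x : E) :
    |h⁻¹ * logRemainder V f t h x| ≤
      ((√h)⁻¹ * (schrodingerFlow V f (t + h) x - schrodingerFlow V f t x)) ^ 2 / κ ^ 2 := by
  have h1 := abs_log_sub_log_sub_le hκ (hpos t ht x) (hpos (t + h) (add_nonneg ht hh.le) x)
  rw [abs_mul, abs_of_pos (inv_pos.2 hh), mul_pow, inv_pow, Real.sq_sqrt hh.le, mul_div_assoc]
  exact mul_le_mul_of_nonneg_left h1 (inv_pos.2 hh).le

lemma hasGradientAt_div_schrodingerFlow (hVc : Continuous V) (hfc : Continuous f)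
    (hV : ∀ x, |V x| ≤ M) (hf : ∀ x, |f x| ≤ B) (hκ : 0 < κ)
    (hpos : ∀ t, 0 ≤ t → ∀ x, κ ≤ schrodingerFlow V f t x) (hθ : ContDiff ℝ 1 θ) {t : ℝ}
    (ht : 0 < t) (x : E) :
    HasGradientAt (fun y => θ y / schrodingerFlow V f t y)
      ((schrodingerFlow V f t x)⁻¹ • gradient θ x -
        (θ x / schrodingerFlow V f t x ^ 2) • schrodingerGrad V f t x) x :=
  hasGradientAt_div ((hθ.differentiable one_ne_zero) x).hasGradientAt
    (hasGradientAt_schrodingerFlow hVc.measurable hfc.measurable hV hf ht x)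
    (hκ.trans_le (hpos t ht.le x)).ne'

lemma contDiff_div_schrodingerFlow (hVc : Continuous V) (hfc : Continuous f)
    (hV : ∀ x, |V x| ≤ M) (hf : ∀ x, |f x| ≤ B) (hκ : 0 < κ)
    (hpos : ∀ t, 0 ≤ t → ∀ x, κ ≤ schrodingerFlow V f t x) (hθ : ContDiff ℝ 1 θ) {t : ℝ}
    (ht : 0 < t) : ContDiff ℝ 1 (fun y => θ y / schrodingerFlow V f t y) :=
  hθ.div (contDiff_schrodingerFlow hVc hfc hV hf ht) fun x => (hκ.trans_le (hpos t ht.le x)).ne'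

lemma exists_abs_div_schrodingerFlow_sub_le (hVc : Continuous V) (hfc : Continuous f)
    (hV : ∀ x, |V x| ≤ M) (hf : ∀ x, |f x| ≤ B) (hκ : 0 < κ)
    (hpos : ∀ t, 0 ≤ t → ∀ x, κ ≤ schrodingerFlow V f t x) {t₀ : ℝ} (ht₀ : 0 < t₀) (T K₀ K₁ : ℝ) :
    ∃ L, 0 ≤ L ∧ ∀ θ : E → ℝ, ContDiff ℝ 1 θ → (∀ x, |θ x| ≤ K₀) → (∀ x, ‖gradient θ x‖ ≤ K₁) →
      ∀ t, t₀ ≤ t → t ≤ T → ∀ x w, |θ (x + w) / schrodingerFlow V f t (x + w) -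
        θ x / schrodingerFlow V f t x| ≤ L * ‖w‖ := by
  obtain ⟨D, hD⟩ := exists_norm_schrodingerGrad_le hV hf ht₀ T
  refine ⟨|κ⁻¹ * K₁ + K₀ / κ ^ 2 * D|, abs_nonneg _, fun θ hθ hK₀ hK₁ t ht htT x w => ?_⟩
  have ht0 := ht₀.trans_le ht
  refine abs_sub_le_of_norm_gradient_le (f := fun y => θ y / schrodingerFlow V f t y)
    ((contDiff_div_schrodingerFlow hVc hfc hV hf hκ hpos hθ ht0).differentiable one_ne_zero)
    (fun y => ?_) x w
  rw [(hasGradientAt_div_schrodingerFlow hVc hfc hV hf hκ hpos hθ ht0 y).gradient]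
  refine le_trans ((norm_sub_le _ _).trans ?_) (le_abs_self _)
  have hp := hpos t ht0.le y
  have hp0 := hκ.trans_le hp
  have hK0 : 0 ≤ K₀ := (abs_nonneg _).trans (hK₀ 0)
  rw [norm_smul, norm_smul, norm_inv, norm_div, norm_pow, Real.norm_of_nonneg hp0.le]
  have h1 := hK₁ y
  have h2 := hD t ht htT y
  have h3 : ‖θ y‖ ≤ K₀ := hK₀ y
  gcongr

lemma continuous_duhamel_potentialTerm (hVc : Continuous V) (hfc : Continuous f)
    (hV : ∀ x, |V x| ≤ M) (hf : ∀ x, |f x| ≤ B) (t h : ℝ) :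
    Continuous (duhamel (potentialTerm V f t) h) :=
  (continuous_duhamel (continuous_potentialTerm hVc hfc hV hf t)
    (timeLocallyBounded_potentialTerm hV hf t)).comp (by fun_prop : Continuous fun x : E => (h, x))

lemma integral_mul_log_sub_log_eq (hVc : Continuous V) (hfc : Continuous f)
    (hV : ∀ x, |V x| ≤ M) (hf : ∀ x, |f x| ≤ B) (hκ : 0 < κ)
    (hpos : ∀ t, 0 ≤ t → ∀ x, κ ≤ schrodingerFlow V f t x) (hθ : ContDiff ℝ 1 θ)
    (hθR : ∀ x, R < ‖x‖ → θ x = 0) {t h : ℝ} (ht : 0 < t) (hh : 0 < h) :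
    ∫ x, θ x * (h⁻¹ * (Real.log (schrodingerFlow V f (t + h) x) -
        Real.log (schrodingerFlow V f t x))) =
      (∫ x, (θ x / schrodingerFlow V f t x) *
        (h⁻¹ * (heatFlow h (schrodingerFlow V f t) x - schrodingerFlow V f t x))) -
      (∫ x, (θ x / schrodingerFlow V f t x) * (h⁻¹ * duhamel (potentialTerm V f t) h x)) +
      ∫ x, θ x * (h⁻¹ * logRemainder V f t h x) := by
  have hgc := (contDiff_div_schrodingerFlow hVc hfc hV hf hκ hpos hθ ht).continuous
  have hgs : HasCompactSupport fun x => θ x / schrodingerFlow V f t x :=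
    hasCompactSupport_of_norm fun x hx => by rw [hθR x hx, zero_div]
  have hφc := continuous_schrodingerFlow_right hVc hfc hV hf t
  obtain ⟨C, hC⟩ := timeLocallyBounded_schrodingerFlow hV hf |t|
  have hQc := continuous_heatFlow hφc (hC t le_rfl) h
  have hdc := continuous_duhamel_potentialTerm hVc hfc hV hf t h
  have hrc := continuous_logRemainder hVc hfc hV hf hκ hpos ht.le hh.le
  have hθc := hθ.continuous
  have i1 : Integrable fun x => (θ x / schrodingerFlow V f t x) *
      (h⁻¹ * (heatFlow h (schrodingerFlow V f t) x - schrodingerFlow V f t x)) :=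
    (hgc.mul (continuous_const.mul (hQc.sub hφc))).integrable_of_hasCompactSupport hgs.mul_right
  have i2 : Integrable fun x => (θ x / schrodingerFlow V f t x) *
      (h⁻¹ * duhamel (potentialTerm V f t) h x) :=
    (hgc.mul (continuous_const.mul hdc)).integrable_of_hasCompactSupport hgs.mul_right
  have i3 : Integrable fun x => θ x * (h⁻¹ * logRemainder V f t h x) :=
    (hθc.mul (continuous_const.mul hrc)).integrable_of_hasCompactSupport
      (hasCompactSupport_of_norm hθR).mul_right
  simp only [mul_log_sub_log_eq hVc hfc hV hf ht.le hh.le]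
  rw [← integral_sub i1 i2]
  exact integral_add (i1.sub i2) i3

/-- The time increments of `∫ θ log φ`, divided by `h`, are bounded uniformly in `t` and `h`. -/
lemma exists_abs_integral_mul_log_sub_log_le (hVc : Continuous V) (hfc : Continuous f)
    (hV : ∀ x, |V x| ≤ M) (hf : ∀ x, |f x| ≤ B) (hκ : 0 < κ)
    (hpos : ∀ t, 0 ≤ t → ∀ x, κ ≤ schrodingerFlow V f t x) {t₀ : ℝ} (ht₀ : 0 < t₀) (T : ℝ)
    (hR : 0 ≤ R) :
    ∃ C, ∀ θ : E → ℝ, ContDiff ℝ 1 θ → (∀ x, |θ x| ≤ K₀) → (∀ x, ‖gradient θ x‖ ≤ K₁) →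
      (∀ x, R < ‖x‖ → θ x = 0) → ∀ t, t₀ ≤ t → t ≤ T → ∀ h, 0 < h → h ≤ 1 →
      |∫ x, θ x * (h⁻¹ * (Real.log (schrodingerFlow V f (t + h) x) -
        Real.log (schrodingerFlow V f t x)))| ≤ C := by
  obtain ⟨L, hL0, hL⟩ := exists_abs_div_schrodingerFlow_sub_le hVc hfc hV hf hκ hpos ht₀ T K₀ K₁
  obtain ⟨L', hL'0, hL'⟩ := exists_abs_schrodingerFlow_sub_le hVc hfc hV hf ht₀ T
  obtain ⟨D, hD0, hD⟩ := exists_abs_duhamel_potentialTerm_le hV hf T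
  obtain ⟨S, hS0, hS⟩ := exists_abs_schrodingerFlow_add_sub_le hVc hfc hV hf ht₀ T
  refine ⟨1 / 2 * (L * L' * ∫ p, spreadBound R p ∂((volume : Measure E).prod (stdGaussian E))) +
    (volume : Measure E).real (Metric.closedBall 0 R) * (K₀ / κ * D) +
    (volume : Measure E).real (Metric.closedBall 0 R) * (K₀ * (S ^ 2 / κ ^ 2)),
    fun θ hθ hK₀ hK₁ hθR t ht htT h hh hh1 => ?_⟩
  have ht0 : 0 < t := ht₀.trans_le ht
  have hK0 : 0 ≤ K₀ := (abs_nonneg _).trans (hK₀ 0)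
  have hg := contDiff_div_schrodingerFlow hVc hfc hV hf hκ hpos hθ ht0
  have hgR : ∀ x, R < ‖x‖ → θ x / schrodingerFlow V f t x = 0 := fun x hx => by
    rw [hθR x hx, zero_div]
  have hgc := hg.continuous
  have hφc := continuous_schrodingerFlow_right hVc hfc hV hf t
  obtain ⟨C, hC⟩ := timeLocallyBounded_schrodingerFlow hV hf |t|
  rw [integral_mul_log_sub_log_eq hVc hfc hV hf hκ hpos hθ hθR ht0 hh]
  refine (abs_add_le _ _).trans (add_le_add ((abs_sub _ _).trans (add_le_add ?_ ?_)) ?_)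
  · exact abs_integral_mul_heatFlow_sub_le hgc hφc (hC t le_rfl) hR hL0 hL'0 hgR
      (hL θ hθ hK₀ hK₁ t ht htT) (hL' t ht htT) hh hh1
  · refine abs_integral_le_of_closedBall (fun x => ?_) fun x hx => by rw [hgR x hx, zero_mul]
    rw [abs_mul, abs_div, abs_mul, abs_of_pos (inv_pos.2 hh)]
    have hp := hpos t ht0.le x
    rw [abs_of_pos (hκ.trans_le hp)]
    have h1 := hK₀ x
    have h2 : h⁻¹ * |duhamel (potentialTerm V f t) h x| ≤ D := by
      rw [inv_mul_le_iff₀ hh, mul_comm h]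
      exact hD t ht0.le htT h hh hh1 x
    gcongr
  · refine abs_integral_le_of_closedBall (fun x => ?_) fun x hx => by rw [hθR x hx, zero_mul]
    rw [abs_mul]
    refine mul_le_mul (hK₀ x) ((abs_inv_mul_logRemainder_le hκ hpos ht0.le hh x).trans ?_)
      (abs_nonneg _) hK0
    have hs : 0 < √h := Real.sqrt_pos.2 hh
    have h1 : |(√h)⁻¹ * (schrodingerFlow V f (t + h) x - schrodingerFlow V f t x)| ≤ S := by
      rw [abs_mul, abs_of_pos (inv_pos.2 hs), inv_mul_le_iff₀ hs, mul_comm (√h)]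
      exact hS t ht htT h hh hh1 x
    rw [← sq_abs]
    gcongr

/-- The equation `∂ₜ log φ = ½ Δ log φ + ½ |∇ log φ|² - V`, tested in space and
differentiated from the right in time. -/
lemma tendsto_integral_mul_log_sub_log (hVc : Continuous V) (hfc : Continuous f)
    (hV : ∀ x, |V x| ≤ M) (hf : ∀ x, |f x| ≤ B) (hκ : 0 < κ)
    (hpos : ∀ t, 0 ≤ t → ∀ x, κ ≤ schrodingerFlow V f t x) (hR : 0 ≤ R) (hθ : ContDiff ℝ 1 θ)
    (hK₀ : ∀ x, |θ x| ≤ K₀) (hK₁ : ∀ x, ‖gradient θ x‖ ≤ K₁) (hθR : ∀ x, R < ‖x‖ → θ x = 0)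
    {t : ℝ} (ht : 0 < t) :
    Tendsto (fun h : ℝ => ∫ x, θ x * (h⁻¹ * (Real.log (schrodingerFlow V f (t + h) x) -
        Real.log (schrodingerFlow V f t x)))) (𝓝[>] 0)
      (𝓝 (∫ x, (1 / 2 * (inner ℝ (gradient θ x) (velocity V f t x) : ℝ) +
        1 / 2 * (θ x * ‖velocity V f t x‖ ^ 2) - θ x * V x))) := by
  obtain ⟨L, hL0, hL⟩ := exists_abs_div_schrodingerFlow_sub_le hVc hfc hV hf hκ hpos ht t K₀ K₁
  obtain ⟨L', hL'0, hL'⟩ := exists_abs_schrodingerFlow_sub_le hVc hfc hV hf ht t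
  obtain ⟨D, hD0, hD⟩ := exists_abs_duhamel_potentialTerm_le hV hf t
  obtain ⟨S, hS0, hS⟩ := exists_abs_schrodingerFlow_add_sub_le hVc hfc hV hf ht t
  have hK0 : 0 ≤ K₀ := (abs_nonneg _).trans (hK₀ 0)
  have hsmall : ∀ᶠ h : ℝ in 𝓝[>] 0, h ∈ Ioc (0 : ℝ) 1 := Ioc_mem_nhdsGT one_pos
  have hg := contDiff_div_schrodingerFlow hVc hfc hV hf hκ hpos hθ ht
  have hgR : ∀ x, R < ‖x‖ → θ x / schrodingerFlow V f t x = 0 := fun x hx => by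
    rw [hθR x hx, zero_div]
  have hgs := hasCompactSupport_of_norm hgR
  have hgc := hg.continuous
  have hφ := contDiff_schrodingerFlow hVc hfc hV hf ht
  have hφc := hφ.continuous
  obtain ⟨C, hC⟩ := timeLocallyBounded_schrodingerFlow hV hf |t|
  have hdc := continuous_duhamel_potentialTerm hVc hfc hV hf t
  have hrc : ∀ h, 0 < h → Continuous (logRemainder V f t h) := fun h hh =>
    continuous_logRemainder hVc hfc hV hf hκ hpos ht.le hh.le
  have hθc := hθ.continuous
  -- The free, potential and remainder parts of the increment have separate limits.
  have l1 := tendsto_integral_mul_heatFlow_sub hg hφ (hC t le_rfl) hR hL0 hL'0 hgR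
    (hL θ hθ hK₀ hK₁ t le_rfl le_rfl) (hL' t le_rfl le_rfl)
  have l2 : Tendsto (fun h : ℝ => ∫ x, (θ x / schrodingerFlow V f t x) *
      (h⁻¹ * duhamel (potentialTerm V f t) h x)) (𝓝[>] 0)
      (𝓝 (∫ x, (θ x / schrodingerFlow V f t x) * potentialTerm V f t 0 x)) := by
    refine tendsto_integral_of_closedBall (R := R) (c := K₀ / κ * D)
      (Eventually.of_forall fun h => hgc.mul (continuous_const.mul (hdc h))) ?_
      (fun h x hx => by rw [hgR x hx, zero_mul]) fun x => ?_
    · filter_upwards [hsmall] with h hh x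
      rw [abs_mul, abs_div, abs_mul, abs_of_pos (inv_pos.2 hh.1)]
      have hp := hpos t ht.le x
      rw [abs_of_pos (hκ.trans_le hp)]
      have h1 := hK₀ x
      have h2 : h⁻¹ * |duhamel (potentialTerm V f t) h x| ≤ D := by
        rw [inv_mul_le_iff₀ hh.1, mul_comm h]
        exact hD t ht.le le_rfl h hh.1 hh.2 x
      have := hh.1
      gcongr
    · exact (tendsto_inv_mul_duhamel (continuous_potentialTerm hVc hfc hV hf t)
        (timeLocallyBounded_potentialTerm hV hf t) x).const_mul _
  have l3 : Tendsto (fun h : ℝ => ∫ x, θ x * (h⁻¹ * logRemainder V f t h x)) (𝓝[>] 0)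
      (𝓝 (∫ _ : E, (0 : ℝ))) := by
    refine tendsto_integral_of_closedBall (R := R) (c := K₀ * (S ^ 2 / κ ^ 2)) ?_ ?_
      (fun h x hx => by rw [hθR x hx, zero_mul]) fun x => ?_
    · filter_upwards [hsmall] with h hh
      exact hθc.mul (continuous_const.mul (hrc h hh.1))
    · filter_upwards [hsmall] with h hh x
      rw [abs_mul]
      refine mul_le_mul (hK₀ x) ((abs_inv_mul_logRemainder_le hκ hpos ht.le hh.1 x).trans ?_)
        (abs_nonneg _) hK0
      have hs : 0 < √h := Real.sqrt_pos.2 hh.1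
      have h1 : |(√h)⁻¹ * (schrodingerFlow V f (t + h) x - schrodingerFlow V f t x)| ≤ S := by
        rw [abs_mul, abs_of_pos (inv_pos.2 hs), inv_mul_le_iff₀ hs, mul_comm (√h)]
        exact hS t le_rfl le_rfl h hh.1 hh.2 x
      rw [← sq_abs]
      gcongr
    · have h1 := ((tendsto_inv_sqrt_mul_schrodingerFlow_add_sub hVc hfc hV hf ht x).pow 2).div_const
        (κ ^ 2)
      simp only [ne_eq, OfNat.ofNat_ne_zero, not_false_eq_true, zero_pow, zero_div] at h1
      have h2 : Tendsto (fun h : ℝ => h⁻¹ * logRemainder V f t h x) (𝓝[>] 0) (𝓝 0) := by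
        refine squeeze_zero_norm' ?_ h1
        filter_upwards [hsmall] with h hh
        exact abs_inv_mul_logRemainder_le hκ hpos ht.le hh.1 x
      simpa using h2.const_mul (θ x)
  have hfin := (l1.sub l2).add l3
  rw [integral_zero, add_zero] at hfin
  -- `∇(θ / φ) · ∇φ = ∇θ · ∇φ / φ - θ |∇φ|² / φ²`.
  have hval : -(1 / 2) * (∫ x, (inner ℝ (gradient (fun y => θ y / schrodingerFlow V f t y) x)
      (gradient (schrodingerFlow V f t) x) : ℝ)) -
      ∫ x, (θ x / schrodingerFlow V f t x) * potentialTerm V f t 0 x =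
      ∫ x, (1 / 2 * (inner ℝ (gradient θ x) (velocity V f t x) : ℝ) +
        1 / 2 * (θ x * ‖velocity V f t x‖ ^ 2) - θ x * V x) := by
    have hcg := continuous_gradient hg
    have hcφ := continuous_gradient hφ
    have hgs' : HasCompactSupport (gradient fun y => θ y / schrodingerFlow V f t y) :=
      HasCompactSupport.comp_left (g := (InnerProductSpace.toDual ℝ E).symm)
        (hgs.fderiv ℝ) (map_zero _)
    have hpc : Continuous (potentialTerm V f t 0) :=
      (continuous_potentialTerm hVc hfc hV hf t).comp
        (by fun_prop : Continuous fun x : E => ((0 : ℝ), x))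
    have j1 : Integrable fun x => -(1 / 2) *
        (inner ℝ (gradient (fun y => θ y / schrodingerFlow V f t y) x)
          (gradient (schrodingerFlow V f t) x) : ℝ) := by
      refine Integrable.const_mul ?_ _
      refine Continuous.integrable_of_hasCompactSupport (hcg.inner hcφ) ?_
      refine hgs'.mono fun x hx => ?_
      contrapose! hx
      simp only [Function.mem_support, not_not] at hx ⊢
      rw [hx, inner_zero_left]
    have j2 : Integrable fun x => (θ x / schrodingerFlow V f t x) * potentialTerm V f t 0 x :=
      (hgc.mul hpc).integrable_of_hasCompactSupport hgs.mul_right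
    rw [← integral_const_mul, ← integral_sub j1 j2]
    congr 1
    ext x
    have hp := (hκ.trans_le (hpos t ht.le x)).ne'
    rw [(hasGradientAt_div_schrodingerFlow hVc hfc hV hf hκ hpos hθ ht x).gradient,
      gradient_schrodingerFlow hVc hfc hV hf ht]
    simp only [velocity, potentialTerm, add_zero, inner_sub_left, inner_smul_left, inner_neg_right,
      inner_smul_right, norm_neg, norm_smul, mul_pow, real_inner_self_eq_norm_sq, norm_inv,
      Real.norm_eq_abs, inv_pow, sq_abs, conj_trivial]
    field_simp
    ring
  rw [← hval]
  refine hfin.congr' ?_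
  filter_upwards [hsmall] with h hh
  exact (integral_mul_log_sub_log_eq hVc hfc hV hf hκ hpos hθ hθR ht hh.1).symm

end

end

/-! ### The equation for the logarithm on space-time -/

section

lemma integrable_of_continuousOn_of_eq_zero {X : Type*} [TopologicalSpace X] [MeasurableSpace X]
    [OpensMeasurableSpace X] [T2Space X] {μ : Measure X} [IsFiniteMeasureOnCompacts μ]
    {F : X → ℝ} {U K : Set X} (hF : ContinuousOn F U) (hK : IsCompact K) (hKU : K ⊆ U)
    (h0 : ∀ p, p ∉ K → F p = 0) : Integrable F μ := by
  have h1 : IntegrableOn F K μ :=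
    (hF.mono hKU).integrableOn_compact' hK hK.isClosed.measurableSet
  refine (integrableOn_iff_integrable_of_support_subset fun p hp => ?_).1 h1
  by_contra h
  exact hp (h0 p h)

lemma exists_pos_le_fst {X : Type*} [TopologicalSpace X] {K : Set (ℝ × X)} (hK : IsCompact K)
    (hKU : K ⊆ Ioi 0 ×ˢ univ) : ∃ t₀ > 0, ∀ p ∈ K, t₀ ≤ p.1 := by
  rcases K.eq_empty_or_nonempty with rfl | hne
  · exact ⟨1, one_pos, by simp⟩
  · obtain ⟨p, hp, hmin⟩ := hK.exists_isMinOn hne continuous_fst.continuousOn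
    exact ⟨p.1, (hKU hp).1, fun q hq => hmin hq⟩

variable {E : Type*} [NormedAddCommGroup E] [InnerProductSpace ℝ E] [FiniteDimensional ℝ E]
  [MeasurableSpace E] [BorelSpace E]

/-- Instance search does not unfold the volume of a product to the product of the volumes. -/
instance isAddHaarMeasure_volume_real_prod : (volume : Measure (ℝ × E)).IsAddHaarMeasure :=
  inferInstanceAs ((volume : Measure ℝ).prod (volume : Measure E)).IsAddHaarMeasure

lemma hasFDerivAt_slice {F : ℝ × E → ℝ} {t : ℝ} {x : E} (hF : DifferentiableAt ℝ F (t, x)) :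
    HasFDerivAt (fun y => F (t, y)) ((fderiv ℝ F (t, x)).comp (ContinuousLinearMap.inr ℝ ℝ E)) x :=
  hF.hasFDerivAt.comp x (hasFDerivAt_prodMk_right t x)

lemma fderiv_slice {F : ℝ × E → ℝ} {t : ℝ} {x : E} (hF : DifferentiableAt ℝ F (t, x)) (v : E) :
    fderiv ℝ (fun y => F (t, y)) x v = fderiv ℝ F (t, x) (0, v) := by
  rw [(hasFDerivAt_slice hF).fderiv]
  simp

lemma norm_gradient_slice_le {F : ℝ × E → ℝ} {t : ℝ} {x : E}
    (hF : DifferentiableAt ℝ F (t, x)) :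
    ‖gradient (fun y => F (t, y)) x‖ ≤ ‖fderiv ℝ F (t, x)‖ := by
  rw [gradient, LinearIsometryEquiv.norm_map, (hasFDerivAt_slice hF).fderiv]
  refine (ContinuousLinearMap.opNorm_comp_le _ _).trans ?_
  exact mul_le_of_le_one_right (norm_nonneg _) (ContinuousLinearMap.norm_inr_le_one ℝ ℝ E)

lemma exists_slice_bounds {θ : ℝ × E → ℝ} (hθ : ContDiff ℝ 1 θ)
    (hθs : HasCompactSupport θ) :
    ∃ R K₀ K₁ : ℝ, 0 ≤ R ∧ (∀ p, R < ‖p‖ → θ p = 0) ∧ (∀ p, |θ p| ≤ K₀) ∧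
      ∀ t x, ‖gradient (fun y => θ (t, y)) x‖ ≤ K₁ := by
  obtain ⟨R, hR⟩ := hθs.isCompact.isBounded.subset_closedBall 0
  obtain ⟨K₀, hK₀⟩ := hθs.exists_bound_of_continuous hθ.continuous
  have h3 : Continuous fun p => ‖fderiv ℝ θ p‖ := (hθ.continuous_fderiv one_ne_zero).norm
  have h4 : HasCompactSupport fun p => ‖fderiv ℝ θ p‖ :=
    (hθs.fderiv ℝ).mono fun p hp hp0 => hp (by
      simp only [hp0]
      exact ContinuousLinearMap.opNorm_zero)
  obtain ⟨K₁, hK₁⟩ := h4.exists_bound_of_continuous h3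
  have h1 : ∀ p, max R 0 < ‖p‖ → θ p = 0 := fun p hp => by
    refine image_eq_zero_of_notMem_tsupport fun h => ?_
    have := mem_closedBall_zero_iff.1 (hR h)
    exact absurd hp (not_lt.2 (this.trans (le_max_left _ _)))
  have h2 : ∀ t x, ‖gradient (fun y => θ (t, y)) x‖ ≤ K₁ := fun t x =>
    (norm_gradient_slice_le ((hθ.differentiable one_ne_zero) _)).trans
      ((le_abs_self _).trans (hK₁ (t, x)))
  exact ⟨max R 0, K₀, K₁, le_max_right _ _, h1, hK₀, h2⟩

section

variable {V f : E → ℝ} {M B κ : ℝ}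

/-- `log φ` on space-time, extended to negative times by its value at time `0`, so that it is
continuous on all of `ℝ × E`. -/
def logFlow (V f : E → ℝ) (p : ℝ × E) : ℝ :=
  Real.log (schrodingerFlow V f (max p.1 0) p.2)

lemma continuous_logFlow (hVc : Continuous V) (hfc : Continuous f)
    (hV : ∀ x, |V x| ≤ M) (hf : ∀ x, |f x| ≤ B) (hκ : 0 < κ)
    (hpos : ∀ t, 0 ≤ t → ∀ x, κ ≤ schrodingerFlow V f t x) : Continuous (logFlow V f) := by
  have h1 : Continuous fun p : ℝ × E => schrodingerFlow V f (max p.1 0) p.2 :=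
    (continuous_schrodingerFlow hVc hfc hV hf).comp
      (by fun_prop : Continuous fun p : ℝ × E => (max p.1 0, p.2))
  exact h1.log fun p => (hκ.trans_le (hpos _ (le_max_right _ _) _)).ne'

lemma continuousOn_velocity (hVc : Continuous V) (hfc : Continuous f)
    (hV : ∀ x, |V x| ≤ M) (hf : ∀ x, |f x| ≤ B) (hκ : 0 < κ)
    (hpos : ∀ t, 0 ≤ t → ∀ x, κ ≤ schrodingerFlow V f t x) :
    ContinuousOn (fun p : ℝ × E => velocity V f p.1 p.2) (Ioi 0 ×ˢ univ) := by
  refine ((ContinuousOn.inv₀ ?_ ?_).smul (continuousOn_schrodingerGrad hVc hfc hV hf)).neg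
  · exact (continuous_schrodingerFlow hVc hfc hV hf).continuousOn
  · rintro p ⟨hp, -⟩
    exact (hκ.trans_le (hpos p.1 (le_of_lt hp) p.2)).ne'

/-- The equation for `log φ` in the sense of distributions on `(0, ∞) × E`; no derivative of the
velocity enters. -/
lemma integral_fderiv_mul_logFlow (hVc : Continuous V) (hfc : Continuous f)
    (hV : ∀ x, |V x| ≤ M) (hf : ∀ x, |f x| ≤ B) (hκ : 0 < κ)
    (hpos : ∀ t, 0 ≤ t → ∀ x, κ ≤ schrodingerFlow V f t x) {θ : ℝ × E → ℝ}
    (hθ : ContDiff ℝ 1 θ) (hθs : HasCompactSupport θ) (hθU : tsupport θ ⊆ Ioi 0 ×ˢ univ) :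
    -∫ p, fderiv ℝ θ p (1, 0) * logFlow V f p =
      ∫ p : ℝ × E, (1 / 2 * fderiv ℝ θ p (0, velocity V f p.1 p.2) +
        1 / 2 * (θ p * ‖velocity V f p.1 p.2‖ ^ 2) - θ p * V p.2) := by
  obtain ⟨t₀, ht₀, htK⟩ := exists_pos_le_fst hθs.isCompact hθU
  obtain ⟨R, K₀, K₁, hR, hθR, hK₀, hK₁⟩ := exists_slice_bounds hθ hθs
  have hθc := hθ.continuous
  have hℓ := continuous_logFlow hVc hfc hV hf hκ hpos
  have hu := continuousOn_velocity hVc hfc hV hf hκ hpos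
  have hsmall : ∀ᶠ h : ℝ in 𝓝[>] 0, h ∈ Ioc (0 : ℝ) 1 := Ioc_mem_nhdsGT one_pos
  have hslice : ∀ t, ContDiff ℝ 1 fun x : E => θ (t, x) := fun t =>
    hθ.comp (contDiff_const.prodMk contDiff_id)
  have hsliceR : ∀ t, ∀ x : E, R < ‖x‖ → θ (t, x) = 0 := fun t x hx =>
    hθR _ (hx.trans_le (norm_snd_le (t, x)))
  have hout : ∀ t, t ∉ Icc t₀ R → ∀ x, θ (t, x) = 0 := by
    intro t ht x
    by_contra h
    have h1 : (t, x) ∈ tsupport θ := subset_tsupport _ h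
    have h2 : ‖(t, x)‖ ≤ R := by
      by_contra h3
      exact h (hθR _ (not_le.1 h3))
    exact ht ⟨htK _ h1, (le_abs_self t).trans ((norm_fst_le (t, x)).trans h2)⟩
  have hRHS : Integrable (fun p : ℝ × E => 1 / 2 * fderiv ℝ θ p (0, velocity V f p.1 p.2) +
      1 / 2 * (θ p * ‖velocity V f p.1 p.2‖ ^ 2) - θ p * V p.2) := by
    refine integrable_of_continuousOn_of_eq_zero (U := Ioi 0 ×ˢ univ) ?_ hθs.isCompact hθU ?_
    · have h1 : ContinuousOn (fun p : ℝ × E => fderiv ℝ θ p (0, velocity V f p.1 p.2))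
          (Ioi 0 ×ˢ univ) :=
        (hθ.continuous_fderiv one_ne_zero).continuousOn.clm_apply (continuousOn_const.prodMk hu)
      exact ((continuousOn_const.mul h1).add (continuousOn_const.mul
        (hθc.continuousOn.mul (hu.norm.pow 2)))).sub
        (hθc.mul (hVc.comp continuous_snd)).continuousOn
    · intro p hp
      have h1 : θ p = 0 := image_eq_zero_of_notMem_tsupport hp
      have h2 : fderiv ℝ θ p = 0 :=
        image_eq_zero_of_notMem_tsupport fun h => hp (tsupport_fderiv_subset ℝ h)
      simp [h1, h2]
  -- The difference quotients in time have two limits: one by moving the quotient to `θ`, the other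
  -- by integrating the spatial statement over the time slices.
  have hlim1 := tendsto_integral_mul_diffQuotient (μ := (volume : Measure (ℝ × E)))
    hθ hθs hℓ ((1 : ℝ), (0 : E))
  have hint : ∀ h : ℝ, Integrable (fun p : ℝ × E =>
      θ p * (h⁻¹ * (logFlow V f (p + h • ((1 : ℝ), (0 : E))) - logFlow V f p))) := fun h =>
    Continuous.integrable_of_hasCompactSupport (by fun_prop) hθs.mul_right
  have hinner : ∀ h : ℝ, 0 < h → ∀ t,
      ∫ x, θ (t, x) * (h⁻¹ * (logFlow V f ((t, x) + h • ((1 : ℝ), (0 : E))) - logFlow V f (t, x))) =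
      if t ∈ Icc t₀ R then ∫ x, θ (t, x) * (h⁻¹ *
        (Real.log (schrodingerFlow V f (t + h) x) - Real.log (schrodingerFlow V f t x)))
      else 0 := by
    intro h hh t
    split_ifs with ht
    · have ht0 : 0 ≤ t := ht₀.le.trans ht.1
      simp only [logFlow, Prod.smul_mk, smul_eq_mul, mul_one, smul_zero, Prod.mk_add_mk, add_zero,
        max_eq_left ht0, max_eq_left (add_nonneg ht0 hh.le)]
    · simp [hout t ht]
  obtain ⟨C, hC⟩ := exists_abs_integral_mul_log_sub_log_le (K₀ := K₀) (K₁ := K₁) hVc hfc hV hf hκ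
    hpos ht₀ R hR
  have hlim2 : Tendsto (fun h : ℝ => ∫ p : ℝ × E,
      θ p * (h⁻¹ * (logFlow V f (p + h • ((1 : ℝ), (0 : E))) - logFlow V f p))) (𝓝[>] 0)
      (𝓝 (∫ t, ∫ x, (1 / 2 * fderiv ℝ θ (t, x) (0, velocity V f t x) +
        1 / 2 * (θ (t, x) * ‖velocity V f t x‖ ^ 2) - θ (t, x) * V x))) := by
    have hfub : ∀ h : ℝ, ∫ p : ℝ × E,
        θ p * (h⁻¹ * (logFlow V f (p + h • ((1 : ℝ), (0 : E))) - logFlow V f p)) =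
        ∫ t, ∫ x, θ (t, x) *
          (h⁻¹ * (logFlow V f ((t, x) + h • ((1 : ℝ), (0 : E))) - logFlow V f (t, x))) :=
      fun h => integral_prod _ (hint h)
    simp only [hfub]
    refine tendsto_integral_filter_of_dominated_convergence
      (indicator (Icc t₀ R) fun _ => C) ?_ ?_ ?_ (Eventually.of_forall fun t => ?_)
    · exact Eventually.of_forall fun h => (hint h).integral_prod_left.aestronglyMeasurable
    · filter_upwards [hsmall] with h hh
      refine Eventually.of_forall fun t => ?_
      rw [hinner h hh.1 t]
      split_ifs with ht
      · rw [indicator_of_mem ht]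
        exact hC (fun x => θ (t, x)) (hslice t) (fun x => hK₀ _) (hK₁ t) (hsliceR t) t ht.1 ht.2
          h hh.1 hh.2
      · rw [indicator_of_notMem ht, norm_zero]
    · rw [integrable_indicator_iff measurableSet_Icc]
      exact integrableOn_const (by simp)
    · by_cases ht : t ∈ Icc t₀ R
      · have h1 := tendsto_integral_mul_log_sub_log hVc hfc hV hf hκ hpos hR (hslice t)
          (fun x => hK₀ _) (hK₁ t) (hsliceR t) (ht₀.trans_le ht.1)
        simp only [inner_gradient_left, fderiv_slice ((hθ.differentiable one_ne_zero) _)] at h1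
        refine h1.congr' ?_
        filter_upwards [self_mem_nhdsWithin] with h hh
        rw [hinner h hh t, if_pos ht]
      · have h2 : ∀ x : E, fderiv ℝ θ (t, x) (0, velocity V f t x) = 0 := by
          intro x
          rw [← fderiv_slice ((hθ.differentiable one_ne_zero) _)]
          simp [hout t ht]
        have h3 : ∫ x, (1 / 2 * fderiv ℝ θ (t, x) (0, velocity V f t x) +
            1 / 2 * (θ (t, x) * ‖velocity V f t x‖ ^ 2) - θ (t, x) * V x) = 0 := by
          simp [h2, hout t ht]
        rw [h3]
        refine tendsto_const_nhds.congr' ?_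
        filter_upwards [self_mem_nhdsWithin] with h hh
        rw [hinner h hh t, if_neg ht]
  rw [tendsto_nhds_unique hlim1 hlim2]
  exact (integral_prod _ hRHS).symm

lemma hasLineDerivAt_logFlow (hVc : Continuous V) (hfc : Continuous f)
    (hV : ∀ x, |V x| ≤ M) (hf : ∀ x, |f x| ≤ B) (hκ : 0 < κ)
    (hpos : ∀ t, 0 ≤ t → ∀ x, κ ≤ schrodingerFlow V f t x) {p : ℝ × E} (hp : 0 < p.1) (v : E) :
    HasLineDerivAt ℝ (logFlow V f) (-(inner ℝ (velocity V f p.1 p.2) v : ℝ)) p (0, v) := by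
  have h1 := (hasGradientAt_schrodingerFlow hVc.measurable hfc.measurable hV hf hp
    p.2).hasFDerivAt.log (hκ.trans_le (hpos p.1 hp.le p.2)).ne'
  have h2 := h1.hasLineDerivAt v
  simp only [HasLineDerivAt] at h2 ⊢
  convert! h2 using 1
  · ext s
    simp [logFlow, max_eq_left hp.le]
  · simp [velocity, inner_neg_left, inner_smul_left]

/-- The velocity is `-∇ log φ` in the sense of distributions on `(0, ∞) × E`. -/
lemma integral_fderiv_mul_logFlow_eq_integral_inner (hVc : Continuous V) (hfc : Continuous f)
    (hV : ∀ x, |V x| ≤ M) (hf : ∀ x, |f x| ≤ B) (hκ : 0 < κ)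
    (hpos : ∀ t, 0 ≤ t → ∀ x, κ ≤ schrodingerFlow V f t x) {ζ : ℝ × E → ℝ}
    (hζ : ContDiff ℝ 1 ζ) (hζs : HasCompactSupport ζ) (hζU : tsupport ζ ⊆ Ioi 0 ×ˢ univ) (v : E) :
    ∫ p, fderiv ℝ ζ p (0, v) * logFlow V f p =
      ∫ p : ℝ × E, ζ p * (inner ℝ (velocity V f p.1 p.2) v : ℝ) := by
  have hℓ := continuous_logFlow hVc hfc hV hf hκ hpos
  have hu := continuousOn_velocity hVc hfc hV hf hκ hpos
  have hζc := hζ.continuous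
  have hζ' : Continuous fun p => fderiv ℝ ζ p (0, v) :=
    (hζ.continuous_fderiv one_ne_zero).clm_apply continuous_const
  have h1 := integral_bilinear_hasLineDerivAt_right_eq_neg_left_of_integrable
    (μ := (volume : Measure (ℝ × E))) (f := ζ) (f' := fun p => fderiv ℝ ζ p (0, v))
    (g := logFlow V f) (g' := fun p => -(inner ℝ (velocity V f p.1 p.2) v : ℝ)) (v := (0, v))
    (B := ContinuousLinearMap.mul ℝ ℝ) ?_ ?_ ?_ ?_ ?_
  · simp only [ContinuousLinearMap.mul_apply', mul_neg, integral_neg, neg_inj] at h1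
    exact h1.symm
  · exact (hζ'.mul hℓ).integrable_of_hasCompactSupport
      (((hζs.fderiv_apply ℝ (0, v))).mul_right)
  · refine integrable_of_continuousOn_of_eq_zero (U := Ioi 0 ×ˢ univ)
      (hζc.continuousOn.mul (hu.inner continuousOn_const).neg) hζs.isCompact hζU fun p hp => ?_
    simp [image_eq_zero_of_notMem_tsupport hp]
  · exact (hζc.mul hℓ).integrable_of_hasCompactSupport hζs.mul_right
  · exact fun p _ => ((hζ.differentiable one_ne_zero) p).hasFDerivAt.hasLineDerivAt _
  · exact fun p hp => hasLineDerivAt_logFlow hVc hfc hV hf hκ hpos (hζU hp).1 v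

end

lemma integral_fderiv_mul_comp_snd {V : E → ℝ} (hV : ContDiff ℝ 1 V) {ζ : ℝ × E → ℝ}
    (hζ : ContDiff ℝ 1 ζ) (hζs : HasCompactSupport ζ) (v : E) :
    ∫ p, fderiv ℝ ζ p (0, v) * V p.2 = -∫ p : ℝ × E, fderiv ℝ V p.2 v * ζ p := by
  have hζc := hζ.continuous
  have hVc := hV.continuous
  have hζ' : Continuous fun p => fderiv ℝ ζ p (0, v) :=
    (hζ.continuous_fderiv one_ne_zero).clm_apply continuous_const
  have hV' : Continuous fun p : ℝ × E => fderiv ℝ V p.2 v :=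
    ((hV.continuous_fderiv one_ne_zero).comp continuous_snd).clm_apply continuous_const
  have hd : ∀ p : ℝ × E, HasFDerivAt (fun q : ℝ × E => V q.2)
      ((fderiv ℝ V p.2).comp (ContinuousLinearMap.snd ℝ ℝ E)) p := fun p =>
    ((hV.differentiable one_ne_zero) p.2).hasFDerivAt.comp p hasFDerivAt_snd
  have h1 := integral_mul_fderiv_eq_neg_fderiv_mul_of_integrable
    (μ := (volume : Measure (ℝ × E))) (f := fun q : ℝ × E => V q.2) (g := ζ) (v := (0, v))
    ?_ ?_ ?_ (fun p _ => (hd p).differentiableAt)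
    (fun p _ => (hζ.differentiable one_ne_zero) p)
  · simp only [(hd _).fderiv, ContinuousLinearMap.comp_apply, ContinuousLinearMap.coe_snd'] at h1
    rw [← h1]
    simp only [mul_comm]
  · simp only [(hd _).fderiv, ContinuousLinearMap.comp_apply, ContinuousLinearMap.coe_snd']
    exact (hV'.mul hζc).integrable_of_hasCompactSupport hζs.mul_left
  · exact ((hVc.comp continuous_snd).mul hζ').integrable_of_hasCompactSupport
      (hζs.fderiv_apply ℝ (0, v)).mul_left
  · exact ((hVc.comp continuous_snd).mul hζc).integrable_of_hasCompactSupport hζs.mul_left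

end

/-! ### The weak Burgers equation -/

section

section

variable {X : Type*} [NormedAddCommGroup X] [NormedSpace ℝ X] {F : X → ℝ}

lemma contDiff_fderiv_apply (hF : ContDiff ℝ ∞ F) (v : X) :
    ContDiff ℝ ∞ fun p => fderiv ℝ F p v :=
  (hF.fderiv_right (m := ∞) le_rfl).clm_apply contDiff_const

lemma fderiv_fderiv_apply (hF : ContDiff ℝ ∞ F) (p v w : X) :
    fderiv ℝ (fun q => fderiv ℝ F q v) p w = fderiv ℝ (fderiv ℝ F) p w v := by
  have h : DifferentiableAt ℝ (fderiv ℝ F) p :=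
    ((hF.fderiv_right (m := ∞) le_rfl).differentiable (by simp)) p
  rw [(h.hasFDerivAt.clm_apply (hasFDerivAt_const v p)).fderiv]
  simp

lemma fderiv_fderiv_apply_comm (hF : ContDiff ℝ ∞ F) (p v w : X) :
    fderiv ℝ (fun q => fderiv ℝ F q v) p w = fderiv ℝ (fun q => fderiv ℝ F q w) p v := by
  rw [fderiv_fderiv_apply hF, fderiv_fderiv_apply hF]
  exact (hF.contDiffAt.isSymmSndFDerivAt (by simpa using ENat.LEInfty.out)).eq w v

end

section

variable {X : Type*} [MeasurableSpace X] {μ : Measure X} {f₁ f₂ f₃ f₄ : X → ℝ}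

lemma integral_half_add_half_sub (h₁ : Integrable f₁ μ) (h₂ : Integrable f₂ μ)
    (h₃ : Integrable f₃ μ) :
    ∫ p, (1 / 2 * f₁ p + 1 / 2 * f₂ p - f₃ p) ∂μ =
      1 / 2 * ∫ p, f₁ p ∂μ + 1 / 2 * ∫ p, f₂ p ∂μ - ∫ p, f₃ p ∂μ := by
  have h : Integrable (fun p => 1 / 2 * f₁ p + 1 / 2 * f₂ p) μ :=
    (h₁.const_mul _).add (h₂.const_mul _)
  rw [integral_sub h h₃, integral_add (h₁.const_mul _) (h₂.const_mul _), integral_const_mul,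
    integral_const_mul]

lemma integral_add_half_add_half_add (h₁ : Integrable f₁ μ) (h₂ : Integrable f₂ μ)
    (h₃ : Integrable f₃ μ) (h₄ : Integrable f₄ μ) :
    ∫ p, (f₁ p + 1 / 2 * f₂ p + 1 / 2 * f₃ p + f₄ p) ∂μ =
      ∫ p, f₁ p ∂μ + 1 / 2 * ∫ p, f₂ p ∂μ + 1 / 2 * ∫ p, f₃ p ∂μ + ∫ p, f₄ p ∂μ := by
  have h : Integrable (fun p => f₁ p + 1 / 2 * f₂ p) μ := h₁.add (h₂.const_mul _)
  have h' : Integrable (fun p => f₁ p + 1 / 2 * f₂ p + 1 / 2 * f₃ p) μ := h.add (h₃.const_mul _)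
  rw [integral_add h' h₄, integral_add h (h₃.const_mul _), integral_add h₁ (h₂.const_mul _),
    integral_const_mul, integral_const_mul]

end

variable {E : Type*} [NormedAddCommGroup E] [InnerProductSpace ℝ E] [FiniteDimensional ℝ E]
  [MeasurableSpace E] [BorelSpace E]

/-- The spatial Laplacian as iterated directional derivatives on space-time. -/
lemma laplacian_slice {F : ℝ × E → ℝ} (hF : ContDiff ℝ ∞ F) {ι : Type*} [Fintype ι]
    (b : OrthonormalBasis ι ℝ E) (t : ℝ) (x : E) :
    Laplacian.laplacian (fun y => F (t, y)) x =
      ∑ j, fderiv ℝ (fun q => fderiv ℝ F q (0, b j)) (t, x) (0, b j) := by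
  have hFt : ContDiff ℝ ∞ fun y : E => F (t, y) := hF.comp (contDiff_const.prodMk contDiff_id)
  rw [InnerProductSpace.laplacian_eq_iteratedFDeriv_orthonormalBasis _ b]
  refine Finset.sum_congr rfl fun j _ => ?_
  rw [iteratedFDeriv_two_apply]
  simp only [Matrix.cons_val_zero, Matrix.cons_val_one]
  rw [← fderiv_fderiv_apply hFt]
  have h1 : (fun y => fderiv ℝ (fun y => F (t, y)) y (b j)) =
      fun y => fderiv ℝ F (t, y) (0, b j) := by
    funext y
    exact fderiv_slice ((hF.differentiable (by simp)) _) _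
  rw [h1]
  exact fderiv_slice (F := fun q => fderiv ℝ F q (0, b j))
    (((contDiff_fderiv_apply hF _).differentiable (by simp)) _) _

variable {V f : E → ℝ} {M B κ : ℝ}

/-- The weak form of the forced Burgers equation: the weak equation for `log φ` is tested with a
derivative of the test function, and derivatives are then moved from `log φ` to the velocity. -/
lemma integral_burgers_eq_zero (hVd : ContDiff ℝ 1 V) (hfc : Continuous f)
    (hV : ∀ x, |V x| ≤ M) (hf : ∀ x, |f x| ≤ B) (hκ : 0 < κ)
    (hpos : ∀ t, 0 ≤ t → ∀ x, κ ≤ schrodingerFlow V f t x) {F : ℝ × E → ℝ}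
    (hF : ContDiff ℝ ∞ F) (hFs : HasCompactSupport F) (hFU : tsupport F ⊆ Ioi 0 ×ˢ univ)
    {ι : Type*} [Fintype ι] (b : OrthonormalBasis ι ℝ E) (e : E) :
    ∫ p : ℝ × E, ((inner ℝ (velocity V f p.1 p.2) e : ℝ) * fderiv ℝ F p (1, 0) +
      1 / 2 * ‖velocity V f p.1 p.2‖ ^ 2 * fderiv ℝ F p (0, e) +
      1 / 2 * (inner ℝ (velocity V f p.1 p.2) e : ℝ) *
        (∑ j, fderiv ℝ (fun q => fderiv ℝ F q (0, b j)) p (0, b j)) +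
      fderiv ℝ V p.2 e * F p) = 0 := by
  have hVc := hVd.continuous
  have hu := continuousOn_velocity hVc hfc hV hf hκ hpos
  have hD : ∀ {G : ℝ × E → ℝ}, ContDiff ℝ ∞ G → ∀ w, ContDiff ℝ ∞ fun p => fderiv ℝ G p w :=
    fun hG w => contDiff_fderiv_apply hG w
  have h1 : ∀ {G : ℝ × E → ℝ}, ContDiff ℝ ∞ G → ContDiff ℝ 1 G := fun hG => hG.of_le (by simp)
  have hDs : ∀ {G : ℝ × E → ℝ}, HasCompactSupport G → ∀ w,
    HasCompactSupport fun p => fderiv ℝ G p w := fun hG w => hG.fderiv_apply ℝ w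
  have hDU : ∀ {G : ℝ × E → ℝ}, tsupport G ⊆ Ioi (0 : ℝ) ×ˢ (univ : Set E) → ∀ w,
      tsupport (fun p => fderiv ℝ G p w) ⊆ Ioi (0 : ℝ) ×ˢ (univ : Set E) := fun hG w =>
    (tsupport_fderiv_apply_subset ℝ w).trans hG
  have hint : ∀ {G : ℝ × E → ℝ} {a : ℝ × E → ℝ}, ContDiff ℝ ∞ G → HasCompactSupport G →
      tsupport G ⊆ Ioi (0 : ℝ) ×ˢ (univ : Set E) →
      ContinuousOn a (Ioi (0 : ℝ) ×ˢ (univ : Set E)) → Integrable fun p => a p * G p := by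
    intro G a hG hGs hGU ha
    refine integrable_of_continuousOn_of_eq_zero (ha.mul hG.continuous.continuousOn)
      hGs.isCompact hGU fun p hp => ?_
    simp [image_eq_zero_of_notMem_tsupport hp]
  have hue : ∀ v : E, ContinuousOn (fun p : ℝ × E => (inner ℝ (velocity V f p.1 p.2) v : ℝ))
      (Ioi 0 ×ˢ univ) := fun v => hu.inner continuousOn_const
  have hgrad : ∀ {G : ℝ × E → ℝ}, ContDiff ℝ ∞ G → HasCompactSupport G →
      tsupport G ⊆ Ioi (0 : ℝ) ×ˢ (univ : Set E) → ∀ v,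
      ∫ p, fderiv ℝ G p (0, v) * logFlow V f p =
        ∫ p : ℝ × E, (inner ℝ (velocity V f p.1 p.2) v : ℝ) * G p := by
    intro G hG hGs hGU v
    rw [integral_fderiv_mul_logFlow_eq_integral_inner hVc hfc hV hf hκ hpos (h1 hG) hGs hGU]
    simp only [mul_comm]
  -- The equation for `log φ` tested with `∂ₑ F` is the `e`-component of the Burgers equation.
  have hlog := integral_fderiv_mul_logFlow hVc hfc hV hf hκ hpos (h1 (hD hF (0, e)))
    (hDs hFs (0, e)) (hDU hFU (0, e))
  have htime : ∫ p, fderiv ℝ (fun q => fderiv ℝ F q (0, e)) p (1, 0) * logFlow V f p =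
      ∫ p : ℝ × E, (inner ℝ (velocity V f p.1 p.2) e : ℝ) * fderiv ℝ F p (1, 0) := by
    rw [← hgrad (hD hF (1, 0)) (hDs hFs (1, 0)) (hDU hFU (1, 0))]
    simp only [fderiv_fderiv_apply_comm hF _ (0, e) (1, 0)]
  have hspace : ∀ j, ∫ p : ℝ × E, (inner ℝ (velocity V f p.1 p.2) (b j) : ℝ) *
        fderiv ℝ (fun q => fderiv ℝ F q (0, e)) p (0, b j) =
      ∫ p : ℝ × E, (inner ℝ (velocity V f p.1 p.2) e : ℝ) *
        fderiv ℝ (fun q => fderiv ℝ F q (0, b j)) p (0, b j) := by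
    intro j
    have hcomm : (fun q => fderiv ℝ (fun q => fderiv ℝ F q (0, e)) q (0, b j)) =
        fun q => fderiv ℝ (fun q => fderiv ℝ F q (0, b j)) q (0, e) := by
      funext q
      exact fderiv_fderiv_apply_comm hF _ _ _
    rw [← hgrad (hD (hD hF (0, e)) (0, b j)) (hDs (hDs hFs _) _) (hDU (hDU hFU _) _), hcomm,
      ← hgrad (hD (hD hF (0, b j)) (0, b j)) (hDs (hDs hFs _) _) (hDU (hDU hFU _) _)]
    simp only [fderiv_fderiv_apply_comm (hD hF (0, b j)) _ (0, e) (0, b j)]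
  have hpot := integral_fderiv_mul_comp_snd hVd (h1 hF) hFs e
  have hexp : ∀ p : ℝ × E,
      fderiv ℝ (fun q => fderiv ℝ F q (0, e)) p (0, velocity V f p.1 p.2) =
      ∑ j, (inner ℝ (velocity V f p.1 p.2) (b j) : ℝ) *
        fderiv ℝ (fun q => fderiv ℝ F q (0, e)) p (0, b j) := by
    intro p
    have h2 : ((0 : ℝ), velocity V f p.1 p.2) =
        ∑ j, (inner ℝ (velocity V f p.1 p.2) (b j) : ℝ) • ((0 : ℝ), b j) := by
      conv_lhs => rw [← b.sum_repr' (velocity V f p.1 p.2)]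
      ext
      · simp [Prod.fst_sum]
      · simp [Prod.snd_sum, real_inner_comm]
    rw [h2, map_sum]
    simp only [map_smul, smul_eq_mul]
  have hi1 := hint (hD hF (1, 0)) (hDs hFs _) (hDU hFU _) (hue e)
  have hi2 : Integrable fun p : ℝ × E =>
      ‖velocity V f p.1 p.2‖ ^ 2 * fderiv ℝ F p (0, e) :=
    hint (hD hF (0, e)) (hDs hFs _) (hDU hFU _) (hu.norm.pow 2)
  have hi3 : ∀ j, Integrable fun p : ℝ × E => (inner ℝ (velocity V f p.1 p.2) e : ℝ) *
        fderiv ℝ (fun q => fderiv ℝ F q (0, b j)) p (0, b j) := fun j =>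
    hint (hD (hD hF _) _) (hDs (hDs hFs _) _) (hDU (hDU hFU _) _) (hue e)
  have hi3' : ∀ j, Integrable fun p : ℝ × E => (inner ℝ (velocity V f p.1 p.2) (b j) : ℝ) *
        fderiv ℝ (fun q => fderiv ℝ F q (0, e)) p (0, b j) := fun j =>
    hint (hD (hD hF _) _) (hDs (hDs hFs _) _) (hDU (hDU hFU _) _) (hue _)
  have hi4 : Integrable fun p : ℝ × E => fderiv ℝ V p.2 e * F p :=
    hint hF hFs hFU (((hVd.continuous_fderiv one_ne_zero).comp
      continuous_snd).clm_apply continuous_const).continuousOn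
  have hi4' : Integrable fun p : ℝ × E => V p.2 * fderiv ℝ F p (0, e) :=
    hint (hD hF _) (hDs hFs _) (hDU hFU _) (hVc.comp continuous_snd).continuousOn
  have hL : ∫ p : ℝ × E, (1 / 2 * fderiv ℝ (fun q => fderiv ℝ F q (0, e)) p
        (0, velocity V f p.1 p.2) +
      1 / 2 * (fderiv ℝ F p (0, e) * ‖velocity V f p.1 p.2‖ ^ 2) - fderiv ℝ F p (0, e) * V p.2) =
      1 / 2 * (∑ j, ∫ p : ℝ × E, (inner ℝ (velocity V f p.1 p.2) (b j) : ℝ) *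
        fderiv ℝ (fun q => fderiv ℝ F q (0, e)) p (0, b j)) +
      1 / 2 * (∫ p : ℝ × E, ‖velocity V f p.1 p.2‖ ^ 2 * fderiv ℝ F p (0, e)) -
      ∫ p : ℝ × E, V p.2 * fderiv ℝ F p (0, e) := by
    simp only [hexp]
    rw [← integral_finsetSum _ fun j _ => hi3' j,
      ← integral_half_add_half_sub (integrable_finsetSum _ fun j _ => hi3' j) hi2 hi4']
    refine integral_congr_ae (Eventually.of_forall fun p => ?_)
    ring
  have hR : ∫ p : ℝ × E, ((inner ℝ (velocity V f p.1 p.2) e : ℝ) * fderiv ℝ F p (1, 0) +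
      1 / 2 * ‖velocity V f p.1 p.2‖ ^ 2 * fderiv ℝ F p (0, e) +
      1 / 2 * (inner ℝ (velocity V f p.1 p.2) e : ℝ) *
        (∑ j, fderiv ℝ (fun q => fderiv ℝ F q (0, b j)) p (0, b j)) +
      fderiv ℝ V p.2 e * F p) =
      (∫ p : ℝ × E, (inner ℝ (velocity V f p.1 p.2) e : ℝ) * fderiv ℝ F p (1, 0)) +
      1 / 2 * (∫ p : ℝ × E, ‖velocity V f p.1 p.2‖ ^ 2 * fderiv ℝ F p (0, e)) +
      1 / 2 * (∑ j, ∫ p : ℝ × E, (inner ℝ (velocity V f p.1 p.2) e : ℝ) *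
        fderiv ℝ (fun q => fderiv ℝ F q (0, b j)) p (0, b j)) +
      ∫ p : ℝ × E, fderiv ℝ V p.2 e * F p := by
    rw [← integral_finsetSum _ fun j _ => hi3 j,
      ← integral_add_half_add_half_add hi1 hi2 (integrable_finsetSum _ fun j _ => hi3 j) hi4]
    refine integral_congr_ae (Eventually.of_forall fun p => ?_)
    simp only [← Finset.mul_sum]
    ring
  have hpot' : ∫ p : ℝ × E, V p.2 * fderiv ℝ F p (0, e) = -∫ p : ℝ × E, fderiv ℝ V p.2 e * F p := by
    rw [← hpot]
    simp only [mul_comm]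
  rw [hR]
  rw [hL, htime, hpot'] at hlog
  simp only [hspace] at hlog
  linarith

end

/-! ### The Cole–Hopf transform and its long-time limit -/

section

variable {E : Type*} [NormedAddCommGroup E] [InnerProductSpace ℝ E] [FiniteDimensional ℝ E]
  [MeasurableSpace E] [BorelSpace E] {V f : E → ℝ} {M B κ : ℝ}

lemma schrodingerFlow_zero (hVm : Measurable V) (hfm : Measurable f)
    (hV : ∀ x, |V x| ≤ M) (hf : ∀ x, |f x| ≤ B) (x : E) : schrodingerFlow V f 0 x = f x := by
  rw [schrodingerFlow_eq hVm hfm hV hf, heatFlow_of_nonpos le_rfl, duhamel,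
    intervalIntegral.integral_same, sub_zero]

/-- A continuous function is bounded by its essential supremum at every point, as volume charges
every nonempty open set. -/
lemma enorm_le_eLpNorm_top {F : Type*} [NormedAddCommGroup F] {g : E → F} (hg : Continuous g)
    (x : E) : ‖g x‖ₑ ≤ eLpNorm g ∞ volume := by
  rw [eLpNorm_exponent_top]
  have hd : Dense {y | ‖g y‖ₑ ≤ eLpNormEssSup g volume} :=
    Measure.dense_of_ae (ae_le_eLpNormEssSup (μ := (volume : Measure E)) (f := g))
  have hc : IsClosed {y | ‖g y‖ₑ ≤ eLpNormEssSup g volume} :=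
    isClosed_le hg.enorm continuous_const
  have h : x ∈ closure {y | ‖g y‖ₑ ≤ eLpNormEssSup g volume} := hd x
  rwa [hc.closure_eq] at h

/-- The initial value of the velocity, jointly in `t ↓ 0` and in the space variable. -/
lemma tendsto_velocity (hVc : Continuous V) (hfd : ContDiff ℝ 1 f)
    (hV : ∀ x, |V x| ≤ M) (hf : ∀ x, |f x| ≤ B) {x : E} (hfx : f x ≠ 0) :
    Tendsto (fun p : ℝ × E => velocity V f p.1 p.2) (𝓝[>] 0 ×ˢ 𝓝 x)
      (𝓝 (-((f x)⁻¹ • gradient f x))) := by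
  have h1 : Tendsto (fun p : ℝ × E => schrodingerFlow V f p.1 p.2) (𝓝[>] 0 ×ˢ 𝓝 x)
      (𝓝 (f x)) := by
    have h := (continuous_schrodingerFlow hVc hfd.continuous hV hf).tendsto (0, x)
    rw [nhds_prod_eq, Function.uncurry_apply_pair,
      schrodingerFlow_zero hVc.measurable hfd.continuous.measurable hV hf] at h
    exact h.mono_left (prod_mono nhdsWithin_le_nhds le_rfl)
  exact ((h1.inv₀ hfx).smul (tendsto_schrodingerGrad hfd hV hf x)).neg

lemma gradient_exp_neg {ψ : E → ℝ} (hψ : ContDiff ℝ 1 ψ) (x : E) :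
    gradient (fun y => Real.exp (-ψ y)) x = -(Real.exp (-ψ x) • gradient ψ x) := by
  refine HasGradientAt.gradient ?_
  have h := ((hψ.differentiable one_ne_zero) x).hasGradientAt.hasFDerivAt.neg.exp
  rw [hasGradientAt_iff_hasFDerivAt]
  refine h.congr_fderiv ?_
  ext v
  simp

section

variable {ν : ℕ} {V ψ₀ : EuclideanSpace ℝ (Fin ν) → ℝ} {g w : EuclideanSpace ℝ (Fin ν) → ℝ}

/-- The difference of two logarithmic gradients is the logarithmic gradient of the quotient. -/
lemma negLogGrad_sub_negLogGrad {x : EuclideanSpace ℝ (Fin ν)} (hg : DifferentiableAt ℝ g x)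
    (hw : DifferentiableAt ℝ w x) (hgx : g x ≠ 0) (hwx : w x ≠ 0) :
    negLogGrad g x - negLogGrad w x = negLogGrad (fun y => g y / w y) x := by
  rw [negLogGrad, negLogGrad, negLogGrad,
    (hasGradientAt_div hg.hasGradientAt hw.hasGradientAt hwx).gradient]
  match_scalars <;> field_simp

lemma enorm_negLogGrad_le {c : ℝ} (hg : ContDiff ℝ 1 g) (hc : 0 < c) (hcg : ∀ x, c ≤ g x)
    (x : EuclideanSpace ℝ (Fin ν)) :
    ‖negLogGrad g x‖ₑ ≤ ENNReal.ofReal c⁻¹ * eLpNorm (gradient g) ∞ volume := by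
  rw [negLogGrad, enorm_neg, enorm_smul]
  gcongr
  · rw [Real.enorm_of_nonneg (inv_nonneg.2 (hc.le.trans (hcg x)))]
    exact ENNReal.ofReal_le_ofReal (inv_anti₀ hc (hcg x))
  · exact enorm_le_eLpNorm_top (continuous_gradient hg) x

lemma negLogGrad_colePhi {M B t : ℝ} (hVc : Continuous V) (hψ : Continuous ψ₀)
    (hV : ∀ x, |V x| ≤ M) (hf : ∀ x, |Real.exp (-ψ₀ x)| ≤ B) (ht : 0 < t) :
    negLogGrad (colePhi V ψ₀ t) = velocity V (fun y => Real.exp (-ψ₀ y)) t := by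
  funext x
  rw [negLogGrad, velocity, colePhi, schrodingerSemigroup_eq_schrodingerFlow _ _ ht,
    gradient_schrodingerFlow hVc (by fun_prop) hV hf ht]

/-- The Cole–Hopf transform of a uniformly positive `φ` solves the forced Burgers equation. -/
lemma isBurgersSolution_negLogGrad_colePhi {M B κ : ℝ} (hVd : ContDiff ℝ 1 V)
    (hψ : ContDiff ℝ 1 ψ₀) (hV : ∀ x, |V x| ≤ M) (hf : ∀ x, |Real.exp (-ψ₀ x)| ≤ B) (hκ : 0 < κ)
    (hpos : ∀ t, 0 ≤ t → ∀ x, κ ≤ schrodingerFlow V (fun y => Real.exp (-ψ₀ y)) t x) :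
    IsBurgersSolution V (gradient ψ₀) (fun t => negLogGrad (colePhi V ψ₀ t)) := by
  have hVc := hVd.continuous
  have hfd : ContDiff ℝ 1 fun y => Real.exp (-ψ₀ y) := hψ.neg.exp
  have hu : ∀ t, 0 < t → negLogGrad (colePhi V ψ₀ t) =
      velocity V (fun y => Real.exp (-ψ₀ y)) t := fun t ht =>
    negLogGrad_colePhi hVc hψ.continuous hV hf ht
  refine ⟨?_, fun i η hη hηs hηU => ?_, ?_⟩
  · refine (continuousOn_velocity hVc hfd.continuous hV hf hκ hpos).congr ?_
    rintro p ⟨hp, -⟩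
    simp only [hu p.1 hp]
  · have h0 := integral_burgers_eq_zero hVd hfd.continuous hV hf hκ hpos hη hηs hηU
      (EuclideanSpace.basisFun (Fin ν) ℝ) (EuclideanSpace.single i 1)
    rw [← h0]
    refine integral_congr_ae (Eventually.of_forall fun p => ?_)
    have hd : DifferentiableAt ℝ (Function.uncurry η) p := (hη.differentiable (by simp)) p
    have htime : deriv (fun s => η s p.2) p.1 = fderiv ℝ (Function.uncurry η) p (1, 0) :=
      (HasFDerivAt.comp_hasDerivAt (f := fun s => (s, p.2)) p.1 hd.hasFDerivAt
        ((hasDerivAt_id p.1).prodMk (hasDerivAt_const p.1 p.2))).deriv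
    have hspace : partialDeriv i (η p.1) p.2 =
        fderiv ℝ (Function.uncurry η) p (0, EuclideanSpace.single i 1) :=
      fderiv_slice (F := Function.uncurry η) hd _
    have hlap : Laplacian.laplacian (η p.1) p.2 = _ :=
      laplacian_slice hη (EuclideanSpace.basisFun (Fin ν) ℝ) p.1 p.2
    simp only [htime, hspace, hlap]
    by_cases hp : p ∈ tsupport (Function.uncurry η)
    · simp only [hu p.1 (hηU hp).1, partialDeriv, EuclideanSpace.inner_single_right,
        Function.uncurry]
      simp
    -- Off the support, where `t ≤ 0` is possible, all terms vanish.
    · have hz : ∀ v, fderiv ℝ (Function.uncurry η) p v = 0 := fun v => by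
        rw [image_eq_zero_of_notMem_tsupport
          fun h => hp (tsupport_fderiv_subset ℝ h), zero_apply]
      have hz2 : ∀ v, fderiv ℝ (fun q => fderiv ℝ (Function.uncurry η) q v) p v = 0 := fun v => by
        rw [image_eq_zero_of_notMem_tsupport (f := fderiv ℝ _) fun h =>
          hp (tsupport_fderiv_apply_subset ℝ v (tsupport_fderiv_subset ℝ h)),
          zero_apply]
      have hz0 : Function.uncurry η p = 0 := image_eq_zero_of_notMem_tsupport hp
      have hz0' : η p.1 p.2 = 0 := hz0
      simp [hz, hz2, hz0, hz0']
  · rw [tendstoLocallyUniformly_iff_forall_tendsto]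
    intro x
    have hlim : Tendsto (fun p : ℝ × EuclideanSpace ℝ (Fin ν) =>
        negLogGrad (colePhi V ψ₀ p.1) p.2) (𝓝[>] 0 ×ˢ 𝓝 x) (𝓝 (gradient ψ₀ x)) := by
      have h := tendsto_velocity hVc hfd hV hf (x := x) (Real.exp_pos _).ne'
      rw [gradient_exp_neg hψ, smul_neg, neg_neg, inv_smul_smul₀ (Real.exp_pos _).ne'] at h
      refine h.congr' ?_
      filter_upwards [prod_mem_prod (self_mem_nhdsWithin (s := Ioi (0 : ℝ)) (a := 0))
        (univ_mem (f := 𝓝 x))] with p hp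
      rw [hu p.1 hp.1]
    have hlim0 : Tendsto (fun p : ℝ × EuclideanSpace ℝ (Fin ν) => gradient ψ₀ p.2)
        (𝓝[>] 0 ×ˢ 𝓝 x) (𝓝 (gradient ψ₀ x)) :=
      ((continuous_gradient hψ).tendsto x).comp tendsto_snd
    refine (hlim0.prodMk_nhds hlim).mono_right ?_
    exact nhds_le_uniformity _

end

end

end ForcedBurgers

end

theorem theorem2p1 {ν : ℕ} (V : EuclideanSpace ℝ (Fin ν) → ℝ)
    (hV : ContDiff ℝ 1 V) (hVb : ∃ M : ℝ, ∀ x, |V x| ≤ M)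
    (ψ₀ : EuclideanSpace ℝ (Fin ν) → ℝ)
    (hψ₀ : ContDiff ℝ 1 ψ₀) (hψ₀b : ∃ M : ℝ, ∀ x, |ψ₀ x| ≤ M)
    (Ω : EuclideanSpace ℝ (Fin ν) → ℝ) (hΩm : Measurable Ω)
    (a b : ℝ) (ha : 0 < a) (hΩab : ∀ x, a ≤ Ω x ∧ Ω x ≤ b)
    (hΩ : ∀ t : ℝ, 0 < t → ∀ x, ForcedBurgers.schrodingerSemigroup V t Ω x = Ω x)
    (hgrad : Tendsto
      (fun t : ℝ =>
        eLpNorm (gradient (fun x => ForcedBurgers.colePhi V ψ₀ t x / Ω x)) ∞ volume)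
      atTop (𝓝 0)) :
    -- the gradients are classical, and `φ > 0`
    ContDiff ℝ 1 Ω ∧
    (∀ t : ℝ, 0 < t → ContDiff ℝ 1 (ForcedBurgers.colePhi V ψ₀ t) ∧
      ∀ x, 0 < ForcedBurgers.colePhi V ψ₀ t x) ∧
    -- `u = -φ⁻¹ ∇φ` is a solution of the Burgers equation with initial data `∇ψ₀`
    ForcedBurgers.IsBurgersSolution V (gradient ψ₀)
      (fun t => ForcedBurgers.negLogGrad (ForcedBurgers.colePhi V ψ₀ t)) ∧
    -- uniform convergence of `u` to `-∇Ω / Ω`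
    Tendsto
      (fun t : ℝ =>
        ⨆ x, ‖ForcedBurgers.negLogGrad (ForcedBurgers.colePhi V ψ₀ t) x
          - ForcedBurgers.negLogGrad Ω x‖ₑ)
      atTop (𝓝 0) := by
  open ForcedBurgers in
    obtain ⟨M, hM⟩ := hVb
    obtain ⟨K, hK⟩ := hψ₀b
    set f : EuclideanSpace ℝ (Fin ν) → ℝ := fun y => Real.exp (-ψ₀ y) with hf
    have hVc := hV.continuous
    have hfc : Continuous f := by
      have := hψ₀.continuous
      fun_prop
    have hfb : ∀ x, |f x| ≤ Real.exp K := fun x => by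
      rw [hf, abs_of_pos (Real.exp_pos _)]
      exact Real.exp_le_exp.2 (neg_le.1 (neg_le_of_abs_le (hK x)))
    have hfK : ∀ x, Real.exp (-K) ≤ f x := fun x =>
      Real.exp_le_exp.2 (neg_le_neg (le_of_abs_le (hK x)))
    have hφ : ∀ t, 0 < t → colePhi V ψ₀ t = schrodingerFlow V f t := fun t ht =>
      schrodingerSemigroup_eq_schrodingerFlow V f ht
    have hΩflow : ∀ t, 0 < t → schrodingerFlow V Ω t = Ω := fun t ht => by
      rw [← schrodingerSemigroup_eq_schrodingerFlow V Ω ht]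
      exact funext (hΩ t ht)
    have hΩpos : ∀ x, 0 < Ω x := fun x => ha.trans_le (hΩab x).1
    have hb : 0 < b := (hΩpos 0).trans_le (hΩab 0).2
    have hΩb : ∀ x, |Ω x| ≤ b := fun x => by
      rw [abs_of_pos (hΩpos x)]
      exact (hΩab x).2
    -- The fixed point property smooths `Ω` twice: first to continuity, then to `C¹`.
    have hΩc : Continuous Ω := by
      rw [continuous_iff_continuousAt]
      intro x
      have h := hasGradientAt_schrodingerFlow hVc.measurable hΩm hM hΩb one_pos x
      rw [hΩflow 1 one_pos] at h
      exact h.hasFDerivAt.continuousAt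
    have hΩd : ContDiff ℝ 1 Ω := by
      have h := contDiff_schrodingerFlow hVc hΩc hM hΩb one_pos
      rwa [hΩflow 1 one_pos] at h
    have hφd : ∀ t, 0 < t → ContDiff ℝ 1 (colePhi V ψ₀ t) := fun t ht => by
      rw [hφ t ht]
      exact contDiff_schrodingerFlow hVc hfc hM hfb ht
    -- Comparison with the stationary solution `c Ω ≤ φ₀`.
    have hc : 0 < Real.exp (-K) / b := div_pos (Real.exp_pos _) hb
    have hcf : ∀ x, Real.exp (-K) / b * Ω x ≤ f x := fun x => by
      refine le_trans ?_ (hfK x)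
      rw [div_mul_eq_mul_div, div_le_iff₀ hb]
      exact mul_le_mul_of_nonneg_left (hΩab x).2 (Real.exp_pos _).le
    have hcφ : ∀ t, 0 ≤ t → ∀ x, Real.exp (-K) / b * Ω x ≤ schrodingerFlow V f t x := by
      intro t ht x
      rcases ht.eq_or_lt with rfl | ht'
      · rw [schrodingerFlow_zero hVc.measurable hfc.measurable hM hfb]
        exact hcf x
      · have h := const_mul_schrodingerFlow_le hVc.measurable hfc.measurable hΩm hM hfb hΩb hcf ht x
        rwa [hΩflow t ht'] at h
    have hκ : 0 < Real.exp (-K) / b * a := mul_pos hc ha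
    have hpos : ∀ t, 0 ≤ t → ∀ x, Real.exp (-K) / b * a ≤ schrodingerFlow V f t x := fun t ht x =>
      (mul_le_mul_of_nonneg_left (hΩab x).1 hc.le).trans (hcφ t ht x)
    have hφpos : ∀ t, 0 < t → ∀ x, 0 < colePhi V ψ₀ t x := fun t ht x => by
      rw [hφ t ht]
      exact hκ.trans_le (hpos t ht.le x)
    refine ⟨hΩd, fun t ht => ⟨hφd t ht, hφpos t ht⟩,
      isBurgersSolution_negLogGrad_colePhi hV hψ₀ hM hfb hκ hpos, ?_⟩
    have hbound : Tendsto (fun t : ℝ => ENNReal.ofReal (Real.exp (-K) / b)⁻¹ *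
        eLpNorm (gradient (fun x => colePhi V ψ₀ t x / Ω x)) ∞ volume) atTop (𝓝 0) := by
      have h := ENNReal.Tendsto.const_mul (a := ENNReal.ofReal (Real.exp (-K) / b)⁻¹) hgrad
        (Or.inr ENNReal.ofReal_ne_top)
      rwa [mul_zero] at h
    refine tendsto_of_tendsto_of_tendsto_of_le_of_le' tendsto_const_nhds hbound
      (Eventually.of_forall fun t => zero_le) ?_
    filter_upwards [eventually_gt_atTop 0] with t ht
    refine iSup_le fun x => ?_
    rw [negLogGrad_sub_negLogGrad ((hφd t ht).differentiable one_ne_zero x)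
      (hΩd.differentiable one_ne_zero x) (hφpos t ht x).ne' (hΩpos x).ne']
    refine enorm_negLogGrad_le ((hφd t ht).div hΩd fun y => (hΩpos y).ne') hc (fun y => ?_) x
    rw [Pi.div_apply, le_div_iff₀ (hΩpos y), hφ t ht]
    exact hcφ t ht.le y
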